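/- Model. For $g,h,m\ge 1$ consider $$y_{ijk}=\mu_{ijk}+\alpha_i+\beta_j+\gamma_{ij}+e_{ijk},\qquad \mu_{ijk}=\xi_0+x_i^{(a)T}\xi_1+x_j^{(b)T}\xi_2+x_{ij}^{(ab)T}\xi_3+x_{ijk}^{(w)T}\xi_4,$$ $1\le i\le g$, $1\le j\le h$, $1\le k\le m$, where $x_i^{(a)}\in\mathbb R^{p_a}$, $x_j^{(b)}\in\mathbb R^{p_b}$, $x_{ij}^{(ab)}\in\mathbb R^{p_{ab}}$, $x_{ijk}^{(w)}\in\mathbb R^{p_w}$ are non-random, taken from infinite arrays that do not depend on $(g,h,m)$ (any of the dimensions may be $0$). Put $\xi=(\xi_0,\xi_1,\xi_2,\xi_3,\xi_4)$, $\theta=(\sigma_\alpha^2,\sigma_\beta^2,\sigma_\gamma^2,\sigma_e^2)$, $\omega=(\xi,\theta)$; the parameter space is $\{\sigma_\alpha^2,\sigma_\beta^2,\sigma_\gamma^2\ge 0,\ \sigma_e^2>0\}$ with $\xi$ arbitrary. Bars and dots denote averages: $\bar x^{(a)}=g^{-1}\sum_{i\le g}x_i^{(a)}$, $\bar x^{(ab)}_{i.}=h^{-1}\sum_{j\le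 h}x^{(ab)}_{ij}$, $\bar x^{(w)}_{ij}=m^{-1}\sum_{k\le m}x^{(w)}_{ijk}$, $\bar x^{(w)}_{i.}=h^{-1}\sum_{j\le h}\bar x_{ij}^{(w)}$, and so on; $\bar\gamma_{i.}=h^{-1}\sum_{j\le h}\gamma_{ij}$, $\bar\gamma_{.j}=g^{-1}\sum_{i\le g}\gamma_{ij}$, $\bar e_{ij}=m^{-1}\sum_{k\le m}e_{ijk}$. The subscript $(c)$ denotes centring: $x_{i(c)}^{(a)}=x_i^{(a)}-\bar x^{(a)}$, $x_{j(c)}^{(b)}=x_j^{(b)}-\bar x^{(b)}$, $\bar x_{i.(c)}=\bar x_{i.}-\bar x$, $\bar x_{.j(c)}=\bar x_{.j}-\bar x$, $x^{(ab)}_{ij(c)}=x^{(ab)}_{ij}-\bar x^{(ab)}_{i.}-\bar x^{(ab)}_{.j}+\bar x^{(ab)}$, $\bar x^{(w)}_{ij(c)}=\bar x^{(w)}_{ij}-\bar x^{(w)}_{i.}-\bar x^{(w)}_{.j}+\bar x^{(w)}$, $x^{(w)}_{ijk(c)}=x^{(w)}_{ijk}-\bar x^{(w)}_{ij}$. Assumptions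 (Condition B). 1. The model holds with true parameter $\dot\omega=(\dot\xi,\dot\theta)$ in the interior of the parameter space. 2. The sizes are $g=g_t$, $h=h_t$, $m=m_t$ with $g_t,h_t,m_t\to\infty$ as $t\to\infty$, at arbitrary relative rates. 3. All variables $\alpha_i,\beta_j,\gamma_{ij},e_{ijk}$ are independent, identically distributed within each of the four families, with mean $0$ and variances $\dot\sigma_\alpha^2,\dot\sigma_\beta^2,\dot\sigma_\gamma^2,\dot\sigma_e^2$, and for some $\delta>0$ have finite absolute moments of order $4+\delta$. Normality is not assumed. 4. The limits of $g^{-1}\sum_{i\le g}x_i^{(a)}$ ($g\to\infty$) and $h^{-1}\sum_{j\le h}x_j^{(b)}$ ($h\to\infty$) exist. With $X^{(a)}_{i(c)}=[x^{(a)T}_{i(c)},\bar x^{(ab)T}_{i.(c)},\bar x^{(w)T}_{i.(c)}]^T$, $X^{(b)}_{j(c)}=[x^{(b)T}_{j(c)},\bar x^{(ab)T}_{.j(c)},\bar x^{(w)T}_{.j(c)}]^T$ and $X^{(ab)}_{ij(c)}=[x^{(ab)T}_{ij(c)},\bar x^{(w)T}_{ij(c)}]^T$, the matrices $$\tfrac1g\sum_i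 X^{(a)}_{i(c)}X^{(a)T}_{i(c)},\quad \tfrac1h\sum_j X^{(b)}_{j(c)}X^{(b)T}_{j(c)},\quad \tfrac1{gh}\sum_{i,j} X^{(ab)}_{ij(c)}X^{(ab)T}_{ij(c)},\quad \tfrac1{ghm}\sum_{i,j,k} x^{(w)}_{ijk(c)}x^{(w)T}_{ijk(c)}$$ converge to positive definite limits as $g,h,m\to\infty$ jointly, without restriction on the relative rates. For some $\delta>0$ the averages of $|x^{(a)}_{i(c)}|^{2+\delta}$ over $i\le g$, of $|x^{(b)}_{j(c)}|^{2+\delta}$ over $j\le h$, of $|x^{(ab)}_{ij(c)}|^{2+\delta}$ over $i\le g,j\le h$, and of $|x^{(w)}_{ijk(c)}|^{2+\delta}$ over all $i,j,k$ stay bounded as the sizes involved tend jointly to infinity. Put $D_1=\lim_{g\to\infty} g^{-1}\sum_{i\le g}x^{(a)}_{i(c)}x^{(a)T}_{i(c)}$, $D_2=\lim_{h\to\infty} h^{-1}\sum_{j\le h}x^{(b)}_{j(c)}x^{(b)T}_{j(c)}$, and $H^{(a)}_{is}=1+x^{(a)T}_{i(c)}D_1^{-1}x^{(a)}_{s(c)}$,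 $H^{(b)}_{jr}=1+x^{(b)T}_{j(c)}D_2^{-1}x^{(b)}_{r(c)}$. Estimators and EBLUPs. Write $\mu=X\xi$ in matrix form, $y=X\xi+Zu+e$ with $u=(\alpha,\beta,\gamma)$, $G(\theta)=\operatorname{Var}(u)$ and $V(\theta)=\sigma_e^2I+ZG(\theta)Z^T=\operatorname{Var}(y)$. The normal maximum likelihood (ML) estimating equations are the vanishing of the gradient in $\omega$ of $$\ell(\xi,\theta)=-\tfrac{ghm}2\log 2\pi-\tfrac12\log\det V(\theta)-\tfrac12(y-X\xi)^TV(\theta)^{-1}(y-X\xi).$$ The normal REML estimating equations are the vanishing of the gradient in $\theta$ of $$-\tfrac12\log\det V(\theta)-\tfrac12\log\det\{X^TV(\theta)^{-1}X\}-\tfrac12(y-X\hat\xi(\theta))^TV(\theta)^{-1}(y-X\hat\xi(\theta)),$$ $\hat\xi(\theta)=\{X^TV(\theta)^{-1}X\}^{-1}X^TV(\theta)^{-1}y$, together with $\partial\ell(\xi,\theta)/\partial\xi=0$. For either system, a consistent solution is a sequence $\hat\omega=\hat\omega_t$ of functions of the data such that, with probability tending to one, $\hat\omega_t$ lies in the parameter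 space and solves the system, and $\hat\omega_t\to\dot\omega$ in probability. The EBLUPs $\hat\alpha_i,\hat\beta_j,\hat\gamma_{ij}$ are the corresponding coordinates of the best linear unbiased predictor $G(\theta)Z^TV(\theta)^{-1}(y-X\xi)$ evaluated at $(\xi,\theta)=\hat\omega$. Conclusion. Consistent solutions of the ML equations and of the REML equations exist, and for every consistent solution $\hat\omega$ of either system and all fixed $i,j$, as $t\to\infty$, $$\hat\alpha_i-\alpha_i=\bar\gamma_{i.}-\frac1g\sum_{s=1}^gH^{(a)}_{is}\alpha_s+o_p(g^{-1/2}+h^{-1/2}),$$ $$\hat\beta_j-\beta_j=\bar\gamma_{.j}-\frac1h\sum_{r=1}^hH^{(b)}_{jr}\beta_r+o_p(g^{-1/2}+h^{-1/2}),$$ $$\hat\gamma_{ij}-\gamma_{ij}=\bar e_{ij}-\bar\gamma_{i.}-\bar\gamma_{.j}+O_p(m^{-1})+o_p(g^{-1/2}+h^{-1/2}).$$ -/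

import Mathlib

open Filter Topology MeasureTheory ProbabilityTheory

noncomputable section

namespace CrossedModel

/-! ### Stochastic order symbols -/

/-- `R t = o_p(a t)`: for every `ε > 0`, `P(|R t| ≥ ε a t) → 0`. -/
def IsLittleOp {Ω : Type*} [MeasurableSpace Ω] (P : Measure Ω)
    (R : ℕ → Ω → ℝ) (a : ℕ → ℝ) : Prop :=
  ∀ ε : ℝ, 0 < ε → Tendsto (fun t => P {s | ε * a t ≤ |R t s|}) atTop (𝓝 0)

/-- `R t = O_p(a t)`: for every `ε > 0` there is `C` with `P(|R t| > C a t) ≤ ε` eventually. -/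
def IsBigOp {Ω : Type*} [MeasurableSpace Ω] (P : Measure Ω)
    (R : ℕ → Ω → ℝ) (a : ℕ → ℝ) : Prop :=
  ∀ ε : ℝ, 0 < ε → ∃ C : ℝ, ∀ᶠ t in atTop, P {s | C * a t < |R t s|} ≤ ENNReal.ofReal ε

/-! ### Averages and centred covariates

Rows, columns and replicates are numbered from `0`, so that a table with `g` rows, `h` columns
and `m` replicates uses the indices `i < g`, `j < h`, `k < m`. -/

/-- `n⁻¹ ∑_{i < n} f i`. -/
def avg {E : Type*} [AddCommGroup E] [Module ℝ E] (n : ℕ) (f : ℕ → E) : E :=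
  (n : ℝ)⁻¹ • ∑ i ∈ Finset.range n, f i

/-- The (non-random) row, column, interaction and within-cell covariates. -/
structure Covariates (pa pb pab pw : ℕ) where
  a : ℕ → Fin pa → ℝ
  b : ℕ → Fin pb → ℝ
  ab : ℕ → ℕ → Fin pab → ℝ
  w : ℕ → ℕ → ℕ → Fin pw → ℝ

namespace Covariates

variable {pa pb pab pw : ℕ} (x : Covariates pa pb pab pw)

/-- Row covariate minus its average over `g` rows. -/
def aC (g i : ℕ) : Fin pa → ℝ := x.a i - avg g x.a

/-- Column covariate minus its average over `h` columns. -/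
def bC (h j : ℕ) : Fin pb → ℝ := x.b j - avg h x.b

def abRow (h i : ℕ) : Fin pab → ℝ := avg h fun j => x.ab i j
def abCol (g j : ℕ) : Fin pab → ℝ := avg g fun i => x.ab i j
def abAll (g h : ℕ) : Fin pab → ℝ := avg g fun i => avg h fun j => x.ab i j

def wCell (m i j : ℕ) : Fin pw → ℝ := avg m fun k => x.w i j k
def wRow (h m i : ℕ) : Fin pw → ℝ := avg h fun j => x.wCell m i j
def wCol (g m j : ℕ) : Fin pw → ℝ := avg g fun i => x.wCell m i j
def wAll (g h m : ℕ) : Fin pw → ℝ := avg g fun i => avg h fun j => x.wCell m i j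

/-- Doubly centred interaction covariate. -/
def abC (g h i j : ℕ) : Fin pab → ℝ :=
  x.ab i j - x.abRow h i - x.abCol g j + x.abAll g h

/-- Doubly centred cell mean of the within-cell covariate. -/
def wCellC (g h m i j : ℕ) : Fin pw → ℝ :=
  x.wCell m i j - x.wRow h m i - x.wCol g m j + x.wAll g h m

/-- Within-cell covariate minus its cell mean. -/
def wC (m i j k : ℕ) : Fin pw → ℝ := x.w i j k - x.wCell m i j

/-- Stacked centred row-level covariate. -/
def XA (g h m i : ℕ) : Fin pa ⊕ Fin pab ⊕ Fin pw → ℝ :=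
  Sum.elim (x.aC g i)
    (Sum.elim (x.abRow h i - x.abAll g h) (x.wRow h m i - x.wAll g h m))

/-- Stacked centred column-level covariate. -/
def XB (g h m j : ℕ) : Fin pb ⊕ Fin pab ⊕ Fin pw → ℝ :=
  Sum.elim (x.bC h j)
    (Sum.elim (x.abCol g j - x.abAll g h) (x.wCol g m j - x.wAll g h m))

/-- Stacked centred interaction-level covariate. -/
def XAB (g h m i j : ℕ) : Fin pab ⊕ Fin pw → ℝ :=
  Sum.elim (x.abC g h i j) (x.wCellC g h m i j)

/-- `g⁻¹ ∑ x_{i(c)} x_{i(c)}ᵀ` for the row covariates. -/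
def D1hat (g : ℕ) : Matrix (Fin pa) (Fin pa) ℝ :=
  avg g fun i => Matrix.vecMulVec (x.aC g i) (x.aC g i)

/-- `h⁻¹ ∑ x_{j(c)} x_{j(c)}ᵀ` for the column covariates. -/
def D2hat (h : ℕ) : Matrix (Fin pb) (Fin pb) ℝ :=
  avg h fun j => Matrix.vecMulVec (x.bC h j) (x.bC h j)

end Covariates

/-- `M` converges, as its indices tend to infinity (jointly, at arbitrary relative rates), to a
positive definite matrix. -/
def TendstoPosDef {ι n : Type*} [Preorder ι] [Fintype n] (M : ι → Matrix n n ℝ) : Prop :=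
  ∃ L : Matrix n n ℝ, Tendsto M atTop (𝓝 L) ∧ L.PosDef

/-- `F` stays bounded above as its indices tend to infinity. -/
def EventuallyBounded {ι : Type*} [Preorder ι] (F : ι → ℝ) : Prop :=
  ∃ C : ℝ, ∀ᶠ s in atTop, F s ≤ C

/-- Euclidean norm of a vector. -/
def enorm2 {p : ℕ} (v : Fin p → ℝ) : ℝ := ‖WithLp.toLp 2 v‖

/-- The conditions on the covariates; all limits are joint limits in the table dimensions
involved, which are collected in `s = (g, h, m)` or `s = (g, h)`. -/
structure CovariateCondition {pa pb pab pw : ℕ} (x : Covariates pa pb pab pw) : Prop where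
  mean_a : ∃ l, Tendsto (fun g => avg g x.a) atTop (𝓝 l)
  mean_b : ∃ l, Tendsto (fun h => avg h x.b) atTop (𝓝 l)
  row : TendstoPosDef fun s : ℕ × ℕ × ℕ =>
    avg s.1 fun i => Matrix.vecMulVec (x.XA s.1 s.2.1 s.2.2 i) (x.XA s.1 s.2.1 s.2.2 i)
  col : TendstoPosDef fun s : ℕ × ℕ × ℕ =>
    avg s.2.1 fun j => Matrix.vecMulVec (x.XB s.1 s.2.1 s.2.2 j) (x.XB s.1 s.2.1 s.2.2 j)
  inter : TendstoPosDef fun s : ℕ × ℕ × ℕ =>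
    avg s.1 fun i => avg s.2.1 fun j =>
      Matrix.vecMulVec (x.XAB s.1 s.2.1 s.2.2 i j) (x.XAB s.1 s.2.1 s.2.2 i j)
  within : TendstoPosDef fun s : ℕ × ℕ × ℕ =>
    avg s.1 fun i => avg s.2.1 fun j => avg s.2.2 fun k =>
      Matrix.vecMulVec (x.wC s.2.2 i j k) (x.wC s.2.2 i j k)
  moment : ∃ δ : ℝ, 0 < δ ∧
    EventuallyBounded (fun g : ℕ => avg g fun i => enorm2 (x.aC g i) ^ (2 + δ)) ∧
    EventuallyBounded (fun h : ℕ => avg h fun j => enorm2 (x.bC h j) ^ (2 + δ)) ∧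
    EventuallyBounded (fun s : ℕ × ℕ =>
      avg s.1 fun i => avg s.2 fun j => enorm2 (x.abC s.1 s.2 i j) ^ (2 + δ)) ∧
    EventuallyBounded (fun s : ℕ × ℕ × ℕ =>
      avg s.1 fun i => avg s.2.1 fun j => avg s.2.2 fun k =>
        enorm2 (x.wC s.2.2 i j k) ^ (2 + δ))

/-! ### Parameters -/

/-- Index set of the fixed effects: intercept, row, column, interaction, within-cell slopes. -/
abbrev FixedIdx (pa pb pab pw : ℕ) : Type :=
  Unit ⊕ Fin pa ⊕ Fin pb ⊕ Fin pab ⊕ Fin pw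

/-- A parameter `(ξ, θ)`: fixed effects `ξ` and variance components
`θ = (σ_α², σ_β², σ_γ², σ_e²)`. -/
abbrev Param (pa pb pab pw : ℕ) : Type :=
  (FixedIdx pa pb pab pw → ℝ) × (Fin 4 → ℝ)

/-- The parameter space: arbitrary fixed effects, `σ_α², σ_β², σ_γ² ≥ 0`, `σ_e² > 0`. -/
def parameterSpace (pa pb pab pw : ℕ) : Set (Param pa pb pab pw) :=
  {ω | 0 ≤ ω.2 0 ∧ 0 ≤ ω.2 1 ∧ 0 ≤ ω.2 2 ∧ 0 < ω.2 3}

/-! ### Random terms and data -/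

/-- Row effects, column effects, interaction effects and errors. -/
structure RandomTerms (Ω : Type*) where
  α : ℕ → Ω → ℝ
  β : ℕ → Ω → ℝ
  γ : ℕ × ℕ → Ω → ℝ
  e : ℕ × ℕ × ℕ → Ω → ℝ

/-- All random terms are independent; within each of the four families they are identically
distributed, with mean zero, variances `θ` and finite absolute moments of order `4 + δ`. -/
structure RandomTermsCondition {Ω : Type*} [MeasurableSpace Ω] (P : Measure Ω)
    (u : RandomTerms Ω) (θ : Fin 4 → ℝ) : Prop where
  indep : iIndepFun (β := fun _ : ℕ ⊕ ℕ ⊕ (ℕ × ℕ) ⊕ (ℕ × ℕ × ℕ) => ℝ)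
    (Sum.elim u.α (Sum.elim u.β (Sum.elim u.γ u.e))) P
  ident_α : ∀ i, IdentDistrib (u.α i) (u.α 0) P P
  ident_β : ∀ j, IdentDistrib (u.β j) (u.β 0) P P
  ident_γ : ∀ c, IdentDistrib (u.γ c) (u.γ 0) P P
  ident_e : ∀ c, IdentDistrib (u.e c) (u.e 0) P P
  mean_α : P[u.α 0] = 0
  mean_β : P[u.β 0] = 0
  mean_γ : P[u.γ 0] = 0
  mean_e : P[u.e 0] = 0
  var_α : variance (u.α 0) P = θ 0
  var_β : variance (u.β 0) P = θ 1
  var_γ : variance (u.γ 0) P = θ 2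
  var_e : variance (u.e 0) P = θ 3
  moment : ∃ δ : ℝ, 0 < δ ∧
    MemLp (u.α 0) (ENNReal.ofReal (4 + δ)) P ∧ MemLp (u.β 0) (ENNReal.ofReal (4 + δ)) P ∧
    MemLp (u.γ 0) (ENNReal.ofReal (4 + δ)) P ∧ MemLp (u.e 0) (ENNReal.ofReal (4 + δ)) P

/-- The positions `(i, j, k)` of the observations. -/
abbrev Cell (g h m : ℕ) : Type := Fin g × Fin h × Fin m

section Model

variable {pa pb pab pw : ℕ} (x : Covariates pa pb pab pw) (g h m : ℕ)

/-- Design matrix of the fixed effects; row `(i, j, k)` is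
`(1, x_i^{(a)}, x_j^{(b)}, x_{ij}^{(ab)}, x_{ijk}^{(w)})`. -/
def design : Matrix (Cell g h m) (FixedIdx pa pb pab pw) ℝ :=
  Matrix.of fun c => Sum.elim (fun _ => 1) (Sum.elim (x.a c.1) (Sum.elim (x.b c.2.1)
    (Sum.elim (x.ab c.1 c.2.1) (x.w c.1 c.2.1 c.2.2))))

/-- The response vector `y_{ijk} = μ(x_{ijk}) + α_i + β_j + γ_{ij} + e_{ijk}` at the fixed
effects `ξ`. -/
def response {Ω : Type*} (ξ : FixedIdx pa pb pab pw → ℝ) (u : RandomTerms Ω) (s : Ω) :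
    Cell g h m → ℝ := fun c =>
  (design x g h m).mulVec ξ c + u.α c.1 s + u.β c.2.1 s + u.γ (c.1, c.2.1) s
    + u.e (c.1, c.2.1, c.2.2) s

/-- Covariance matrix of the response: entry `(i,j,k), (i',j',k')` is
`σ_α² 1(i=i') + σ_β² 1(j=j') + σ_γ² 1(i=i', j=j') + σ_e² 1(i=i', j=j', k=k')`. -/
def V (θ : Fin 4 → ℝ) : Matrix (Cell g h m) (Cell g h m) ℝ :=
  Matrix.of fun c d =>
    (if c.1 = d.1 then θ 0 else 0) + (if c.2.1 = d.2.1 then θ 1 else 0)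
      + (if c.1 = d.1 ∧ c.2.1 = d.2.1 then θ 2 else 0) + (if c = d then θ 3 else 0)

/-- `y - X ξ`. -/
def resid (y : Cell g h m → ℝ) (ξ : FixedIdx pa pb pab pw → ℝ) : Cell g h m → ℝ :=
  y - (design x g h m).mulVec ξ

/-- `(y - X ξ)ᵀ V(θ)⁻¹ (y - X ξ)`. -/
def quadForm (y : Cell g h m → ℝ) (ω : Param pa pb pab pw) : ℝ :=
  dotProduct (resid x g h m y ω.1) ((V g h m ω.2)⁻¹.mulVec (resid x g h m y ω.1))

/-- Normal log-likelihood. -/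
def logLik (y : Cell g h m → ℝ) (ω : Param pa pb pab pw) : ℝ :=
  -((g * h * m : ℕ) : ℝ) / 2 * Real.log (2 * Real.pi)
    - Real.log (V g h m ω.2).det / 2 - quadForm x g h m y ω / 2

/-- `Xᵀ V(θ)⁻¹ X`. -/
def fixedInfo (θ : Fin 4 → ℝ) : Matrix (FixedIdx pa pb pab pw) (FixedIdx pa pb pab pw) ℝ :=
  (design x g h m).transpose * (V g h m θ)⁻¹ * design x g h m

/-- Generalised least squares estimator `(Xᵀ V(θ)⁻¹ X)⁻¹ Xᵀ V(θ)⁻¹ y`. -/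
def gls (y : Cell g h m → ℝ) (θ : Fin 4 → ℝ) : FixedIdx pa pb pab pw → ℝ :=
  (fixedInfo x g h m θ)⁻¹.mulVec
    ((design x g h m).transpose.mulVec ((V g h m θ)⁻¹.mulVec y))

/-- Normal REML criterion (restricted log-likelihood, up to an additive constant). -/
def remlCrit (y : Cell g h m → ℝ) (θ : Fin 4 → ℝ) : ℝ :=
  - Real.log (V g h m θ).det / 2 - Real.log (fixedInfo x g h m θ).det / 2
    - quadForm x g h m y (gls x g h m y θ, θ) / 2

/-- `ω` solves the normal maximum likelihood estimating equations: it lies in the parameter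
space and the gradient of the log-likelihood vanishes there. -/
def IsMLSolution (y : Cell g h m → ℝ) (ω : Param pa pb pab pw) : Prop :=
  ω ∈ parameterSpace pa pb pab pw ∧
    HasFDerivAt (logLik x g h m y) (0 : Param pa pb pab pw →L[ℝ] ℝ) ω

/-- `ω = (ξ, θ)` solves the normal REML estimating equations: it lies in the parameter space, the
gradient of the REML criterion vanishes at `θ`, and `ξ` solves the maximum likelihood estimating
equations for the fixed effects with `θ` held fixed. -/
def IsREMLSolution (y : Cell g h m → ℝ) (ω : Param pa pb pab pw) : Prop :=
  ω ∈ parameterSpace pa pb pab pw ∧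
    HasFDerivAt (remlCrit x g h m y) (0 : (Fin 4 → ℝ) →L[ℝ] ℝ) ω.2 ∧
    HasFDerivAt (fun ξ => logLik x g h m y (ξ, ω.2))
      (0 : (FixedIdx pa pb pab pw → ℝ) →L[ℝ] ℝ) ω.1

/-! The best linear unbiased predictors `G(θ) Zᵀ V(θ)⁻¹ (y - X ξ)`, coordinate by coordinate. -/

/-- `V(θ)⁻¹ (y - X ξ)`. -/
def weightedResid (y : Cell g h m → ℝ) (ω : Param pa pb pab pw) : Cell g h m → ℝ :=
  (V g h m ω.2)⁻¹.mulVec (resid x g h m y ω.1)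

/-- Predictor of `α_i`, for `i < g`. -/
def blupα (y : Cell g h m → ℝ) (ω : Param pa pb pab pw) (i : ℕ) : ℝ :=
  ω.2 0 * ∑ c, if (c.1 : ℕ) = i then weightedResid x g h m y ω c else 0

/-- Predictor of `β_j`, for `j < h`. -/
def blupβ (y : Cell g h m → ℝ) (ω : Param pa pb pab pw) (j : ℕ) : ℝ :=
  ω.2 1 * ∑ c, if (c.2.1 : ℕ) = j then weightedResid x g h m y ω c else 0

/-- Predictor of `γ_{ij}`, for `i < g` and `j < h`. -/
def blupγ (y : Cell g h m → ℝ) (ω : Param pa pb pab pw) (i j : ℕ) : ℝ :=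
  ω.2 2 * ∑ c, if (c.1 : ℕ) = i ∧ (c.2.1 : ℕ) = j then weightedResid x g h m y ω c else 0

end Model

/-- `H_{is}^{(a)} = 1 + x_{i(c)}ᵀ D₁⁻¹ x_{s(c)}` for the row covariates. -/
def Ha {pa pb pab pw : ℕ} (x : Covariates pa pb pab pw) (D1 : Matrix (Fin pa) (Fin pa) ℝ)
    (g i s : ℕ) : ℝ :=
  1 + dotProduct (x.aC g i) (D1⁻¹.mulVec (x.aC g s))

/-- `H_{jt}^{(b)} = 1 + x_{j(c)}ᵀ D₂⁻¹ x_{t(c)}` for the column covariates. -/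
def Hb {pa pb pab pw : ℕ} (x : Covariates pa pb pab pw) (D2 : Matrix (Fin pb) (Fin pb) ℝ)
    (h j t : ℕ) : ℝ :=
  1 + dotProduct (x.bC h j) (D2⁻¹.mulVec (x.bC h t))

/-- `est`, a sequence of functions of the data (the `t`-th table being of size
`g t × h t × m t`), is a consistent sequence of solutions of the estimating equations `Solves`:
the equations are solved with probability tending to one, and `est t` converges in probability to
the true parameter `ω₀`. -/
def ConsistentSolution {Ω : Type*} [MeasurableSpace Ω] (P : Measure Ω)
    {pa pb pab pw : ℕ} (x : Covariates pa pb pab pw) (u : RandomTerms Ω)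
    (ω₀ : Param pa pb pab pw) (g h m : ℕ → ℕ)
    (Solves : ∀ g h m : ℕ, (Cell g h m → ℝ) → Param pa pb pab pw → Prop)
    (est : ∀ t : ℕ, (Cell (g t) (h t) (m t) → ℝ) → Param pa pb pab pw) : Prop :=
  Tendsto (fun t => P {s | ¬ Solves (g t) (h t) (m t)
      (response x (g t) (h t) (m t) ω₀.1 u s)
      (est t (response x (g t) (h t) (m t) ω₀.1 u s))}) atTop (𝓝 0) ∧
  TendstoInMeasure P (fun t s => est t (response x (g t) (h t) (m t) ω₀.1 u s)) atTop
    (fun _ => ω₀)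

end CrossedModel

end

open CrossedModel

open Filter Topology MeasureTheory ProbabilityTheory
noncomputable section
namespace CrossedModel
open Matrix

/-! ### Complete families of orthogonal projections: inverse and determinant of a combination -/

section Spectral
variable {N K : Type*} [Fintype N]

/-! In a balanced table the covariance matrix is diagonal in a decomposition that does not depend on
θ: V(θ) = ∑ λ_k(θ) E_k, where the E_k project onto the grand mean, row, column, interaction and
within-cell strata (`V_eq_sum`). Inverses, determinants and quadratic forms reduce to five scalars,
and a trial θ is compared with the true θ₀ through ratios of eigenvalues.

Fixed effects. The score equation for ξ says that Xζ, with ζ the error of the fixed effects, is the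
V⁻¹-orthogonal projection of the noise. Cauchy–Schwarz in each stratum bounds ∑ λ_k⁻¹|E_k Xζ|² by
the same weighted sum of squared projections of the noise onto the columns of E_k X
(`IsResolution.energy_le`). For θ within a factor two of θ₀ this is at most twice `fitNoise`, whose
expectation is at most five times the number of fixed effects. The positive definite limits turn
this into rates g^(-1/2), h^(-1/2), (gh)^(-1/2), (ghm)^(-1/2) for the four groups of slopes
(`CovariateCondition.exists_rates`). The bound is uniform in θ near θ₀, so only consistency of the
variance components is needed, not their rate.

Predictors. The score equations also make the grand mean of the residuals vanish. Then the predictor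
of α_i is the residual row mean times 1 + O(1/h), and that of γ_ij is the residual interaction times
1 + O(1/m), plus row and column means with coefficients O(1/h) and O(1/g). A residual row mean is
α_i plus row means of γ and e, minus the average of these over rows, minus a fitted part. The row
score equations determine the slopes of x^(a) as D₁⁻¹ g⁻¹ ∑ x_s(c) α_s up to a negligible error;
together with the average of the α_s this produces H (`row_expansion`). Columns follow by exchanging
the two factors. Interaction and within-cell covariates need not be bounded at a fixed position, but
a halving argument shows that their centred versions grow at most logarithmically
(`seminorm_sub_avg_le`), which the slope rates outweigh.

Existence. Profile out ξ and restrict θ to a box on which the eigenvalues have relative error at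
most ε. Minus twice the profile criterion, ML or REML, exceeds its value at θ₀ by at least ∑ n_k
(λ_k(θ₀)/λ_k(θ) - 1)²/12 - O_p(1), with n_k the dimension of stratum k (`profileCrit_sub_ge`);
fourth moments control the stratum sums of squares. Every n_k except that of the grand mean tends to
infinity, so a minimiser over the box is interior. Paired with generalised least squares it solves
the estimating equations, and the energy bound puts its fixed effects close to the true ones. -/

lemma sum_smul_mulVec [Fintype K] (E : K → Matrix N N ℝ) (l : K → ℝ) (v : N → ℝ) :
    (∑ k, l k • E k) *ᵥ v = ∑ k, l k • (E k *ᵥ v) := by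
  rw [Matrix.sum_mulVec]
  simp [smul_mulVec]

lemma dotProduct_sum_smul_mulVec [Fintype K] (E : K → Matrix N N ℝ) (l : K → ℝ) (u v : N → ℝ) :
    u ⬝ᵥ ((∑ k, l k • E k) *ᵥ v) = ∑ k, l k * (u ⬝ᵥ (E k *ᵥ v)) := by
  rw [sum_smul_mulVec, dotProduct_sum]
  simp

variable [DecidableEq N]

/-- The eigenvalues of a symmetric idempotent are 0 and 1, the latter with multiplicity equal to the
trace, so the determinant is the power of 1 + c with exponent tr E. -/
lemma log_det_one_add_smul {E : Matrix N N ℝ} (hs : Eᵀ = E) (hi : E * E = E) {c : ℝ}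
    (hc : -1 < c) :
    0 < (1 + c • E).det ∧ Real.log (1 + c • E).det = E.trace * Real.log (1 + c) := by
  have hE : E.IsHermitian := by simpa [IsHermitian] using hs
  have heig : ∀ i, hE.eigenvalues i = 0 ∨ hE.eigenvalues i = 1 := by
    intro i
    have h1 := hE.mulVec_eigenvectorBasis i
    set v := (hE.eigenvectorBasis i).ofLp with hv
    have hv0 : v ≠ 0 := by
      intro h0
      have := hE.eigenvectorBasis.orthonormal.ne_zero i
      exact this (by ext j; simpa [hv] using congrFun h0 j)
    have h2 : E *ᵥ (E *ᵥ v) = E *ᵥ v := by rw [mulVec_mulVec, hi]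
    rw [h1, mulVec_smul, h1, smul_smul] at h2
    obtain ⟨j, hj⟩ := Function.ne_iff.mp hv0
    have h3 := congrFun h2 j
    simp only [Pi.smul_apply, smul_eq_mul] at h3
    have h4 : hE.eigenvalues i * hE.eigenvalues i = hE.eigenvalues i := mul_right_cancel₀ hj h3
    by_cases h : hE.eigenvalues i = 0
    · exact Or.inl h
    · exact Or.inr (mul_right_cancel₀ h (by rw [h4, one_mul]))
  have hdet : (1 + c • E).det = ∏ i, (1 + c * hE.eigenvalues i) := by
    have h1 := hE.spectral_theorem
    rw [Unitary.conjStarAlgAut_apply] at h1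
    set U := hE.eigenvectorUnitary
    have hU : (U : Matrix N N ℝ) * star (U : Matrix N N ℝ) = 1 := Unitary.coe_mul_star_self U
    have h2 : 1 + c • E = (U : Matrix N N ℝ) * diagonal (fun i => 1 + c * hE.eigenvalues i)
        * star (U : Matrix N N ℝ) := by
      have : diagonal (fun i => 1 + c * hE.eigenvalues i)
          = (1 : Matrix N N ℝ) + c • diagonal (RCLike.ofReal ∘ hE.eigenvalues) := by
        ext i j
        by_cases h : i = j <;> simp [h]
      rw [this, mul_add, add_mul, mul_one, hU, mul_smul_comm, smul_mul_assoc, ← h1]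
    rw [h2, det_mul, det_mul, mul_right_comm, ← det_mul, hU, det_one, one_mul, det_diagonal]
  have hpos : ∀ i, 0 < 1 + c * hE.eigenvalues i := by
    intro i
    rcases heig i with h | h <;> rw [h] <;> linarith
  refine ⟨hdet ▸ Finset.prod_pos fun i _ => hpos i, ?_⟩
  rw [hdet, Real.log_prod (fun i _ => (hpos i).ne'), hE.trace_eq_sum_eigenvalues, Finset.sum_mul]
  refine Finset.sum_congr rfl fun i _ => ?_
  rcases heig i with h | h <;> simp [h]

/-- A complete family of mutually orthogonal symmetric projections. -/
structure IsResolution [Fintype K] (E : K → Matrix N N ℝ) : Prop where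
  symm : ∀ k, (E k)ᵀ = E k
  idem : ∀ k, E k * E k = E k
  orth : ∀ k l, k ≠ l → E k * E l = 0
  sum_eq : ∑ k, E k = 1

namespace IsResolution
variable [Fintype K] {E : K → Matrix N N ℝ} (hE : IsResolution E)
include hE

lemma log_det {l : K → ℝ} (hl : ∀ k, 0 < l k) :
    0 < (∑ k, l k • E k).det ∧
      Real.log (∑ k, l k • E k).det = ∑ k, (E k).trace * Real.log (l k) := by
  classical
  -- By orthogonality the partial sum factors as the product of 1 + (l_k - 1) E_k over k in s, so
  -- determinants multiply. Completeness of the family converts the full product into ∑ l_k E_k.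
  have key : ∀ s : Finset K, 0 < (1 + ∑ k ∈ s, (l k - 1) • E k).det ∧
      Real.log (1 + ∑ k ∈ s, (l k - 1) • E k).det = ∑ k ∈ s, (E k).trace * Real.log (l k) := by
    intro s
    induction s using Finset.induction_on with
    | empty => simp
    | insert a s ha ih =>
      have h1 : 1 + ∑ k ∈ insert a s, (l k - 1) • E k
          = (1 + ∑ k ∈ s, (l k - 1) • E k) * (1 + (l a - 1) • E a) := by
        have h0 : (∑ k ∈ s, (l k - 1) • E k) * E a = 0 := by
          rw [Finset.sum_mul]
          refine Finset.sum_eq_zero fun k hk => ?_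
          rw [smul_mul_assoc, hE.orth k a (fun h => ha (h ▸ hk)), smul_zero]
        rw [Finset.sum_insert ha, mul_add, mul_one, mul_smul_comm, add_mul, h0, one_mul, add_zero]
        abel
      have h2 := log_det_one_add_smul (hE.symm a) (hE.idem a) (c := l a - 1)
        (by linarith [hl a])
      rw [h1, det_mul, Finset.sum_insert ha]
      refine ⟨mul_pos ih.1 h2.1, ?_⟩
      rw [Real.log_mul ih.1.ne' h2.1.ne', ih.2, h2.2]
      ring_nf
  have h := key Finset.univ
  have h3 : 1 + ∑ k, (l k - 1) • E k = ∑ k, l k • E k := by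
    simp only [sub_smul, one_smul, Finset.sum_sub_distrib, hE.sum_eq]
    abel
  rwa [h3] at h

lemma sum_smul_mul (l l' : K → ℝ) :
    (∑ k, l k • E k) * (∑ k, l' k • E k) = ∑ k, (l k * l' k) • E k := by
  classical
  rw [Finset.sum_mul]
  refine Finset.sum_congr rfl fun k _ => ?_
  rw [Finset.mul_sum, Finset.sum_eq_single k]
  · rw [smul_mul_smul_comm, hE.idem]
  · intro j _ hj
    rw [smul_mul_smul_comm, hE.orth k j (Ne.symm hj), smul_zero]
  · simp

lemma inv_sum {l : K → ℝ} (hl : ∀ k, l k ≠ 0) :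
    (∑ k, l k • E k)⁻¹ = ∑ k, (l k)⁻¹ • E k := by
  apply inv_eq_right_inv
  rw [hE.sum_smul_mul]
  simp [hl, hE.sum_eq]

lemma dotProduct_mulVec_eq (k : K) (u v : N → ℝ) :
    u ⬝ᵥ (E k *ᵥ v) = (E k *ᵥ u) ⬝ᵥ (E k *ᵥ v) := by
  conv_lhs => rw [← hE.idem k, ← mulVec_mulVec, dotProduct_mulVec, ← mulVec_transpose, hE.symm]

lemma dotProduct_mulVec_comm (k : K) (u v : N → ℝ) :
    u ⬝ᵥ (E k *ᵥ v) = v ⬝ᵥ (E k *ᵥ u) := by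
  rw [hE.dotProduct_mulVec_eq, hE.dotProduct_mulVec_eq k v, dotProduct_comm]

end IsResolution

end Spectral

/-! ### Projection onto a column space -/

section Projection
variable {N p : Type*} [Fintype N] [Fintype p]

/-- Squared length of the projection of `r` onto the column space of `Y`. -/
def projSq (Y : Matrix N p ℝ) (r : N → ℝ) : ℝ :=
  ‖(LinearMap.range ((WithLp.linearEquiv 2 ℝ (N → ℝ)).symm.toLinearMap ∘ₗ
    Y.mulVecLin)).starProjection (WithLp.toLp 2 r)‖ ^ 2

lemma projSq_nonneg (Y : Matrix N p ℝ) (r : N → ℝ) : 0 ≤ projSq Y r := sq_nonneg _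

/-- Only the component of r in the column space meets Y v, so Cauchy–Schwarz applies to the
projection of r. Working with the range requires no rank condition, which matters because E_k X is
rank deficient: every stratum but the grand mean kills the intercept. -/
lemma sq_dotProduct_le_projSq (Y : Matrix N p ℝ) (v : p → ℝ) (r : N → ℝ) :
    ((Y *ᵥ v) ⬝ᵥ r) ^ 2 ≤ ((Y *ᵥ v) ⬝ᵥ (Y *ᵥ v)) * projSq Y r := by
  unfold projSq
  set W := LinearMap.range ((WithLp.linearEquiv 2 ℝ (N → ℝ)).symm.toLinearMap ∘ₗ
    Y.mulVecLin)
  have hmem : WithLp.toLp 2 (Y *ᵥ v) ∈ W := ⟨v, rfl⟩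
  have h1 : (Y *ᵥ v) ⬝ᵥ r = inner ℝ (WithLp.toLp 2 (Y *ᵥ v)) (W.starProjection (WithLp.toLp 2 r)) := by
    rw [← Submodule.inner_starProjection_left_eq_right, Submodule.starProjection_eq_self_iff.2 hmem]
    simp [PiLp.inner_apply, dotProduct, mul_comm]
  have h2 : (Y *ᵥ v) ⬝ᵥ (Y *ᵥ v) = ‖WithLp.toLp 2 (Y *ᵥ v)‖ ^ 2 := by
    rw [EuclideanSpace.norm_sq_eq]
    simp [dotProduct, sq]
  rw [h1, h2, ← mul_pow, ← sq_abs]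
  gcongr
  exact abs_real_inner_le_norm _ _

/-- The projection length in an orthonormal basis of the column space. -/
lemma exists_projSq_eq (Y : Matrix N p ℝ) : ∃ (d : ℕ) (e : Fin d → N → ℝ),
    d ≤ Fintype.card p ∧ (∀ l, e l ⬝ᵥ e l = 1) ∧ (∀ l, ∃ v, e l = Y *ᵥ v) ∧
    ∀ r, projSq Y r = ∑ l, (e l ⬝ᵥ r) ^ 2 := by
  set f : (p → ℝ) →ₗ[ℝ] EuclideanSpace ℝ N :=
    (WithLp.linearEquiv 2 ℝ (N → ℝ)).symm.toLinearMap ∘ₗ Y.mulVecLin with hf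
  set W := LinearMap.range f with hW
  let b := stdOrthonormalBasis ℝ W
  refine ⟨Module.finrank ℝ W, fun l => (b l : EuclideanSpace ℝ N).ofLp, ?_, ?_, ?_, ?_⟩
  · simpa using LinearMap.finrank_range_le f
  · intro l
    have h := b.orthonormal.1 l
    have h2 : ‖(b l : EuclideanSpace ℝ N)‖ ^ 2 = 1 := by
      rw [← Submodule.coe_norm, h, one_pow]
    rw [EuclideanSpace.norm_sq_eq] at h2
    simpa [dotProduct, sq] using h2
  · intro l
    obtain ⟨v, hv⟩ := (b l).2
    refine ⟨v, ?_⟩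
    change (b l : EuclideanSpace ℝ N).ofLp = _
    rw [← hv]
    rfl
  · intro r
    unfold projSq
    rw [Submodule.starProjection_apply, ← Submodule.coe_norm, ← b.sum_sq_norm_inner_right]
    refine Finset.sum_congr rfl fun l _ => ?_
    rw [Submodule.coe_inner, ← Submodule.starProjection_apply,
      ← Submodule.inner_starProjection_left_eq_right, Submodule.starProjection_eq_self_iff.2 (b l).2]
    simp [PiLp.inner_apply, dotProduct, mul_comm]

end Projection
end CrossedModel
end

/-! ### Strata of a balanced table and the eigenvalues of V -/

open Filter Topology MeasureTheory ProbabilityTheory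
noncomputable section
namespace CrossedModel
open Matrix
open scoped Kronecker

/-- The averaging matrix. -/
def avgMat (n : ℕ) : Matrix (Fin n) (Fin n) ℝ := Matrix.of fun _ _ => (n : ℝ)⁻¹

lemma avgMat_transpose (n : ℕ) : (avgMat n)ᵀ = avgMat n := rfl

lemma avgMat_mul_self {n : ℕ} (hn : 0 < n) : avgMat n * avgMat n = avgMat n := by
  ext i j
  have : (n : ℝ) ≠ 0 := by positivity
  simp [avgMat, mul_apply, this]

lemma trace_avgMat {n : ℕ} (hn : 0 < n) : (avgMat n).trace = 1 := by
  have : (n : ℝ) ≠ 0 := by positivity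
  simp [avgMat, trace, this]

/-- Projections onto the strata of a balanced two-way table with replicates: grand mean, rows,
columns, interaction, within cells. -/
def strat (g h m : ℕ) : Fin 5 → Matrix (Cell g h m) (Cell g h m) ℝ :=
  ![avgMat g ⊗ₖ (avgMat h ⊗ₖ avgMat m),
    (1 - avgMat g) ⊗ₖ (avgMat h ⊗ₖ avgMat m),
    avgMat g ⊗ₖ ((1 - avgMat h) ⊗ₖ avgMat m),
    (1 - avgMat g) ⊗ₖ ((1 - avgMat h) ⊗ₖ avgMat m),
    1 ⊗ₖ (1 ⊗ₖ (1 - avgMat m))]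

/-- Eigenvalues of `V` on the strata. -/
def lam (g h m : ℕ) (θ : Fin 4 → ℝ) : Fin 5 → ℝ :=
  ![h * m * θ 0 + g * m * θ 1 + m * θ 2 + θ 3,
    h * m * θ 0 + m * θ 2 + θ 3,
    g * m * θ 1 + m * θ 2 + θ 3,
    m * θ 2 + θ 3,
    θ 3]

lemma isResolution_strat {g h m : ℕ} (hg : 0 < g) (hh : 0 < h) (hm : 0 < m) :
    IsResolution (strat g h m) where
  symm k := by
    have key : ∀ n : ℕ, (1 - avgMat n)ᵀ = 1 - avgMat n := fun n => by
      rw [transpose_sub, transpose_one, avgMat_transpose]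
    have hk : ∀ {a b c : ℕ} (A : Matrix (Fin a) (Fin a) ℝ) (B : Matrix (Fin b) (Fin b) ℝ)
        (C : Matrix (Fin c) (Fin c) ℝ), Aᵀ = A → Bᵀ = B → Cᵀ = C →
        (A ⊗ₖ (B ⊗ₖ C))ᵀ = A ⊗ₖ (B ⊗ₖ C) := fun A B C hA hB hC => by
      conv_rhs => rw [← hA, ← hB, ← hC]
      rfl
    fin_cases k <;> exact hk _ _ _ (by simp [avgMat_transpose]) (by simp [avgMat_transpose])
      (by simp [avgMat_transpose])
  idem k := by
    fin_cases k <;> simp [strat, ← mul_kronecker_mul, avgMat_mul_self, hg, hh, hm, mul_sub, sub_mul]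
  orth k l hkl := by
    fin_cases k <;> fin_cases l <;> first
      | exact absurd rfl hkl
      | simp [strat, ← mul_kronecker_mul, avgMat_mul_self, hg, hh, hm, mul_sub, sub_mul]
  sum_eq := by
    rw [← one_kronecker_one, ← one_kronecker_one]
    ext c d
    simp only [Fin.sum_univ_five, strat, Matrix.add_apply, kroneckerMap_apply, Matrix.sub_apply,
      Matrix.cons_val]
    ring

/-- Each indicator in V is a Kronecker product of identities and all-ones matrices: sharing a row
gives hm(E₀ + E₁), sharing a column gm(E₀ + E₂), sharing a cell m(E₀ + E₁ + E₂ + E₃). -/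
lemma V_eq_sum {g h m : ℕ} (hg : 0 < g) (hh : 0 < h) (hm : 0 < m) (θ : Fin 4 → ℝ) :
    V g h m θ = ∑ k, lam g h m θ k • strat g h m k := by
  have hg' : (g : ℝ) ≠ 0 := by positivity
  have hh' : (h : ℝ) ≠ 0 := by positivity
  have hm' : (m : ℝ) ≠ 0 := by positivity
  ext c d
  obtain ⟨i, j, k⟩ := c
  obtain ⟨i', j', k'⟩ := d
  simp only [Fin.sum_univ_five, strat, Matrix.add_apply, Matrix.smul_apply, kronecker_apply,
    Matrix.sub_apply, Matrix.cons_val, lam, V, Matrix.of_apply, avgMat, smul_eq_mul,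
    Matrix.one_apply, Prod.mk.injEq]
  by_cases h1 : i = i' <;> by_cases h2 : j = j' <;> by_cases h3 : k = k' <;>
    simp [h1, h2, h3] <;> field_simp <;> ring

lemma lam_pos {g h m : ℕ} {θ : Fin 4 → ℝ} (hθ : ∀ l, 0 < θ l) (k : Fin 5) :
    0 < lam g h m θ k := by
  have := hθ 0
  have := hθ 1
  have := hθ 2
  have := hθ 3
  fin_cases k <;> simp [lam] <;> positivity

/-- Degrees of freedom of the strata. All but the first tend to infinity, which is what makes the
four variance components estimable. -/
lemma trace_strat {g h m : ℕ} (hg : 0 < g) (hh : 0 < h) (hm : 0 < m) :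
    (fun k => (strat g h m k).trace) =
      ![1, (g : ℝ) - 1, (h : ℝ) - 1, ((g : ℝ) - 1) * (h - 1), g * h * (m - 1)] := by
  funext k
  fin_cases k <;> simp [strat, trace_kronecker, trace_avgMat, hg, hh, hm, mul_assoc]

end CrossedModel
end

open Filter Topology MeasureTheory ProbabilityTheory
noncomputable section
namespace CrossedModel
open Matrix
open scoped Kronecker

/-! ### Averages, tables and their stratum components -/

section Avg

lemma avg_add' {E : Type*} [AddCommGroup E] [Module ℝ E] (n : ℕ) (f f' : ℕ → E) :
    avg n (fun i => f i + f' i) = avg n f + avg n f' := by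
  simp [avg, Finset.sum_add_distrib]

lemma avg_sub' {E : Type*} [AddCommGroup E] [Module ℝ E] (n : ℕ) (f f' : ℕ → E) :
    avg n (fun i => f i - f' i) = avg n f - avg n f' := by
  simp [avg, Finset.sum_sub_distrib, smul_sub]

lemma avg_const {E : Type*} [AddCommGroup E] [Module ℝ E] {n : ℕ} (hn : 0 < n) (c : E) :
    avg n (fun _ => c) = c := by
  have : (n : ℝ) ≠ 0 := by positivity
  simp [avg, ← Nat.cast_smul_eq_nsmul ℝ, smul_smul, this]

lemma avg_const_mul (n : ℕ) (c : ℝ) (f : ℕ → ℝ) : avg n (fun i => c * f i) = c * avg n f := by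
  simp only [avg, smul_eq_mul, ← Finset.mul_sum]
  ring

lemma avg_mul_const (n : ℕ) (c : ℝ) (f : ℕ → ℝ) : avg n (fun i => f i * c) = avg n f * c := by
  simp only [avg, smul_eq_mul, ← Finset.sum_mul]
  ring

lemma avg_apply {ι : Type*} (n : ℕ) (f : ℕ → ι → ℝ) (l : ι) :
    avg n f l = avg n (fun i => f i l) := by
  simp [avg]

lemma avg_dotProduct {ι : Type*} [Fintype ι] (n : ℕ) (f : ℕ → ι → ℝ) (v : ι → ℝ) :
    avg n (fun i => f i ⬝ᵥ v) = avg n f ⬝ᵥ v := by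
  simp [avg, smul_dotProduct, sum_dotProduct]

lemma avg_comm {E : Type*} [AddCommGroup E] [Module ℝ E] (n n' : ℕ) (f : ℕ → ℕ → E) :
    avg n (fun i => avg n' fun j => f i j) = avg n' (fun j => avg n fun i => f i j) := by
  simp only [avg, ← Finset.smul_sum]
  rw [Finset.sum_comm, smul_comm]

lemma sum_range_eq_avg {n : ℕ} (hn : 0 < n) (f : ℕ → ℝ) :
    ∑ i ∈ Finset.range n, f i = n * avg n f := by
  have : (n : ℝ) ≠ 0 := by positivity
  simp [avg, this]

lemma avg_nonneg {n : ℕ} {f : ℕ → ℝ} (hf : ∀ i, 0 ≤ f i) : 0 ≤ avg n f :=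
  smul_nonneg (by positivity) (Finset.sum_nonneg fun i _ => hf i)

lemma avg_quadForm {ι : Type*} [Fintype ι] (n : ℕ) (f : ℕ → ι → ℝ) (v : ι → ℝ) :
    v ⬝ᵥ (avg n (fun i => vecMulVec (f i) (f i)) *ᵥ v) = avg n fun i => (f i ⬝ᵥ v) ^ 2 := by
  simp only [avg, smul_mulVec, sum_mulVec, dotProduct_smul, dotProduct_sum, smul_eq_mul]
  congr 1
  refine Finset.sum_congr rfl fun i _ => ?_
  simp [vecMulVec_mulVec, dotProduct_comm v, sq]

end Avg

section Table

/-- A table restricted to `g` rows, `h` columns and `m` replicates. -/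
def toCell (g h m : ℕ) (F : ℕ → ℕ → ℕ → ℝ) : Cell g h m → ℝ := fun c => F c.1 c.2.1 c.2.2

def cellMean (m : ℕ) (F : ℕ → ℕ → ℕ → ℝ) (i j : ℕ) : ℝ := avg m fun k => F i j k
def rowMean (h m : ℕ) (F : ℕ → ℕ → ℕ → ℝ) (i : ℕ) : ℝ := avg h fun j => avg m fun k => F i j k
def colMean (g m : ℕ) (F : ℕ → ℕ → ℕ → ℝ) (j : ℕ) : ℝ := avg g fun i => avg m fun k => F i j k
def grandMean (g h m : ℕ) (F : ℕ → ℕ → ℕ → ℝ) : ℝ :=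
  avg g fun i => avg h fun j => avg m fun k => F i j k

lemma avgMat_mulVec {n : ℕ} (f : ℕ → ℝ) (i : Fin n) :
    (avgMat n *ᵥ fun i : Fin n => f i) i = avg n f := by
  simp only [mulVec, dotProduct, avgMat, of_apply, avg, smul_eq_mul, Finset.mul_sum]
  rw [Finset.sum_range]

lemma kronecker_mulVec_toCell {g h m : ℕ} (A : Matrix (Fin g) (Fin g) ℝ)
    (B : Matrix (Fin h) (Fin h) ℝ) (C : Matrix (Fin m) (Fin m) ℝ) (F : ℕ → ℕ → ℕ → ℝ)
    (c : Cell g h m) :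
    ((A ⊗ₖ (B ⊗ₖ C)) *ᵥ toCell g h m F) c =
      (A *ᵥ fun i => (B *ᵥ fun j => (C *ᵥ fun k => F i j k) c.2.2) c.2.1) c.1 := by
  obtain ⟨i, j, k⟩ := c
  simp only [mulVec, dotProduct, Fintype.sum_prod_type, kroneckerMap_apply, toCell,
    Finset.mul_sum, mul_assoc]

/-- The components of a table in the strata. -/
def component (g h m : ℕ) (F : ℕ → ℕ → ℕ → ℝ) : Fin 5 → ℕ → ℕ → ℕ → ℝ :=
  ![fun _ _ _ => grandMean g h m F,
    fun i _ _ => rowMean h m F i - grandMean g h m F,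
    fun _ j _ => colMean g m F j - grandMean g h m F,
    fun i j _ => cellMean m F i j - rowMean h m F i - colMean g m F j + grandMean g h m F,
    fun i j k => F i j k - cellMean m F i j]

lemma strat_mulVec_toCell (g h m : ℕ) (F : ℕ → ℕ → ℕ → ℝ) (k : Fin 5) :
    strat g h m k *ᵥ toCell g h m F = toCell g h m (component g h m F k) := by
  have e1 : ∀ {n : ℕ} (f : ℕ → ℝ) (i : Fin n),
      ((1 - avgMat n) *ᵥ fun i : Fin n => f i) i = f i - avg n f := fun f i => by
    rw [sub_mulVec, one_mulVec, Pi.sub_apply, avgMat_mulVec]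
  have a3 : ∀ (i j : ℕ) (k : Fin m), (avgMat m *ᵥ fun k : Fin m => F i j k) k
      = avg m fun k => F i j k := fun i j k => avgMat_mulVec (F i j) k
  have a2 : ∀ (i : ℕ) (j : Fin h), (avgMat h *ᵥ fun j : Fin h => avg m fun k => F i j k) j
      = avg h fun j => avg m fun k => F i j k :=
    fun i j => avgMat_mulVec (fun j => avg m fun k => F i j k) j
  have b2 : ∀ (i : ℕ) (j : Fin h), ((1 - avgMat h) *ᵥ fun j : Fin h => avg m fun k => F i j k) j
      = (avg m fun k => F i j k) - avg h fun j => avg m fun k => F i j k :=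
    fun i j => e1 (fun j => avg m fun k => F i j k) j
  ext c
  fin_cases k
  · simp only [strat, component, Fin.zero_eta, cons_val_zero, kronecker_mulVec_toCell, a3, a2]
    exact avgMat_mulVec (fun i => avg h fun j => avg m fun k => F i j k) _
  · simp only [strat, component, Fin.mk_one, cons_val_one, cons_val_zero,
      kronecker_mulVec_toCell, a3, a2]
    exact e1 (fun i => avg h fun j => avg m fun k => F i j k) _
  · simp only [strat, component, Fin.reduceFinMk, cons_val, kronecker_mulVec_toCell, a3, b2]
    refine (avgMat_mulVec (fun i => (avg m fun k => F i c.2.1 k)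
      - avg h fun j => avg m fun k => F i j k) _).trans ?_
    rw [avg_sub']
    rfl
  · simp only [strat, component, Fin.reduceFinMk, cons_val, kronecker_mulVec_toCell, a3, b2]
    refine (e1 (fun i => (avg m fun k => F i c.2.1 k)
      - avg h fun j => avg m fun k => F i j k) _).trans ?_
    rw [avg_sub']
    simp only [toCell, cellMean, rowMean, colMean, grandMean]
    ring
  · simp only [strat, component, Fin.reduceFinMk, cons_val, kronecker_mulVec_toCell, one_mulVec]
    exact e1 (F c.1 c.2.1) _

lemma sum_toCell {g h m : ℕ} (hg : 0 < g) (hh : 0 < h) (hm : 0 < m) (F : ℕ → ℕ → ℕ → ℝ) :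
    ∑ c, toCell g h m F c = g * h * m * grandMean g h m F := by
  simp only [Fintype.sum_prod_type, toCell, grandMean, mul_assoc, ← sum_range_eq_avg hg,
    ← avg_const_mul, ← sum_range_eq_avg hh, ← sum_range_eq_avg hm, Finset.sum_range]

lemma toCell_dotProduct {g h m : ℕ} (hg : 0 < g) (hh : 0 < h) (hm : 0 < m)
    (F G : ℕ → ℕ → ℕ → ℝ) :
    toCell g h m F ⬝ᵥ toCell g h m G = g * h * m * grandMean g h m fun i j k => F i j k * G i j k :=
  sum_toCell hg hh hm fun i j k => F i j k * G i j k

end Table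

/-! ### Stratum components of the fixed-effect table -/

section Fixed
variable {pa pb pab pw : ℕ} (x : Covariates pa pb pab pw) (ζ : FixedIdx pa pb pab pw → ℝ)

def slopeA : Fin pa → ℝ := fun l => ζ (.inr (.inl l))
def slopeB : Fin pb → ℝ := fun l => ζ (.inr (.inr (.inl l)))
def slopeAB : Fin pab → ℝ := fun l => ζ (.inr (.inr (.inr (.inl l))))
def slopeW : Fin pw → ℝ := fun l => ζ (.inr (.inr (.inr (.inr l))))

/-- Slopes of the covariates that vary between rows. -/
def slopesRow : Fin pa ⊕ Fin pab ⊕ Fin pw → ℝ :=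
  Sum.elim (slopeA ζ) (Sum.elim (slopeAB ζ) (slopeW ζ))
/-- Slopes of the covariates that vary between columns. -/
def slopesCol : Fin pb ⊕ Fin pab ⊕ Fin pw → ℝ :=
  Sum.elim (slopeB ζ) (Sum.elim (slopeAB ζ) (slopeW ζ))
/-- Slopes of the covariates that vary between cells. -/
def slopesInter : Fin pab ⊕ Fin pw → ℝ := Sum.elim (slopeAB ζ) (slopeW ζ)

/-- The table of fixed-effect means. -/
def fixedTable (i j k : ℕ) : ℝ :=
  ζ (.inl ()) + x.a i ⬝ᵥ slopeA ζ + x.b j ⬝ᵥ slopeB ζ + x.ab i j ⬝ᵥ slopeAB ζ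
    + x.w i j k ⬝ᵥ slopeW ζ

lemma design_mulVec (g h m : ℕ) : design x g h m *ᵥ ζ = toCell g h m (fixedTable x ζ) := by
  ext c
  simp [design, mulVec, dotProduct, Fintype.sum_sum_type, toCell, fixedTable, slopeA, slopeB,
    slopeAB, slopeW, add_assoc]

variable {g h m : ℕ} (hg : 0 < g) (hh : 0 < h) (hm : 0 < m)

include hm in
lemma cellMean_fixedTable (i j : ℕ) : cellMean m (fixedTable x ζ) i j =
    ζ (.inl ()) + x.a i ⬝ᵥ slopeA ζ + x.b j ⬝ᵥ slopeB ζ + x.ab i j ⬝ᵥ slopeAB ζ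
      + x.wCell m i j ⬝ᵥ slopeW ζ := by
  simp only [cellMean, fixedTable, avg_add', avg_const hm, avg_dotProduct, Covariates.wCell]

include hh hm in
lemma rowMean_fixedTable (i : ℕ) : rowMean h m (fixedTable x ζ) i =
    ζ (.inl ()) + x.a i ⬝ᵥ slopeA ζ + avg h x.b ⬝ᵥ slopeB ζ + x.abRow h i ⬝ᵥ slopeAB ζ
      + x.wRow h m i ⬝ᵥ slopeW ζ := by
  simp only [rowMean, fixedTable, avg_add', avg_const hm, avg_const hh, avg_dotProduct,
    Covariates.wCell, Covariates.wRow, Covariates.abRow]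

include hg hm in
lemma colMean_fixedTable (j : ℕ) : colMean g m (fixedTable x ζ) j =
    ζ (.inl ()) + avg g x.a ⬝ᵥ slopeA ζ + x.b j ⬝ᵥ slopeB ζ + x.abCol g j ⬝ᵥ slopeAB ζ
      + x.wCol g m j ⬝ᵥ slopeW ζ := by
  simp only [colMean, fixedTable, avg_add', avg_const hm, avg_const hg, avg_dotProduct,
    Covariates.wCell, Covariates.wCol, Covariates.abCol]

include hg hh hm in
lemma grandMean_fixedTable : grandMean g h m (fixedTable x ζ) =
    ζ (.inl ()) + avg g x.a ⬝ᵥ slopeA ζ + avg h x.b ⬝ᵥ slopeB ζ + x.abAll g h ⬝ᵥ slopeAB ζ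
      + x.wAll g h m ⬝ᵥ slopeW ζ := by
  simp only [grandMean, fixedTable, avg_add', avg_const hm, avg_const hg, avg_const hh,
    avg_dotProduct, Covariates.wCell, Covariates.wAll, Covariates.abAll]

include hg hh hm in
-- In each stratum the fixed-effect table is linear in exactly the slopes of the covariates that
-- vary there. The covariate conditions thereby become bounds on the energy of the fitted values,
-- stratum by stratum.
lemma component_fixedTable : component g h m (fixedTable x ζ) =
    ![fun _ _ _ => grandMean g h m (fixedTable x ζ),
      fun i _ _ => x.XA g h m i ⬝ᵥ slopesRow ζ,
      fun _ j _ => x.XB g h m j ⬝ᵥ slopesCol ζ,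
      fun i j _ => x.XAB g h m i j ⬝ᵥ slopesInter ζ,
      fun i j k => x.wC m i j k ⬝ᵥ slopeW ζ] := by
  have e : ∀ {ι κ : Type} [Fintype ι] [Fintype κ] (a a' : ι → ℝ) (b b' : κ → ℝ),
      Sum.elim a b ⬝ᵥ Sum.elim a' b' = a ⬝ᵥ a' + b ⬝ᵥ b' := fun a a' b b' => by
    simp [dotProduct]
  funext k i j l
  fin_cases k
  · rfl
  · simp only [component, Fin.mk_one, cons_val_one, cons_val_zero, rowMean_fixedTable x ζ hh hm,
      grandMean_fixedTable x ζ hg hh hm, Covariates.XA, slopesRow, e, Covariates.aC, sub_dotProduct]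
    ring
  · simp only [component, Fin.reduceFinMk, cons_val, colMean_fixedTable x ζ hg hm,
      grandMean_fixedTable x ζ hg hh hm, Covariates.XB, slopesCol, e, Covariates.bC, sub_dotProduct]
    ring
  · simp only [component, Fin.reduceFinMk, cons_val, colMean_fixedTable x ζ hg hm,
      cellMean_fixedTable x ζ hm, rowMean_fixedTable x ζ hh hm,
      grandMean_fixedTable x ζ hg hh hm, Covariates.XAB, slopesInter, e, Covariates.abC,
      Covariates.wCellC, sub_dotProduct, add_dotProduct]
    ring
  · simp only [component, Fin.reduceFinMk, cons_val,
      cellMean_fixedTable x ζ hm, fixedTable, Covariates.wC, sub_dotProduct]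
    ring

end Fixed
end CrossedModel
end

open Filter Topology MeasureTheory ProbabilityTheory
noncomputable section
namespace CrossedModel
open Matrix

/-! ### Score equations and predictors in terms of residual means -/

section Weighted
variable {g h m : ℕ} (hg : 0 < g) (hh : 0 < h) (hm : 0 < m)

/-- The table `V⁻¹ F`. -/
def weighted (g h m : ℕ) (θ : Fin 4 → ℝ) (F : ℕ → ℕ → ℕ → ℝ) (i j k : ℕ) : ℝ :=
  ∑ κ, (lam g h m θ κ)⁻¹ * component g h m F κ i j k

include hg hh hm in
lemma V_inv_eq {θ : Fin 4 → ℝ} (hθ : ∀ l, 0 < θ l) :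
    (V g h m θ)⁻¹ = ∑ κ, (lam g h m θ κ)⁻¹ • strat g h m κ := by
  rw [V_eq_sum hg hh hm, (isResolution_strat hg hh hm).inv_sum fun κ => (lam_pos hθ κ).ne']

include hg hh hm in
lemma V_inv_mulVec_toCell {θ : Fin 4 → ℝ} (hθ : ∀ l, 0 < θ l) (F : ℕ → ℕ → ℕ → ℝ) :
    (V g h m θ)⁻¹ *ᵥ toCell g h m F = toCell g h m (weighted g h m θ F) := by
  rw [V_inv_eq hg hh hm hθ, sum_smul_mulVec]
  ext c
  simp [strat_mulVec_toCell, weighted, toCell]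

include hg hh hm in
-- Averaging over an index keeps the components that are constant in it and annihilates the others,
-- so every mean of V⁻¹F involves only the matching stratum components of F.
lemma means_weighted (θ : Fin 4 → ℝ) (F : ℕ → ℕ → ℕ → ℝ) :
    grandMean g h m (weighted g h m θ F) = (lam g h m θ 0)⁻¹ * grandMean g h m F ∧
    (∀ i, rowMean h m (weighted g h m θ F) i = (lam g h m θ 0)⁻¹ * grandMean g h m F
      + (lam g h m θ 1)⁻¹ * (rowMean h m F i - grandMean g h m F)) ∧
    (∀ j, colMean g m (weighted g h m θ F) j = (lam g h m θ 0)⁻¹ * grandMean g h m F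
      + (lam g h m θ 2)⁻¹ * (colMean g m F j - grandMean g h m F)) ∧
    ∀ i j, cellMean m (weighted g h m θ F) i j = (lam g h m θ 0)⁻¹ * grandMean g h m F
      + (lam g h m θ 1)⁻¹ * (rowMean h m F i - grandMean g h m F)
      + (lam g h m θ 2)⁻¹ * (colMean g m F j - grandMean g h m F)
      + (lam g h m θ 3)⁻¹ * (cellMean m F i j - rowMean h m F i - colMean g m F j
          + grandMean g h m F) := by
  have hcell : ∀ i j, avg m (fun k => weighted g h m θ F i j k)
      = (lam g h m θ 0)⁻¹ * grandMean g h m F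
      + (lam g h m θ 1)⁻¹ * (rowMean h m F i - grandMean g h m F)
      + (lam g h m θ 2)⁻¹ * (colMean g m F j - grandMean g h m F)
      + (lam g h m θ 3)⁻¹ * (cellMean m F i j - rowMean h m F i - colMean g m F j
          + grandMean g h m F) := fun i j => by
    simp only [weighted, Fin.sum_univ_five, component, cons_val, avg_add', avg_const_mul,
      avg_const hm, avg_sub']
    simp only [cellMean, sub_self]
    ring
  have cr : ∀ i, avg h (fun j => cellMean m F i j) = rowMean h m F i := fun i => rfl
  have cc : ∀ j, avg g (fun i => cellMean m F i j) = colMean g m F j := fun i => rfl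
  have rg : avg g (fun i => rowMean h m F i) = grandMean g h m F := rfl
  have cg : avg h (fun j => colMean g m F j) = grandMean g h m F := by
    simp only [colMean, grandMean]
    rw [avg_comm]
  have hrow : ∀ i, avg h (fun j => avg m (fun k => weighted g h m θ F i j k))
      = (lam g h m θ 0)⁻¹ * grandMean g h m F
      + (lam g h m θ 1)⁻¹ * (rowMean h m F i - grandMean g h m F) := fun i => by
    simp only [hcell, avg_add', avg_const_mul, avg_const hh, avg_sub', cr, cg]
    ring
  refine ⟨?_, hrow, fun j => ?_, hcell⟩
  · rw [grandMean]
    simp only [hrow]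
    simp only [avg_add', avg_const_mul, avg_const hg, avg_sub', rg]
    ring
  · simp only [colMean, hcell]
    simp only [avg_add', avg_const_mul, avg_const hg, avg_sub', rg, cc]
    simp only [colMean]
    ring

/-- `F` is orthogonal to the fixed effects in the metric of `V⁻¹`: the estimating equation of the
fixed effects. -/
def IsScoreZero {pa pb pab pw : ℕ} (x : Covariates pa pb pab pw) (g h m : ℕ) (θ : Fin 4 → ℝ)
    (r : Cell g h m → ℝ) : Prop :=
  ∀ v, (design x g h m *ᵥ v) ⬝ᵥ ((V g h m θ)⁻¹ *ᵥ r) = 0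

variable {pa pb pab pw : ℕ} {x : Covariates pa pb pab pw}

include hg hh hm in
-- The score is tested against the intercept, then against a single row or column covariate. Such a
-- table is constant in the remaining indices, so only one mean of V⁻¹F enters, and once the grand
-- mean is zero its nonzero eigenvalue factor cancels.
lemma IsScoreZero.means {θ : Fin 4 → ℝ} (hθ : ∀ l, 0 < θ l) {F : ℕ → ℕ → ℕ → ℝ}
    (hF : IsScoreZero x g h m θ (toCell g h m F)) :
    grandMean g h m F = 0 ∧ (∀ l, avg g (fun i => x.a i l * rowMean h m F i) = 0) ∧
      ∀ l, avg h (fun j => x.b j l * colMean g m F j) = 0 := by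
  have hs : ∀ v, grandMean g h m (fun i j k => fixedTable x v i j k * weighted g h m θ F i j k)
      = 0 := by
    intro v
    have h1 := hF v
    rw [V_inv_mulVec_toCell hg hh hm hθ, design_mulVec, toCell_dotProduct hg hh hm] at h1
    have : (g : ℝ) * h * m ≠ 0 := by positivity
    exact (mul_eq_zero.1 h1).resolve_left this
  obtain ⟨m0, m1, m2, -⟩ := means_weighted hg hh hm θ F
  have h0 : grandMean g h m F = 0 := by
    have h1 := hs (Pi.single (.inl ()) 1)
    have h2 : fixedTable x (Pi.single (.inl ()) 1 : FixedIdx pa pb pab pw → ℝ)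
        = fun _ _ _ => 1 := by
      funext i j k
      simp [fixedTable, slopeA, slopeB, slopeAB, slopeW, dotProduct]
    simp only [h2, one_mul] at h1
    have h3 := m0.symm.trans h1
    exact (mul_eq_zero.1 h3).resolve_left (inv_ne_zero (lam_pos hθ 0).ne')
  refine ⟨h0, fun l => ?_, fun l => ?_⟩
  · have h1 := hs (Pi.single (.inr (.inl l)) 1)
    have h2 : fixedTable x (Pi.single (.inr (.inl l)) 1 : FixedIdx pa pb pab pw → ℝ)
        = fun i _ _ => x.a i l := by
      funext i j k
      simp [fixedTable, slopeA, slopeB, slopeAB, slopeW, dotProduct, Pi.single_apply]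
    simp only [h2, grandMean, avg_const_mul] at h1
    have h3 : avg g (fun i => x.a i l * rowMean h m (weighted g h m θ F) i) = 0 := h1
    simp only [m1, h0, mul_zero, zero_add, sub_zero, mul_left_comm _ (lam g h m θ 1)⁻¹,
      avg_const_mul] at h3
    exact (mul_eq_zero.1 h3).resolve_left (inv_ne_zero (lam_pos hθ 1).ne')
  · have h1 := hs (Pi.single (.inr (.inr (.inl l))) 1)
    have h2 : fixedTable x (Pi.single (.inr (.inr (.inl l))) 1 : FixedIdx pa pb pab pw → ℝ)
        = fun _ j _ => x.b j l := by
      funext i j k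
      simp [fixedTable, slopeA, slopeB, slopeAB, slopeW, dotProduct, Pi.single_apply]
    simp only [h2, grandMean, avg_const_mul] at h1
    rw [avg_comm] at h1
    simp only [avg_const_mul] at h1
    have h3 : avg h (fun j => x.b j l * colMean g m (weighted g h m θ F) j) = 0 := h1
    simp only [m2, h0, mul_zero, zero_add, sub_zero, mul_left_comm _ (lam g h m θ 2)⁻¹,
      avg_const_mul] at h3
    exact (mul_eq_zero.1 h3).resolve_left (inv_ne_zero (lam_pos hθ 2).ne')

include hg hh hm in
/-- The predictors in terms of averages of residuals with vanishing grand mean. -/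
lemma blup_eq {y : Cell g h m → ℝ} {ω : Param pa pb pab pw} (hθ : ∀ l, 0 < ω.2 l)
    {F : ℕ → ℕ → ℕ → ℝ} (hy : resid x g h m y ω.1 = toCell g h m F)
    (h0 : grandMean g h m F = 0) {i j : ℕ} (hi : i < g) (hj : j < h) :
    blupα x g h m y ω i = ω.2 0 * (h * m) / lam g h m ω.2 1 * rowMean h m F i ∧
    blupβ x g h m y ω j = ω.2 1 * (g * m) / lam g h m ω.2 2 * colMean g m F j ∧
    blupγ x g h m y ω i j = ω.2 2 * m / lam g h m ω.2 1 * rowMean h m F i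
      + ω.2 2 * m / lam g h m ω.2 2 * colMean g m F j
      + ω.2 2 * m / lam g h m ω.2 3 * (cellMean m F i j - rowMean h m F i - colMean g m F j) := by
  obtain ⟨-, m1, m2, m3⟩ := means_weighted hg hh hm ω.2 F
  set G := weighted g h m ω.2 F with hG
  have hw : weightedResid x g h m y ω = toCell g h m G := by
    rw [weightedResid, hy, V_inv_mulVec_toCell hg hh hm hθ]
  have s1 : (∑ c : Cell g h m, if (c.1 : ℕ) = i then toCell g h m G c else 0)
      = h * m * rowMean h m G i := by
    rw [Fintype.sum_prod_type, Finset.sum_eq_single ⟨i, hi⟩]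
    · simp only [if_true, Fintype.sum_prod_type, toCell, rowMean, mul_assoc,
        ← sum_range_eq_avg hh, ← avg_const_mul, ← sum_range_eq_avg hm, Finset.sum_range]
    · intro b _ hb
      exact Finset.sum_eq_zero fun c _ => if_neg fun h => hb (Fin.ext h)
    · simp
  have s2 : (∑ c : Cell g h m, if (c.2.1 : ℕ) = j then toCell g h m G c else 0)
      = g * m * colMean g m G j := by
    rw [Fintype.sum_prod_type]
    have : ∀ i : Fin g, (∑ c : Fin h × Fin m, if (c.1 : ℕ) = j then toCell g h m G (i, c) else 0)
        = ∑ k ∈ Finset.range m, G i j k := by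
      intro i
      rw [Fintype.sum_prod_type, Finset.sum_eq_single ⟨j, hj⟩]
      · simp [toCell, Finset.sum_range]
      · intro b _ hb
        exact Finset.sum_eq_zero fun c _ => if_neg fun h => hb (Fin.ext h)
      · simp
    simp only [this, colMean, mul_assoc, ← sum_range_eq_avg hg, ← avg_const_mul,
      ← sum_range_eq_avg hm, Finset.sum_range]
  have s3 : (∑ c : Cell g h m, if (c.1 : ℕ) = i ∧ (c.2.1 : ℕ) = j then toCell g h m G c else 0)
      = m * cellMean m G i j := by
    rw [Fintype.sum_prod_type, Finset.sum_eq_single ⟨i, hi⟩]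
    · rw [Fintype.sum_prod_type, Finset.sum_eq_single ⟨j, hj⟩]
      · simp only [and_self, if_true, toCell, cellMean, ← sum_range_eq_avg hm, Finset.sum_range]
      · intro b _ hb
        exact Finset.sum_eq_zero fun c _ => if_neg fun h => hb (Fin.ext h.2)
      · simp
    · intro b _ hb
      exact Finset.sum_eq_zero fun c _ => if_neg fun h => hb (Fin.ext h.1)
    · simp
  refine ⟨?_, ?_, ?_⟩
  · rw [blupα, hw, s1, m1, h0]
    ring
  · rw [blupβ, hw, s2, m2, h0]
    ring
  · rw [blupγ, hw, s3, m3, h0]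
    ring

end Weighted

/-! ### From vanishing derivatives to the score equation -/

section Score
variable {pa pb pab pw : ℕ} {x : Covariates pa pb pab pw} {g h m : ℕ}

lemma V_transpose (θ : Fin 4 → ℝ) : (V g h m θ)ᵀ = V g h m θ := by
  ext c d
  simp [V, eq_comm]

/-- On a line through ξ the log-likelihood is a quadratic polynomial in the step, and its linear
coefficient is the score in that direction. -/
lemma isScoreZero_of_hasFDerivAt {y : Cell g h m → ℝ} {θ : Fin 4 → ℝ}
    {ξ : FixedIdx pa pb pab pw → ℝ}
    (hd : HasFDerivAt (fun ξ => logLik x g h m y (ξ, θ))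
      (0 : (FixedIdx pa pb pab pw → ℝ) →L[ℝ] ℝ) ξ) :
    IsScoreZero x g h m θ (resid x g h m y ξ) := by
  intro v
  have hline : HasDerivAt (fun t : ℝ => ξ + t • v) v 0 := by
    simpa using HasDerivAt.const_add ξ ((hasDerivAt_id (0 : ℝ)).smul_const v)
  have h1 : HasDerivAt (fun t : ℝ => logLik x g h m y (ξ + t • v, θ)) 0 0 := by
    have hd' : HasFDerivAt (fun ξ => logLik x g h m y (ξ, θ))
        (0 : (FixedIdx pa pb pab pw → ℝ) →L[ℝ] ℝ) (ξ + (0 : ℝ) • v) := by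
      simpa using hd
    have h0 := hd'.comp_hasDerivAt (0 : ℝ) hline
    exact h0
  set W := (V g h m θ)⁻¹ with hW
  have hWs : Wᵀ = W := by rw [hW, transpose_nonsing_inv, V_transpose]
  set r := resid x g h m y ξ with hr
  set d := design x g h m *ᵥ v with hdv
  have hq : ∀ t : ℝ, logLik x g h m y (ξ + t • v, θ) =
      (-((g * h * m : ℕ) : ℝ) / 2 * Real.log (2 * Real.pi) - Real.log (V g h m θ).det / 2
        - r ⬝ᵥ (W *ᵥ r) / 2) + t * (d ⬝ᵥ (W *ᵥ r)) - t ^ 2 * (d ⬝ᵥ (W *ᵥ d)) / 2 := by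
    intro t
    have e1 : resid x g h m y (ξ + t • v) = r - t • d := by
      simp only [resid, mulVec_add, mulVec_smul, hr, hdv]
      abel
    have e2 : r ⬝ᵥ (W *ᵥ d) = d ⬝ᵥ (W *ᵥ r) := by
      rw [dotProduct_mulVec, ← mulVec_transpose, hWs, dotProduct_comm]
    simp only [logLik, quadForm]
    rw [e1]
    simp only [mulVec_sub, mulVec_smul, dotProduct_sub, sub_dotProduct, dotProduct_smul,
      smul_dotProduct, smul_eq_mul, ← hW, e2]
    ring
  have h2 : HasDerivAt (fun t : ℝ => logLik x g h m y (ξ + t • v, θ)) (d ⬝ᵥ (W *ᵥ r)) 0 := by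
    simp only [hq]
    have := (((hasDerivAt_id (0 : ℝ)).mul_const (d ⬝ᵥ (W *ᵥ r))).const_add
      ((-((g * h * m : ℕ) : ℝ) / 2 * Real.log (2 * Real.pi) - Real.log (V g h m θ).det / 2
        - r ⬝ᵥ (W *ᵥ r) / 2))).sub ((((hasDerivAt_id (0 : ℝ)).pow 2).mul_const
          (d ⬝ᵥ (W *ᵥ d))).div_const 2)
    exact this.congr_deriv (by simp)
  exact h2.unique h1

lemma IsMLSolution.isScoreZero {y : Cell g h m → ℝ} {ω : Param pa pb pab pw}
    (hω : IsMLSolution x g h m y ω) : IsScoreZero x g h m ω.2 (resid x g h m y ω.1) := by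
  apply isScoreZero_of_hasFDerivAt
  have h1 : HasFDerivAt (fun ξ : FixedIdx pa pb pab pw → ℝ => (ξ, ω.2))
      (ContinuousLinearMap.inl ℝ (FixedIdx pa pb pab pw → ℝ) (Fin 4 → ℝ)) ω.1 :=
    hasFDerivAt_prodMk_left ω.1 ω.2
  exact (HasFDerivAt.comp ω.1 (g := logLik x g h m y) hω.2 h1).congr_fderiv (by simp)

lemma IsREMLSolution.isScoreZero {y : Cell g h m → ℝ} {ω : Param pa pb pab pw}
    (hω : IsREMLSolution x g h m y ω) : IsScoreZero x g h m ω.2 (resid x g h m y ω.1) :=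
  isScoreZero_of_hasFDerivAt hω.2.2

end Score
end CrossedModel
end

open Filter Topology MeasureTheory ProbabilityTheory
noncomputable section
namespace CrossedModel
open Asymptotics

/-! ### Stochastic orders as asymptotics along a filter -/

section StochasticOrder
variable {Ω : Type*} [MeasurableSpace Ω] (P : Measure Ω)

/-- The filter of the events `A t` with probability tending to one. -/
def whp : Filter (ℕ × Ω) where
  sets := {A | Tendsto (fun t => P {s | (t, s) ∉ A}) atTop (𝓝 0)}
  univ_sets := by simp
  sets_of_superset {A B} hA hAB :=
    tendsto_of_tendsto_of_tendsto_of_le_of_le tendsto_const_nhds hA (fun _ => zero_le)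
      fun t => measure_mono fun s hs h => hs (hAB h)
  inter_sets {A B} hA hB := by
    have h := hA.add hB
    rw [add_zero] at h
    refine tendsto_of_tendsto_of_tendsto_of_le_of_le tendsto_const_nhds h (fun _ => zero_le)
      fun t => le_trans (measure_mono ?_) (measure_union_le _ _)
    intro s hs
    by_cases h1 : (t, s) ∈ A
    · exact Or.inr fun h2 => hs ⟨h1, h2⟩
    · exact Or.inl h1

variable {P}

lemma eventually_whp {p : ℕ × Ω → Prop} :
    (∀ᶠ q in whp P, p q) ↔ Tendsto (fun t => P {s | ¬ p (t, s)}) atTop (𝓝 0) := Iff.rfl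

lemma tendsto_fst_whp : Tendsto Prod.fst (whp P) atTop := by
  intro A hA
  refine eventually_whp.2 (tendsto_const_nhds.congr' ?_)
  filter_upwards [hA] with t ht
  simp [ht]

/-- Boundedness in probability. -/
def Tight (P : Measure Ω) (R : ℕ × Ω → ℝ) : Prop :=
  ∀ ε : ℝ, 0 < ε → ∃ C : ℝ, ∀ᶠ t in atTop, P {s | C < |R (t, s)|} ≤ ENNReal.ofReal ε

lemma Tight.of_le {R R' : ℕ × Ω → ℝ} (h' : Tight P R') (h : ∀ᶠ q in whp P, |R q| ≤ |R' q|) :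
    Tight P R := by
  intro ε hε
  obtain ⟨C, hC⟩ := h' (ε / 2) (by positivity)
  have h2 := (eventually_whp.1 h).eventually_le_const
    (ENNReal.ofReal_pos.2 (half_pos hε))
  refine ⟨C, ?_⟩
  filter_upwards [hC, h2] with t h3 h4
  refine le_trans (measure_mono ?_) ((measure_union_le _ _).trans ((add_le_add h3 h4).trans ?_))
  · intro s hs
    by_cases h5 : |R (t, s)| ≤ |R' (t, s)|
    · exact Or.inl (lt_of_lt_of_le hs h5)
    · exact Or.inr h5
  · rw [← ENNReal.ofReal_add (by positivity) (by positivity), add_halves]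

lemma Tight.add {R R' : ℕ × Ω → ℝ} (h : Tight P R) (h' : Tight P R') :
    Tight P (fun q => R q + R' q) := by
  intro ε hε
  obtain ⟨C, hC⟩ := h (ε / 2) (by positivity)
  obtain ⟨C', hC'⟩ := h' (ε / 2) (by positivity)
  refine ⟨C + C', ?_⟩
  filter_upwards [hC, hC'] with t h3 h4
  refine le_trans (measure_mono ?_) ((measure_union_le _ _).trans ((add_le_add h3 h4).trans ?_))
  · intro s hs
    by_contra h5
    simp only [Set.mem_union, Set.mem_ofPred_eq, not_or, not_lt] at h5
    have := abs_add_le (R (t, s)) (R' (t, s))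
    have h6 : C + C' < |R (t, s) + R' (t, s)| := hs
    linarith
  · rw [← ENNReal.ofReal_add (by positivity) (by positivity), add_halves]

lemma Tight.neg {R : ℕ × Ω → ℝ} (h : Tight P R) : Tight P (fun q => - R q) := by
  simpa [Tight] using h

lemma Tight.sub {R R' : ℕ × Ω → ℝ} (h : Tight P R) (h' : Tight P R') :
    Tight P (fun q => R q - R' q) := by
  simpa [sub_eq_add_neg] using h.add h'.neg

lemma tight_const (c : ℝ) : Tight P (fun _ => c) := fun ε _ => ⟨|c|, by simp⟩

lemma Tight.const_mul {R : ℕ × Ω → ℝ} (h : Tight P R) (c : ℝ) : Tight P (fun q => c * R q) := by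
  intro ε hε
  obtain ⟨C, hC⟩ := h ε hε
  refine ⟨|c| * C, ?_⟩
  filter_upwards [hC] with t ht
  refine (measure_mono fun s hs => ?_).trans ht
  have hs' : |c| * C < |c * R (t, s)| := hs
  rw [abs_mul] at hs'
  exact lt_of_mul_lt_mul_left hs' (abs_nonneg c)

lemma Tight.sqrt {R : ℕ × Ω → ℝ} (h : Tight P R) : Tight P (fun q => √(R q)) := by
  refine ((tight_const 1).add (R' := fun q => |R q|) ?_).of_le (Eventually.of_forall fun q => ?_)
  · simpa [Tight] using h
  · rw [abs_of_nonneg (Real.sqrt_nonneg _), abs_of_nonneg (by positivity), Real.sqrt_le_left (by positivity)]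
    nlinarith [le_abs_self (R q), abs_nonneg (R q)]

lemma tight_of_integral_le [IsFiniteMeasure P] {R : ℕ × Ω → ℝ} (C : ℝ)
    (h : ∀ᶠ t in atTop, 0 ≤ᵐ[P] (fun s => R (t, s)) ∧ Integrable (fun s => R (t, s)) P ∧
      ∫ s, R (t, s) ∂P ≤ C) : Tight P R := by
  intro ε hε
  set K := max C 0 / ε + 1 with hK
  have hK0 : 0 < K := by positivity
  refine ⟨K, ?_⟩
  filter_upwards [h] with t ⟨h1, h2, h3⟩
  have h4 := mul_meas_ge_le_integral_of_nonneg h1 h2 K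
  have h5 : P.real {s | K ≤ R (t, s)} ≤ ε := by
    have h6 : K * P.real {s | K ≤ R (t, s)} ≤ K * ε := by
      refine h4.trans (h3.trans ?_)
      rw [hK, add_mul, div_mul_cancel₀ _ hε.ne']
      linarith [le_max_left C 0]
    exact le_of_mul_le_mul_left h6 hK0
  have h7 : P {s | K < |R (t, s)|} ≤ P {s | K ≤ R (t, s)} := by
    refine measure_mono_ae ?_
    filter_upwards [h1] with s hs hlt
    have h9 : K < |R (t, s)| := hlt
    rw [abs_of_nonneg hs] at h9
    exact h9.le
  refine h7.trans ?_
  rw [measureReal_def] at h5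
  exact (ENNReal.le_ofReal_iff_toReal_le (measure_ne_top _ _) hε.le).2 h5

lemma tight_of_integral_sq_le [IsFiniteMeasure P] {R : ℕ × Ω → ℝ} (C : ℝ)
    (h : ∀ᶠ t in atTop, Integrable (fun s => R (t, s) ^ 2) P ∧ ∫ s, R (t, s) ^ 2 ∂P ≤ C) :
    Tight P R := by
  have h1 : Tight P (fun q => R q ^ 2) := tight_of_integral_le C (by
    filter_upwards [h] with t ht
    exact ⟨ae_of_all _ fun s => sq_nonneg _, ht⟩)
  refine h1.sqrt.of_le (Eventually.of_forall fun q => ?_)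
  rw [Real.sqrt_sq_eq_abs, abs_abs]

/-- Tightness bounds R only off an event of small, not vanishing, probability. The argument
therefore runs separately at each level δ rather than inside the filter. -/
lemma Tight.mul_isLittleO {R X ρ : ℕ × Ω → ℝ} (hR : Tight P R) (hX : X =o[whp P] ρ) :
    (fun q => X q * R q) =o[whp P] ρ := by
  rw [isLittleO_iff]
  intro c hc
  rw [eventually_whp, ENNReal.tendsto_nhds_zero]
  intro ε hε
  obtain ⟨δ, hδ, hδε⟩ : ∃ δ : ℝ, 0 < δ ∧ ENNReal.ofReal δ + ENNReal.ofReal δ ≤ ε := by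
    by_cases hε' : ε = ⊤
    · exact ⟨1, one_pos, by simp [hε']⟩
    · refine ⟨ε.toReal / 2, half_pos (ENNReal.toReal_pos hε.ne' hε'), ?_⟩
      rw [← ENNReal.ofReal_add (by positivity) (by positivity), add_halves, ENNReal.ofReal_toReal hε']
  obtain ⟨C, hC⟩ := hR δ hδ
  have h1 := (eventually_whp.1 (isLittleO_iff.1 hX (c := c / (|C| + 1)) (by positivity))).eventually_le_const
    (ENNReal.ofReal_pos.2 hδ)
  filter_upwards [hC, h1] with t h3 h4
  refine le_trans (measure_mono ?_) ((measure_union_le _ _).trans ((add_le_add h3 h4).trans hδε))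
  intro s hs
  by_contra h5
  simp only [Set.mem_union, Set.mem_ofPred_eq, not_or, not_lt, not_not] at h5
  apply hs
  rw [norm_mul, Real.norm_eq_abs (R _)]
  calc ‖X (t, s)‖ * |R (t, s)| ≤ (c / (|C| + 1) * ‖ρ (t, s)‖) * (|C| + 1) := by
        refine mul_le_mul h5.2 ?_ (abs_nonneg _) (by positivity)
        linarith [h5.1, le_abs_self C]
    _ = c * ‖ρ (t, s)‖ := by field_simp

/-- A lemma to bound terms: `|R| ≤ X · T` with `X` deterministic and negligible, `T` tight. -/
lemma isLittleO_of_le_mul {R T : ℕ × Ω → ℝ} {X ρ : ℕ → ℝ} (hT : Tight P T)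
    (hX : X =o[atTop] ρ) (h : ∀ᶠ q in whp P, |R q| ≤ |X q.1 * T q|) :
    R =o[whp P] (fun q => ρ q.1) :=
  (IsBigO.of_bound 1 (by simpa using h)).trans_isLittleO
    (hT.mul_isLittleO (hX.comp_tendsto tendsto_fst_whp))

/-- Chebyshev's inequality in the form used throughout: X is the order of the standard deviation,
and it must be nonzero because R is divided by it. -/
lemma isLittleO_of_integral_sq_le [IsFiniteMeasure P] {R : ℕ × Ω → ℝ} {X ρ : ℕ → ℝ} (C : ℝ)
    (hX : X =o[atTop] ρ) (hX0 : ∀ᶠ t in atTop, X t ≠ 0)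
    (h : ∀ᶠ t in atTop, Integrable (fun s => R (t, s) ^ 2) P ∧ ∫ s, R (t, s) ^ 2 ∂P ≤ C * X t ^ 2) :
    R =o[whp P] (fun q => ρ q.1) := by
  have hT : Tight P (fun q => (X q.1)⁻¹ * R q) := tight_of_integral_sq_le C (by
    filter_upwards [h, hX0] with t ht hx
    simp only [mul_pow]
    refine ⟨ht.1.const_mul _, ?_⟩
    rw [integral_const_mul, inv_pow, inv_mul_le_iff₀ (by positivity), mul_comm]
    exact ht.2)
  refine isLittleO_of_le_mul hT hX ?_
  filter_upwards [tendsto_fst_whp.eventually hX0] with q hq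
  rw [mul_inv_cancel_left₀ hq]

lemma isLittleOp_of_isLittleO {R : ℕ → Ω → ℝ} {a : ℕ → ℝ} (ha : ∀ᶠ t in atTop, 0 < a t)
    (h : (fun q : ℕ × Ω => R q.1 q.2) =o[whp P] (fun q => a q.1)) : IsLittleOp P R a := by
  intro ε hε
  have h1 : ∀ᶠ q in whp P, ¬ (ε * a q.1 ≤ |R q.1 q.2|) := by
    filter_upwards [isLittleO_iff.1 h (half_pos hε), tendsto_fst_whp.eventually ha] with q h2 h3
    rw [Real.norm_eq_abs, Real.norm_eq_abs, abs_of_pos h3] at h2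
    nlinarith
  simpa using eventually_whp.1 h1

lemma isBigOp_of_le_mul {R : ℕ → Ω → ℝ} {T : ℕ × Ω → ℝ} {a : ℕ → ℝ} (hT : Tight P T)
    (ha : ∀ᶠ t in atTop, 0 ≤ a t) (h : ∀ᶠ q in whp P, |R q.1 q.2| ≤ a q.1 * |T q|) :
    IsBigOp P R a := by
  intro ε hε
  obtain ⟨C, hC⟩ := hT (ε / 2) (by positivity)
  have h2 := (eventually_whp.1 h).eventually_le_const (ENNReal.ofReal_pos.2 (half_pos hε))
  refine ⟨C, ?_⟩
  filter_upwards [hC, h2, ha] with t h3 h4 h5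
  refine le_trans (measure_mono ?_) ((measure_union_le _ _).trans ((add_le_add h3 h4).trans ?_))
  · intro s hs
    by_cases h6 : |R t s| ≤ a t * |T (t, s)|
    · have h7 : C * a t < |R t s| := hs
      exact Or.inl (lt_of_mul_lt_mul_left (by linarith : a t * C < a t * |T (t, s)|) h5)
    · exact Or.inr h6
  · rw [← ENNReal.ofReal_add (by positivity) (by positivity), add_halves]

/-- A sequence of events has probability tending to one if it contains the events `T ≤ B` of a
tight sequence, for every `B`, eventually. -/
lemma Tight.eventually_whp {T : ℕ × Ω → ℝ} (hT : Tight P T) {p : ℕ × Ω → Prop}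
    (h : ∀ B : ℝ, ∀ᶠ t in atTop, ∀ s, |T (t, s)| ≤ B → p (t, s)) : ∀ᶠ q in whp P, p q := by
  rw [CrossedModel.eventually_whp, ENNReal.tendsto_nhds_zero]
  intro ε hε
  obtain ⟨δ, hδ, hδε⟩ : ∃ δ : ℝ, 0 < δ ∧ ENNReal.ofReal δ ≤ ε := by
    by_cases hε' : ε = ⊤
    · exact ⟨1, one_pos, by simp [hε']⟩
    · exact ⟨ε.toReal, ENNReal.toReal_pos hε.ne' hε', by rw [ENNReal.ofReal_toReal hε']⟩
  obtain ⟨C, hC⟩ := hT δ hδ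
  filter_upwards [hC, h C] with t h1 h2
  refine (measure_mono fun s hs => ?_).trans (h1.trans hδε)
  by_contra h3
  exact hs (h2 s (not_lt.1 h3))

end StochasticOrder
end CrossedModel
end

open Filter Topology MeasureTheory ProbabilityTheory
noncomputable section
namespace CrossedModel
open Matrix

/-! ### Second moments of linear and quadratic forms -/

section Moments
variable {Ω : Type*} [MeasurableSpace Ω] {P : Measure Ω} [IsProbabilityMeasure P]
variable {J T : Type*}

/-- Independent centred variables with variances `v` and kurtosis at most `κ`. -/
structure IndepTerms (P : Measure Ω) (w : J → Ω → ℝ) (v : J → ℝ) (κ : ℝ) : Prop where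
  indep : iIndepFun w P
  memLp : ∀ j, MemLp (w j) 4 P
  mean : ∀ j, ∫ s, w j s ∂P = 0
  sq : ∀ j, ∫ s, w j s ^ 2 ∂P = v j
  fourth : ∀ j, ∫ s, w j s ^ 4 ∂P ≤ κ * v j ^ 2

/-- Square integrable variables with `E w_i w_j = v 1(i = j)`. -/
structure Uncorrelated (P : Measure Ω) (w : J → Ω → ℝ) (v : ℝ) : Prop where
  memLp : ∀ j, MemLp (w j) 2 P
  sq : ∀ j, ∫ s, w j s * w j s ∂P = v
  cross : ∀ i j, i ≠ j → ∫ s, w i s * w j s ∂P = 0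

omit [IsProbabilityMeasure P] in
lemma IndepTerms.precomp {w : J → Ω → ℝ} {v : J → ℝ} {κ : ℝ} (hw : IndepTerms P w v κ) {f : T → J}
    (hf : f.Injective) : IndepTerms P (w ∘ f) (v ∘ f) κ where
  indep := iIndepFun.precomp (g := f) hf hw.indep
  memLp _ := hw.memLp _
  mean _ := hw.mean _
  sq _ := hw.sq _
  fourth _ := hw.fourth _

omit [IsProbabilityMeasure P] in
lemma Uncorrelated.precomp {w : J → Ω → ℝ} {v : ℝ} (hw : Uncorrelated P w v) {f : T → J}
    (hf : f.Injective) : Uncorrelated P (w ∘ f) v where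
  memLp _ := hw.memLp _
  sq _ := hw.sq _
  cross _ _ h := hw.cross _ _ (hf.ne h)

namespace IndepTerms
variable {w : J → Ω → ℝ} {v : J → ℝ} {κ : ℝ} (hw : IndepTerms P w v κ)
include hw

lemma memLp_two (j : J) : MemLp (w j) 2 P := (hw.memLp j).mono_exponent (by norm_num)

omit [IsProbabilityMeasure P] in
lemma integral_mul (i j : J) (h : i ≠ j) : ∫ s, w i s * w j s ∂P = 0 := by
  rw [(hw.indep.indepFun h).integral_fun_mul_eq_mul_integral
    (hw.memLp i).aestronglyMeasurable (hw.memLp j).aestronglyMeasurable, hw.mean, zero_mul]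

lemma uncorrelated {c : ℝ} (hv : ∀ j, v j = c) : Uncorrelated P w c where
  memLp := hw.memLp_two
  sq j := by simpa [pow_two, hv] using hw.sq j
  cross := hw.integral_mul

omit [IsProbabilityMeasure P] in
lemma memLp_linear (S : Finset J) (c : J → ℝ) : MemLp (fun s => ∑ j ∈ S, c j * w j s) 4 P :=
  memLp_finsetSum S fun j _ => (hw.memLp j).const_mul (c j)

lemma integral_linear_sq (S : Finset J) (c : J → ℝ) :
    ∫ s, (∑ j ∈ S, c j * w j s) ^ 2 ∂P = ∑ j ∈ S, c j ^ 2 * v j := by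
  classical
  have hint : ∀ i j, Integrable (fun s => c i * c j * (w i s * w j s)) P := fun i j =>
    ((hw.memLp_two i).integrable_mul (hw.memLp_two j)).const_mul _
  have h1 : ∀ s, (∑ j ∈ S, c j * w j s) ^ 2
      = ∑ i ∈ S, ∑ j ∈ S, c i * c j * (w i s * w j s) := fun s => by
    rw [pow_two, Finset.sum_mul_sum]
    exact Finset.sum_congr rfl fun i _ => Finset.sum_congr rfl fun j _ => by ring
  simp only [h1]
  rw [integral_finsetSum _ fun i _ => integrable_finsetSum _ fun j _ => hint i j]
  refine Finset.sum_congr rfl fun i hi => ?_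
  rw [integral_finsetSum _ fun j _ => hint i j, Finset.sum_eq_single i]
  · rw [integral_const_mul, ← hw.sq i]
    simp only [pow_two]
  · intro j _ hj
    rw [integral_const_mul, hw.integral_mul i j hj.symm, mul_zero]
  · exact fun h => absurd hi h

omit [IsProbabilityMeasure P] in
lemma var_nonneg (j : J) : 0 ≤ v j := hw.sq j ▸ integral_nonneg fun _ => sq_nonneg _

omit [IsProbabilityMeasure P] in
/-- A variable is independent of the others. -/
lemma indepFun_restrict [DecidableEq J] {S : Finset J} {a : J} (ha : a ∉ S) :
    IndepFun (w a) (fun s j => if j ∈ S then w j s else 0) P := by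
  have h := hw.indep.indepFun_finset₀ {a} S (by simpa using ha)
    fun i => (hw.memLp i).aestronglyMeasurable.aemeasurable
  have h1 : Measurable fun p : (({a} : Finset J) → ℝ) => p ⟨a, by simp⟩ := measurable_pi_apply _
  have h2 : Measurable fun (p : S → ℝ) (j : J) => if hj : j ∈ S then p ⟨j, hj⟩ else 0 := by
    refine measurable_pi_iff.2 fun j => ?_
    by_cases hj : j ∈ S
    · simpa [hj] using measurable_pi_apply _
    · simp [hj]
  have h3 := h.comp h1 h2
  convert h3 using 1
  · rfl
  funext s j
  by_cases hj : j ∈ S <;> simp [hj]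

/-- Second moment of a centred quadratic form. -/
lemma integral_quadratic_sq_le (hκ : 0 ≤ κ) {M : J → J → ℝ} (hM : ∀ i j, M i j = M j i)
    (S : Finset J) :
    MemLp (fun s => ∑ i ∈ S, ∑ j ∈ S, M i j * (w i s * w j s) - ∑ i ∈ S, M i i * v i) 2 P ∧
    ∫ s, (∑ i ∈ S, ∑ j ∈ S, M i j * (w i s * w j s) - ∑ i ∈ S, M i i * v i) ∂P = 0 ∧
    ∫ s, (∑ i ∈ S, ∑ j ∈ S, M i j * (w i s * w j s) - ∑ i ∈ S, M i i * v i) ^ 2 ∂P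
      ≤ (κ + 2) * ∑ i ∈ S, ∑ j ∈ S, M i j ^ 2 * (v i * v j) := by
  classical
  induction S using Finset.induction_on with
  | empty => simp
  | insert a S ha ih =>
    obtain ⟨hQ, hQ0, hQ2⟩ := ih
    -- The new variable changes the centred form Q by 2 w_a L + M_aa D. Independence of w_a from the
    -- rest makes the three pieces pairwise uncorrelated; for Q against D this uses that Q is
    -- centred, hence the mean in the induction. The cross part contributes 4 v_a ∑ M² v where the
    -- double sum grows by 2 v_a ∑ M² v, which needs the factor 2, and the diagonal part needs κ.
    -- The constant κ + 2 covers both.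
    set Q : Ω → ℝ := fun s => ∑ i ∈ S, ∑ j ∈ S, M i j * (w i s * w j s) - ∑ i ∈ S, M i i * v i
      with hQdef
    set L : Ω → ℝ := fun s => ∑ j ∈ S, M a j * w j s with hLdef
    set D : Ω → ℝ := fun s => w a s ^ 2 - v a with hDdef
    have hL4 : MemLp L 4 P := hw.memLp_linear S _
    have hL : MemLp L 2 P := hL4.mono_exponent (by norm_num)
    have hL0 : ∫ s, L s ∂P = 0 := by
      rw [hLdef, integral_finsetSum _ fun j _ => ((hw.memLp_two j).integrable (by norm_num)).const_mul _]
      exact Finset.sum_eq_zero fun j _ => by rw [integral_const_mul, hw.mean, mul_zero]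
    have hL2 : ∫ s, L s ^ 2 ∂P = ∑ j ∈ S, M a j ^ 2 * v j := hw.integral_linear_sq S _
    have : ENNReal.HolderTriple 4 4 2 := ⟨by
      rw [← two_mul, show (4 : ENNReal) = 2 * 2 by norm_num,
        ENNReal.mul_inv (by norm_num) (by norm_num), ← mul_assoc,
        ENNReal.mul_inv_cancel (by norm_num) (by norm_num), one_mul]⟩
    have hwL : MemLp (fun s => w a s * L s) 2 P := hL4.mul (hw.memLp a)
    have hw2 : MemLp (fun s => w a s ^ 2) 2 P := by
      have : MemLp (fun s => w a s * w a s) 2 P := (hw.memLp a).mul (hw.memLp a)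
      simpa only [pow_two] using this
    have hD : MemLp D 2 P := hw2.sub (memLp_const _)
    have hD0 : ∫ s, D s ∂P = 0 := by
      rw [hDdef, integral_sub (hw2.integrable (by norm_num)) (integrable_const _), hw.sq]
      simp
    have hD2 : ∫ s, D s ^ 2 ∂P ≤ κ * v a ^ 2 := by
      have h4 : Integrable (fun s => w a s ^ 4) P := by
        have := hw2.integrable_sq
        simpa only [← pow_mul] using this
      have e : ∀ s, D s ^ 2 = w a s ^ 4 - 2 * v a * w a s ^ 2 + v a ^ 2 := fun s => by
        simp only [hDdef]; ring
      simp only [e]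
      have h5 := hw2.integrable (by norm_num : (1 : ENNReal) ≤ 2)
      rw [integral_add, integral_sub, integral_const_mul, hw.sq]
      · simp only [integral_const, probReal_univ, one_smul]
        nlinarith [hw.fourth a, sq_nonneg (v a)]
      all_goals fun_prop
    -- independence of the new variable
    have hind := hw.indepFun_restrict ha
    set R : Ω → J → ℝ := fun s j => if j ∈ S then w j s else 0 with hR
    set q : (J → ℝ) → ℝ := fun p => ∑ i ∈ S, ∑ j ∈ S, M i j * (p i * p j) - ∑ i ∈ S, M i i * v i
      with hq
    set l : (J → ℝ) → ℝ := fun p => ∑ j ∈ S, M a j * p j with hl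
    have hqm : Measurable q := by
      refine Measurable.sub (Finset.measurable_fun_sum _ fun i _ => Finset.measurable_fun_sum _
        fun j _ => ?_) measurable_const
      exact ((measurable_pi_apply i).mul (measurable_pi_apply j)).const_mul _
    have hlm : Measurable l :=
      Finset.measurable_fun_sum _ fun j _ => (measurable_pi_apply j).const_mul _
    have hqR : ∀ s, q (R s) = Q s := fun s => by
      simp only [hq, hQdef, hR]
      congr 1
      refine Finset.sum_congr rfl fun i hi => Finset.sum_congr rfl fun j hj => ?_
      simp [hi, hj]
    have hlR : ∀ s, l (R s) = L s := fun s => by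
      simp only [hl, hLdef, hR]
      exact Finset.sum_congr rfl fun j hj => by simp [hj]
    have fac : ∀ (φ : ℝ → ℝ) (ψ : (J → ℝ) → ℝ), Measurable φ → Measurable ψ →
        AEStronglyMeasurable (fun s => ψ (R s)) P →
        ∫ s, φ (w a s) * ψ (R s) ∂P = (∫ s, φ (w a s) ∂P) * ∫ s, ψ (R s) ∂P := by
      intro φ ψ hφ hψ hm
      exact (hind.comp hφ hψ).integral_fun_mul_eq_mul_integral
        (hφ.comp_aemeasurable (hw.memLp a).aestronglyMeasurable.aemeasurable).aestronglyMeasurable hm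
    have c1 : ∫ s, Q s * (w a s * L s) ∂P = 0 := by
      have := fac id (fun p => q p * l p) measurable_id (hqm.mul hlm) (by
        simp only [hqR, hlR]; exact hQ.aestronglyMeasurable.mul hL.aestronglyMeasurable)
      simp only [id, hqR, hlR, hw.mean, zero_mul] at this
      rw [← this]
      exact integral_congr_ae (ae_of_all _ fun s => by ring)
    have c2 : ∫ s, Q s * D s ∂P = 0 := by
      have := fac (fun z => z ^ 2 - v a) q (by fun_prop) hqm (by
        simp only [hqR]; exact hQ.aestronglyMeasurable)
      simp only [hqR] at this
      rw [show (∫ s, Q s ∂P) = 0 from hQ0, mul_zero] at this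
      rw [← this]
      exact integral_congr_ae (ae_of_all _ fun s => by simp only [hDdef]; ring)
    have c3 : ∫ s, (w a s * L s) * D s ∂P = 0 := by
      have := fac (fun z => z * (z ^ 2 - v a)) l (by fun_prop) hlm (by
        simp only [hlR]; exact hL.aestronglyMeasurable)
      simp only [hlR, hL0, mul_zero] at this
      rw [← this]
      exact integral_congr_ae (ae_of_all _ fun s => by simp only [hDdef]; ring)
    have c4 : ∫ s, (w a s * L s) ^ 2 ∂P = v a * ∑ j ∈ S, M a j ^ 2 * v j := by
      have := fac (fun z => z ^ 2) (fun p => l p ^ 2) (by fun_prop) (hlm.pow_const 2) (by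
        simp only [hlR]; exact hL.aestronglyMeasurable.pow 2)
      simp only [hlR, hL2, hw.sq] at this
      rw [← this]
      exact integral_congr_ae (ae_of_all _ fun s => by ring)
    have c5 : ∫ s, w a s * L s ∂P = 0 := by
      have := fac id l measurable_id hlm (by simp only [hlR]; exact hL.aestronglyMeasurable)
      simpa only [id, hlR, hw.mean, zero_mul] using this
    have hrec : (fun s => ∑ i ∈ insert a S, ∑ j ∈ insert a S, M i j * (w i s * w j s)
        - ∑ i ∈ insert a S, M i i * v i) = fun s => Q s + 2 * (w a s * L s) + M a a * D s := by
      funext s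
      simp only [Finset.sum_insert ha, Finset.sum_add_distrib, hQdef, hLdef, hDdef]
      have : ∑ i ∈ S, M i a * (w i s * w a s) = ∑ i ∈ S, w a s * (M a i * w i s) :=
        Finset.sum_congr rfl fun i _ => by rw [hM i a]; ring
      have h' : ∑ i ∈ S, M a i * (w a s * w i s) = ∑ i ∈ S, w a s * (M a i * w i s) :=
        Finset.sum_congr rfl fun i _ => by ring
      rw [this, h', ← Finset.mul_sum]
      ring
    have hX : MemLp (fun s => Q s + 2 * (w a s * L s) + M a a * D s) 2 P :=
      (hQ.add (hwL.const_mul 2)).add (hD.const_mul (M a a))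
    refine ⟨hrec ▸ hX, ?_, ?_⟩
    · have e := congrArg (fun f => ∫ s, f s ∂P) hrec
      refine e.trans ?_
      have i1 := hQ.integrable (by norm_num : (1 : ENNReal) ≤ 2)
      have i2 := hwL.integrable (by norm_num : (1 : ENNReal) ≤ 2)
      have i3 := hD.integrable (by norm_num : (1 : ENNReal) ≤ 2)
      rw [integral_add, integral_add, integral_const_mul, integral_const_mul, c5, hD0,
        show (∫ s, Q s ∂P) = 0 from hQ0]
      · simp
      all_goals fun_prop
    · have e := congrArg (fun f => ∫ s, f s ^ 2 ∂P) hrec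
      refine e.trans_le ?_
      have i1 := hQ.integrable_sq
      have i2 := hwL.integrable_sq
      have i3 := hD.integrable_sq
      have i4 : Integrable (fun s => Q s * (w a s * L s)) P := hQ.integrable_mul hwL
      have i5 : Integrable (fun s => Q s * D s) P := hQ.integrable_mul hD
      have i6 : Integrable (fun s => (w a s * L s) * D s) P := hwL.integrable_mul hD
      have e2 : ∀ s, (Q s + 2 * (w a s * L s) + M a a * D s) ^ 2
          = Q s ^ 2 + 4 * (w a s * L s) ^ 2 + M a a ^ 2 * D s ^ 2 + 4 * (Q s * (w a s * L s))
            + 2 * M a a * (Q s * D s) + 4 * M a a * ((w a s * L s) * D s) := fun s => by ring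
      simp only [e2]
      rw [integral_add, integral_add, integral_add, integral_add, integral_add, integral_const_mul,
        integral_const_mul, integral_const_mul, integral_const_mul, integral_const_mul, c1, c2, c3, c4]
      · have h1 : ∑ i ∈ insert a S, ∑ j ∈ insert a S, M i j ^ 2 * (v i * v j)
            = ∑ i ∈ S, ∑ j ∈ S, M i j ^ 2 * (v i * v j) + 2 * (v a * ∑ j ∈ S, M a j ^ 2 * v j)
              + M a a ^ 2 * v a ^ 2 := by
          simp only [Finset.sum_insert ha, Finset.sum_add_distrib]
          have h2 : ∑ i ∈ S, M i a ^ 2 * (v i * v a) = ∑ i ∈ S, v a * (M a i ^ 2 * v i) :=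
            Finset.sum_congr rfl fun i _ => by rw [hM i a]; ring
          have h3 : ∑ i ∈ S, M a i ^ 2 * (v a * v i) = ∑ i ∈ S, v a * (M a i ^ 2 * v i) :=
            Finset.sum_congr rfl fun i _ => by ring
          rw [h2, h3, ← Finset.mul_sum]
          ring
        have h4 : 0 ≤ v a * ∑ j ∈ S, M a j ^ 2 * v j := mul_nonneg (hw.var_nonneg a)
          (Finset.sum_nonneg fun j _ => mul_nonneg (sq_nonneg _) (hw.var_nonneg j))
        have h5 : M a a ^ 2 * ∫ s, D s ^ 2 ∂P ≤ M a a ^ 2 * (κ * v a ^ 2) := by gcongr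
        have h6 : 0 ≤ M a a ^ 2 * v a ^ 2 := by positivity
        rw [h1]
        have h7 : ∫ s, Q s ^ 2 ∂P ≤ _ := hQ2
        nlinarith
      all_goals fun_prop
end IndepTerms

omit [IsProbabilityMeasure P] in
lemma Uncorrelated.integral_sum_sq {w : J → Ω → ℝ} {v : ℝ} (hw : Uncorrelated P w v) (S : Finset J)
    (c d : J → ℝ) : ∫ s, (∑ j ∈ S, c j * w j s) * (∑ j ∈ S, d j * w j s) ∂P
      = ∑ j ∈ S, c j * d j * v := by
  classical
  have hint : ∀ i j, Integrable (fun s => c i * d j * (w i s * w j s)) P := fun i j =>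
    ((hw.memLp i).integrable_mul (hw.memLp j)).const_mul _
  have h1 : ∀ s, (∑ j ∈ S, c j * w j s) * (∑ j ∈ S, d j * w j s)
      = ∑ i ∈ S, ∑ j ∈ S, c i * d j * (w i s * w j s) := fun s => by
    rw [Finset.sum_mul_sum]
    exact Finset.sum_congr rfl fun i _ => Finset.sum_congr rfl fun j _ => by ring
  simp only [h1]
  rw [integral_finsetSum _ fun i _ => integrable_finsetSum _ fun j _ => hint i j]
  refine Finset.sum_congr rfl fun i hi => ?_
  rw [integral_finsetSum _ fun j _ => hint i j, Finset.sum_eq_single i]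
  · rw [integral_const_mul, hw.sq]
  · intro j _ hj
    rw [integral_const_mul, hw.cross i j hj.symm, mul_zero]
  · exact fun h => absurd hi h

omit [IsProbabilityMeasure P] in
lemma Uncorrelated.integral_avg_sq {w : ℕ → Ω → ℝ} {v : ℝ} (hw : Uncorrelated P w v) {n : ℕ}
    (hn : 0 < n) (c : ℕ → ℝ) :
    Integrable (fun s => (avg n fun i => c i * w i s) ^ 2) P ∧
    ∫ s, (avg n fun i => c i * w i s) ^ 2 ∂P = avg n (fun i => c i ^ 2) * v / n := by
  have hn' : (n : ℝ) ≠ 0 := by positivity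
  constructor
  · have : MemLp (fun s => avg n fun i => c i * w i s) 2 P := by
      simp only [avg, smul_eq_mul]
      exact (memLp_finsetSum _ fun j _ => (hw.memLp j).const_mul (c j)).const_mul _
    exact this.integrable_sq
  · have h1 := hw.integral_sum_sq (Finset.range n) c c
    have e : ∀ s, (avg n fun i => c i * w i s) ^ 2 = ((n : ℝ)⁻¹) ^ 2 *
        ((∑ j ∈ Finset.range n, c j * w j s) * (∑ j ∈ Finset.range n, c j * w j s)) := fun s => by
      simp only [avg, smul_eq_mul]; ring
    simp only [e]
    rw [integral_const_mul, h1, ← Finset.sum_mul]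
    simp only [avg, smul_eq_mul, ← pow_two]
    field_simp

omit [IsProbabilityMeasure P] in
-- Allows error means to be formed one index at a time, first over replicates and then over columns
-- or rows.
lemma Uncorrelated.avg {w : T × ℕ → Ω → ℝ} {v : ℝ} (hw : Uncorrelated P w v) {n : ℕ}
    (hn : 0 < n) : Uncorrelated P (fun t s => avg n fun k => w (t, k) s) (v / n) where
  memLp t := by
    simp only [CrossedModel.avg, smul_eq_mul]
    exact (memLp_finsetSum _ fun j _ => hw.memLp (t, j)).const_mul _
  sq t := by
    have h1 := (hw.precomp (f := fun k : ℕ => (t, k)) (fun a b h => by simpa using h)).integral_avg_sq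
      hn (fun _ => 1)
    simpa [pow_two, avg_const hn] using h1.2
  cross t t' h := by
    have e : ∀ s, (CrossedModel.avg n fun k => w (t, k) s) * (CrossedModel.avg n fun k => w (t', k) s)
        = ((n : ℝ)⁻¹) ^ 2 * ∑ k ∈ Finset.range n, ∑ k' ∈ Finset.range n, w (t, k) s * w (t', k') s :=
      fun s => by
        simp only [CrossedModel.avg, smul_eq_mul, ← Finset.sum_mul_sum]
        ring
    have hint : ∀ k k', Integrable (fun s => w (t, k) s * w (t', k') s) P := fun k k' =>
      (hw.memLp _).integrable_mul (hw.memLp _)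
    simp only [e]
    rw [integral_const_mul, integral_finsetSum _ fun i _ => integrable_finsetSum _ fun j _ => hint i j]
    refine mul_eq_zero_of_right _ (Finset.sum_eq_zero fun k _ => ?_)
    rw [integral_finsetSum _ fun j _ => hint k j]
    exact Finset.sum_eq_zero fun k' _ => hw.cross _ _ fun h' => h (Prod.ext_iff.1 h').1

end Moments
end CrossedModel
end

open Filter Topology MeasureTheory ProbabilityTheory
noncomputable section
namespace CrossedModel
open Matrix

/-! ### Moments of the noise within a stratum -/

section QuadraticForms
variable {Ω : Type*} [MeasurableSpace Ω] {P : Measure Ω} [IsProbabilityMeasure P]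
variable {N J K p : Type*} [Fintype N] [DecidableEq N] [Fintype J] [DecidableEq J] [Fintype K]
  [Fintype p]
variable {w : J → Ω → ℝ} {v : J → ℝ} {κ : ℝ}

omit [IsProbabilityMeasure P] [DecidableEq N] in
lemma IndepTerms.integral_dotProduct_sq (hw : IndepTerms P w v κ) (Z : Matrix N J ℝ) (c : N → ℝ) :
    Integrable (fun s => (c ⬝ᵥ (Z *ᵥ fun j => w j s)) ^ 2) P ∧
    ∫ s, (c ⬝ᵥ (Z *ᵥ fun j => w j s)) ^ 2 ∂P = c ⬝ᵥ ((Z * diagonal v * Zᵀ) *ᵥ c) := by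
  have e : ∀ s, c ⬝ᵥ (Z *ᵥ fun j => w j s) = ∑ j, (Zᵀ *ᵥ c) j * w j s := fun s => by
    rw [dotProduct_mulVec, ← mulVec_transpose]
    rfl
  simp only [e]
  have := hw.indep.isProbabilityMeasure
  refine ⟨((hw.memLp_linear Finset.univ _).mono_exponent (by norm_num)).integrable_sq, ?_⟩
  rw [hw.integral_linear_sq, ← mulVec_mulVec, ← mulVec_mulVec, dotProduct_mulVec, ← mulVec_transpose]
  simp only [dotProduct, mulVec_diagonal]
  exact Finset.sum_congr rfl fun j _ => by ring

omit [DecidableEq N] in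
-- Pulling E back to M = Zᵀ E Z gives a quadratic form in independent variables. By cyclicity of the
-- trace, ∑ M_ij² v_i v_j is the trace of the square of E times the covariance.
lemma IndepTerms.integral_quadForm_sq_le (hw : IndepTerms P w v κ) (hκ : 0 ≤ κ) (Z : Matrix N J ℝ)
    {E : Matrix N N ℝ} (hE : Eᵀ = E) :
    Integrable (fun s => ((Z *ᵥ fun j => w j s) ⬝ᵥ (E *ᵥ (Z *ᵥ fun j => w j s))
      - (E * (Z * diagonal v * Zᵀ)).trace) ^ 2) P ∧
    ∫ s, ((Z *ᵥ fun j => w j s) ⬝ᵥ (E *ᵥ (Z *ᵥ fun j => w j s))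
      - (E * (Z * diagonal v * Zᵀ)).trace) ^ 2 ∂P
      ≤ (κ + 2) * (E * (Z * diagonal v * Zᵀ) * (E * (Z * diagonal v * Zᵀ))).trace := by
  set M := Zᵀ * E * Z with hMdef
  have hMt : Mᵀ = M := by
    rw [hMdef, transpose_mul, transpose_mul, hE, transpose_transpose, Matrix.mul_assoc]
  have hM : ∀ i j, M i j = M j i := fun i j => by
    conv_lhs => rw [← hMt]
    rfl
  obtain ⟨h1, -, h3⟩ := hw.integral_quadratic_sq_le hκ hM Finset.univ
  have e : ∀ s, ((Z *ᵥ fun j => w j s) ⬝ᵥ (E *ᵥ (Z *ᵥ fun j => w j s))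
      - (E * (Z * diagonal v * Zᵀ)).trace)
      = ∑ i, ∑ j, M i j * (w i s * w j s) - ∑ i, M i i * v i := fun s => by
    congr 1
    · have h4 : (Z *ᵥ fun j => w j s) ⬝ᵥ (E *ᵥ (Z *ᵥ fun j => w j s))
          = (fun j => w j s) ⬝ᵥ (M *ᵥ fun j => w j s) := by
        rw [hMdef, ← mulVec_mulVec, ← mulVec_mulVec, dotProduct_mulVec (fun j => w j s),
          vecMul_transpose]
      rw [h4]
      simp only [dotProduct, mulVec, Finset.mul_sum]
      exact Finset.sum_congr rfl fun i _ => Finset.sum_congr rfl fun j _ => by ring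
    · have : (E * (Z * diagonal v * Zᵀ)).trace = (M * diagonal v).trace := by
        rw [show E * (Z * diagonal v * Zᵀ) = (E * Z * diagonal v) * Zᵀ by
          simp only [Matrix.mul_assoc], Matrix.trace_mul_comm, hMdef]
        simp only [Matrix.mul_assoc]
      rw [this]
      simp [trace, mul_diagonal]
  simp only [e]
  refine ⟨h1.integrable_sq, h3.trans_eq ?_⟩
  congr 1
  have h4 : (E * (Z * diagonal v * Zᵀ) * (E * (Z * diagonal v * Zᵀ))).trace
      = (M * diagonal v * (M * diagonal v)).trace := by
    have : E * (Z * diagonal v * Zᵀ) * (E * (Z * diagonal v * Zᵀ))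
        = (E * Z * diagonal v * Zᵀ * E * Z * diagonal v) * Zᵀ := by
      simp only [Matrix.mul_assoc]
    rw [this, Matrix.trace_mul_comm, hMdef]
    simp only [Matrix.mul_assoc]
  rw [h4]
  simp only [trace, diag_apply]
  refine Finset.sum_congr rfl fun i _ => ?_
  rw [mul_apply]
  refine Finset.sum_congr rfl fun j _ => ?_
  rw [mul_diagonal, mul_diagonal, hM j i]
  ring

lemma IsResolution.mul_sum {E : K → Matrix N N ℝ} (hE : IsResolution E) (l : K → ℝ) (k : K) : E k * ∑ k, l k • E k = l k • E k := by
  classical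
  rw [Finset.mul_sum, Finset.sum_eq_single k]
  · rw [mul_smul_comm, hE.idem]
  · intro j _ hj
    rw [mul_smul_comm, hE.orth k j hj.symm, smul_zero]
  · simp

variable {E : K → Matrix N N ℝ} (hE : IsResolution E) {l : K → ℝ} {Z : Matrix N J ℝ}
  (hV : Z * diagonal v * Zᵀ = ∑ k, l k • E k)
include hE hV

omit [IsProbabilityMeasure P] in
-- The columns of E_k X lie in stratum k, where the noise has variance l_k in every direction, and
-- an orthonormal basis of their span has at most as many elements as there are fixed effects.
lemma IndepTerms.integral_projSq_le (hw : IndepTerms P w v κ) (k : K) (hl : 0 ≤ l k)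
    (X : Matrix N p ℝ) :
    Integrable (fun s => projSq (E k * X) (Z *ᵥ fun j => w j s)) P ∧
    ∫ s, projSq (E k * X) (Z *ᵥ fun j => w j s) ∂P ≤ Fintype.card p * l k := by
  obtain ⟨d, e, hd, he1, he2, he⟩ := exists_projSq_eq (E k * X)
  simp only [he]
  have hi : ∀ i, Integrable (fun s => (e i ⬝ᵥ (Z *ᵥ fun j => w j s)) ^ 2) P :=
    fun i => (hw.integral_dotProduct_sq Z (e i)).1
  refine ⟨integrable_finsetSum _ fun i _ => hi i, ?_⟩
  rw [integral_finsetSum _ fun i _ => hi i]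
  have h1 : ∀ i, ∫ s, (e i ⬝ᵥ (Z *ᵥ fun j => w j s)) ^ 2 ∂P = l k := by
    intro i
    rw [(hw.integral_dotProduct_sq Z (e i)).2, hV]
    obtain ⟨u, hu⟩ := he2 i
    have h2 : E k *ᵥ e i = e i := by
      rw [hu, mulVec_mulVec, ← Matrix.mul_assoc, hE.idem]
    rw [dotProduct_sum_smul_mulVec, Finset.sum_eq_single k]
    · rw [h2, he1, mul_one]
    · intro j _ hj
      rw [← h2, mulVec_mulVec, hE.orth j k hj, zero_mulVec, dotProduct_zero, mul_zero]
    · simp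
  rw [Finset.sum_congr rfl fun i _ => h1 i]
  simp only [Finset.sum_const, Finset.card_univ, Fintype.card_fin, nsmul_eq_mul]
  gcongr

/-- Inside a stratum the covariance acts as the scalar l_k, so both traces collapse. The relative
error of the sum of squares is of order (tr E_k)^(-1/2). -/
lemma IndepTerms.integral_stratum_sq_le (hw : IndepTerms P w v κ) (hκ : 0 ≤ κ) (k : K) :
    Integrable (fun s => ((Z *ᵥ fun j => w j s) ⬝ᵥ (E k *ᵥ (Z *ᵥ fun j => w j s))
      - l k * (E k).trace) ^ 2) P ∧
    ∫ s, ((Z *ᵥ fun j => w j s) ⬝ᵥ (E k *ᵥ (Z *ᵥ fun j => w j s)) - l k * (E k).trace) ^ 2 ∂P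
      ≤ (κ + 2) * (l k ^ 2 * (E k).trace) := by
  have h := hw.integral_quadForm_sq_le hκ Z (hE.symm k)
  rw [hV, hE.mul_sum, trace_smul, smul_mul_smul_comm, hE.idem, trace_smul] at h
  simpa only [smul_eq_mul, ← pow_two] using h

end QuadraticForms

/-! ### The random terms of the model as one independent family -/

section Noise
variable {Ω : Type*} [MeasurableSpace Ω] {P : Measure Ω} [IsProbabilityMeasure P]

/-- All random terms as one family. -/
def RandomTerms.all (u : RandomTerms Ω) : ℕ ⊕ ℕ ⊕ (ℕ × ℕ) ⊕ (ℕ × ℕ × ℕ) → Ω → ℝ :=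
  Sum.elim u.α (Sum.elim u.β (Sum.elim u.γ u.e))

def allVar (θ : Fin 4 → ℝ) : ℕ ⊕ ℕ ⊕ (ℕ × ℕ) ⊕ (ℕ × ℕ × ℕ) → ℝ :=
  Sum.elim (fun _ => θ 0) (Sum.elim (fun _ => θ 1) (Sum.elim (fun _ => θ 2) fun _ => θ 3))

/-- The table of random deviations. -/
def noise (u : RandomTerms Ω) (s : Ω) (i j k : ℕ) : ℝ :=
  u.α i s + u.β j s + u.γ (i, j) s + u.e (i, j, k) s

/-- Identical distribution lets one constant serve the whole family: κ is the common fourth moment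
divided by v². -/
lemma moments_of_identDistrib {T : Type*} {X : T → Ω → ℝ} {X0 : Ω → ℝ}
    (hX : ∀ i, IdentDistrib (X i) X0 P P) (h0 : ∫ s, X0 s ∂P = 0) {v δ : ℝ}
    (hv : variance X0 P = v) (hvpos : 0 < v) (hδ : 0 < δ)
    (hm : MemLp X0 (ENNReal.ofReal (4 + δ)) P) :
    ∃ κ : ℝ, 0 ≤ κ ∧ ∀ i, MemLp (X i) 4 P ∧ ∫ s, X i s ∂P = 0 ∧ ∫ s, X i s ^ 2 ∂P = v ∧
      ∫ s, X i s ^ 4 ∂P ≤ κ * v ^ 2 := by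
  have hm4 : MemLp X0 4 P := hm.mono_exponent (by
    rw [show (4 : ENNReal) = ENNReal.ofReal 4 by norm_num]
    exact ENNReal.ofReal_le_ofReal (by linarith))
  refine ⟨(∫ s, X0 s ^ 4 ∂P) / v ^ 2, div_nonneg (integral_nonneg fun s => by positivity)
    (by positivity), fun i => ⟨(hX i).symm.memLp_snd hm4, ?_, ?_, ?_⟩⟩
  · rw [(hX i).integral_eq, h0]
  · rw [← hv, variance_of_integral_eq_zero hm4.aestronglyMeasurable.aemeasurable h0]
    exact ((hX i).comp (u := fun z : ℝ => z ^ 2) (by fun_prop)).integral_eq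
  · rw [div_mul_cancel₀ _ (by positivity)]
    exact ((hX i).comp (u := fun z : ℝ => z ^ 4) (by fun_prop)).integral_eq.le

lemma RandomTermsCondition.exists_indepTerms {u : RandomTerms Ω} {θ : Fin 4 → ℝ}
    (hu : RandomTermsCondition P u θ) (hθ : ∀ l, 0 < θ l) :
    ∃ κ : ℝ, 0 ≤ κ ∧ IndepTerms P u.all (allVar θ) κ := by
  obtain ⟨δ, hδ, m0, m1, m2, m3⟩ := hu.moment
  obtain ⟨κ0, k0, h0⟩ := moments_of_identDistrib hu.ident_α hu.mean_α hu.var_α (hθ 0) hδ m0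
  obtain ⟨κ1, k1, h1⟩ := moments_of_identDistrib hu.ident_β hu.mean_β hu.var_β (hθ 1) hδ m1
  obtain ⟨κ2, k2, h2⟩ := moments_of_identDistrib hu.ident_γ hu.mean_γ hu.var_γ (hθ 2) hδ m2
  obtain ⟨κ3, k3, h3⟩ := moments_of_identDistrib hu.ident_e hu.mean_e hu.var_e (hθ 3) hδ m3
  refine ⟨κ0 + κ1 + κ2 + κ3, by positivity, hu.indep, ?_, ?_, ?_, ?_⟩
  · rintro (i | i | i | i)
    exacts [(h0 i).1, (h1 i).1, (h2 i).1, (h3 i).1]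
  · rintro (i | i | i | i)
    exacts [(h0 i).2.1, (h1 i).2.1, (h2 i).2.1, (h3 i).2.1]
  · rintro (i | i | i | i)
    exacts [(h0 i).2.2.1, (h1 i).2.2.1, (h2 i).2.2.1, (h3 i).2.2.1]
  · rintro (i | i | i | i)
    · exact (h0 i).2.2.2.trans (mul_le_mul_of_nonneg_right (by linarith) (sq_nonneg _))
    · exact (h1 i).2.2.2.trans (mul_le_mul_of_nonneg_right (by linarith) (sq_nonneg _))
    · exact (h2 i).2.2.2.trans (mul_le_mul_of_nonneg_right (by linarith) (sq_nonneg _))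
    · exact (h3 i).2.2.2.trans (mul_le_mul_of_nonneg_right (by linarith) (sq_nonneg _))

/-- Design matrix of the random terms in a `g × h × m` table. -/
def randomDesign (g h m : ℕ) :
    Matrix (Cell g h m) (Fin g ⊕ Fin h ⊕ (Fin g × Fin h) ⊕ Cell g h m) ℝ :=
  Matrix.of fun c => Sum.elim (fun i => if c.1 = i then 1 else 0)
    (Sum.elim (fun j => if c.2.1 = j then 1 else 0)
      (Sum.elim (fun p => if (c.1, c.2.1) = p then 1 else 0) fun d => if c = d then 1 else 0))

def termIndex (g h m : ℕ) :
    Fin g ⊕ Fin h ⊕ (Fin g × Fin h) ⊕ Cell g h m → ℕ ⊕ ℕ ⊕ (ℕ × ℕ) ⊕ (ℕ × ℕ × ℕ) :=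
  Sum.map (fun i => (i : ℕ)) (Sum.map (fun j => (j : ℕ))
    (Sum.map (fun p => ((p.1 : ℕ), (p.2 : ℕ))) fun c => ((c.1 : ℕ), (c.2.1 : ℕ), (c.2.2 : ℕ))))

lemma termIndex_injective (g h m : ℕ) : (termIndex g h m).Injective := by
  refine Sum.map_injective.2 ⟨Fin.val_injective, Sum.map_injective.2 ⟨Fin.val_injective,
    Sum.map_injective.2 ⟨fun p q h => ?_, fun p q h => ?_⟩⟩⟩
  · simpa [Prod.ext_iff, Fin.ext_iff] using h
  · simpa [Prod.ext_iff, Fin.ext_iff] using h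

omit [MeasurableSpace Ω] in
lemma randomDesign_mulVec (g h m : ℕ) (u : RandomTerms Ω) (s : Ω) :
    randomDesign g h m *ᵥ (fun ι => (u.all ∘ termIndex g h m) ι s) = toCell g h m (noise u s) := by
  ext c
  simp [randomDesign, mulVec, dotProduct, Fintype.sum_sum_type, toCell, noise, termIndex,
    RandomTerms.all, add_assoc]

/-- Supplies the factorisation of V under which the moment bounds for strata are stated. -/
lemma randomDesign_covariance (g h m : ℕ) (θ : Fin 4 → ℝ) :
    randomDesign g h m * diagonal (allVar θ ∘ termIndex g h m) * (randomDesign g h m)ᵀ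
      = V g h m θ := by
  ext c d
  rw [mul_apply]
  simp only [mul_diagonal, transpose_apply, Fintype.sum_sum_type, randomDesign, of_apply,
    Sum.elim_inl, Sum.elim_inr, Function.comp_apply, termIndex, Sum.map_inl, Sum.map_inr, allVar, V,
    ite_mul, mul_ite, one_mul, mul_one, zero_mul, mul_zero, Finset.sum_ite_eq, Finset.mem_univ,
    if_true, add_assoc, Prod.mk.injEq]

end Noise
end CrossedModel
end

open Filter Topology MeasureTheory ProbabilityTheory
noncomputable section
namespace CrossedModel
open Matrix

/-! ### Quadratic forms with a positive definite limit -/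

section PosDefLimits
variable {n ι : Type*} [Fintype n]

/-- The form attains a positive minimum on the unit sphere, and homogeneity does the rest. The
sphere is empty when there are no covariates, so that case is treated separately. -/
lemma exists_le_quadForm_of_posDef {L : Matrix n n ℝ} (hL : L.PosDef) :
    ∃ c : ℝ, 0 < c ∧ ∀ v, c * (v ⬝ᵥ v) ≤ v ⬝ᵥ (L *ᵥ v) := by
  set S : Set (n → ℝ) := {v | v ⬝ᵥ v = 1} with hS
  have hcont : Continuous fun v : n → ℝ => v ⬝ᵥ (L *ᵥ v) := by fun_prop
  have hScl : IsClosed S := isClosed_eq (by fun_prop) continuous_const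
  have hSb : S ⊆ Metric.closedBall 0 1 := by
    intro v hv
    rw [mem_closedBall_zero_iff, pi_norm_le_iff_of_nonneg zero_le_one]
    intro i
    have h1 : v i * v i ≤ v ⬝ᵥ v :=
      Finset.single_le_sum (f := fun i => v i * v i) (fun i _ => mul_self_nonneg (v i)) (Finset.mem_univ i)
    rw [show v ⬝ᵥ v = 1 from hv] at h1
    rw [Real.norm_eq_abs]
    exact abs_le_one_iff_mul_self_le_one.2 h1
  have hSc : IsCompact S := (isCompact_closedBall 0 1).of_isClosed_subset hScl hSb
  have hpos : ∀ v : n → ℝ, v ≠ 0 → 0 < v ⬝ᵥ (L *ᵥ v) := fun v hv => by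
    simpa using hL.dotProduct_mulVec_pos hv
  have hscale : ∀ v : n → ℝ, v ≠ 0 → ∃ a : ℝ, a ^ 2 * (v ⬝ᵥ v) = 1 ∧ a • v ∈ S := by
    intro v hv
    have h0 : 0 < v ⬝ᵥ v := by
      have := dotProduct_star_self_pos_iff.2 hv
      simpa using this
    refine ⟨(√(v ⬝ᵥ v))⁻¹, ?_, ?_⟩
    · rw [inv_pow, Real.sq_sqrt h0.le, inv_mul_cancel₀ h0.ne']
    · change (_ • v) ⬝ᵥ (_ • v) = 1
      rw [smul_dotProduct, dotProduct_smul, smul_eq_mul, smul_eq_mul, ← mul_assoc, ← pow_two,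
        inv_pow, Real.sq_sqrt h0.le, inv_mul_cancel₀ h0.ne']
  rcases S.eq_empty_or_nonempty with hE | hE
  · refine ⟨1, one_pos, fun v => ?_⟩
    by_cases hv : v = 0
    · simp [hv]
    · obtain ⟨a, -, ha⟩ := hscale v hv
      rw [hE] at ha
      exact absurd ha (Set.notMem_empty _)
  · obtain ⟨v0, hv0, hmin⟩ := hSc.exists_isMinOn hE hcont.continuousOn
    have hv00 : v0 ≠ 0 := by
      rintro rfl
      simp [hS] at hv0
    refine ⟨_, hpos v0 hv00, fun v => ?_⟩
    by_cases hv : v = 0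
    · simp [hv]
    · obtain ⟨a, ha1, ha⟩ := hscale v hv
      have h1 : v0 ⬝ᵥ (L *ᵥ v0) ≤ (a • v) ⬝ᵥ (L *ᵥ (a • v)) := hmin ha
      rw [mulVec_smul, smul_dotProduct, dotProduct_smul, smul_eq_mul, smul_eq_mul, ← mul_assoc,
        ← pow_two] at h1
      have h2 : 0 < a ^ 2 := by
        refine lt_of_le_of_ne (sq_nonneg a) fun h => ?_
        rw [← h] at ha1
        simp at ha1
      have h3 : a ^ 2 * (v0 ⬝ᵥ (L *ᵥ v0) * (v ⬝ᵥ v)) ≤ a ^ 2 * (v ⬝ᵥ (L *ᵥ v)) := by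
        calc _ = v0 ⬝ᵥ (L *ᵥ v0) * (a ^ 2 * (v ⬝ᵥ v)) := by ring
          _ ≤ _ := by rw [ha1, mul_one]; exact h1
      exact le_of_mul_le_mul_left h3 h2

/-- Replacing L by M s changes the form by at most ∑ |M_ij - L_ij| times |v|², so eventually half of
the constant for L survives. -/
lemma TendstoPosDef.exists_le [Preorder ι] {M : ι → Matrix n n ℝ} (hM : TendstoPosDef M) :
    ∃ c : ℝ, 0 < c ∧ ∀ᶠ s in atTop, ∀ v, c * (v ⬝ᵥ v) ≤ v ⬝ᵥ (M s *ᵥ v) := by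
  obtain ⟨L, hlim, hL⟩ := hM
  obtain ⟨c, hc, hcL⟩ := exists_le_quadForm_of_posDef hL
  have hent : ∀ i j, Tendsto (fun s => M s i j) atTop (𝓝 (L i j)) := fun i j =>
    ((continuous_apply_apply i j).tendsto L).comp hlim
  have hsum : Tendsto (fun s => ∑ i, ∑ j, |M s i j - L i j|) atTop (𝓝 0) := by
    have : Tendsto (fun s => ∑ i, ∑ j, |M s i j - L i j|) atTop
        (𝓝 (∑ i : n, ∑ j : n, |L i j - L i j|)) :=
      tendsto_finsetSum _ fun i _ => tendsto_finsetSum _ fun j _ =>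
        ((hent i j).sub_const _).abs
    simpa using this
  refine ⟨c / 2, half_pos hc, ?_⟩
  filter_upwards [hsum.eventually (gt_mem_nhds (half_pos hc))] with s hs v
  have h0 : ∀ i, v i ^ 2 ≤ v ⬝ᵥ v := fun i => by
    rw [pow_two]
    exact Finset.single_le_sum (f := fun i => v i * v i) (fun i _ => mul_self_nonneg (v i))
      (Finset.mem_univ i)
  have h1 : |∑ i, v i * ∑ j, (M s i j - L i j) * v j|
      ≤ (∑ i, ∑ j, |M s i j - L i j|) * (v ⬝ᵥ v) := by
    simp only [Finset.mul_sum, Finset.sum_mul]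
    refine (Finset.abs_sum_le_sum_abs _ _).trans (Finset.sum_le_sum fun i _ => ?_)
    refine (Finset.abs_sum_le_sum_abs _ _).trans (Finset.sum_le_sum fun j _ => ?_)
    rw [abs_mul, abs_mul, mul_left_comm]
    refine mul_le_mul_of_nonneg_left ?_ (abs_nonneg _)
    have h2 := h0 i
    have h3 := h0 j
    rw [← sq_abs] at h2 h3
    nlinarith [sq_nonneg (|v i| - |v j|)]
  have h4 : v ⬝ᵥ (M s *ᵥ v) = v ⬝ᵥ (L *ᵥ v) + v ⬝ᵥ ((M s - L) *ᵥ v) := by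
    rw [sub_mulVec, dotProduct_sub]
    ring
  have h5 : 0 ≤ v ⬝ᵥ v := Finset.sum_nonneg fun i _ => mul_self_nonneg (v i)
  have h6 := hcL v
  have h7 : -_ ≤ v ⬝ᵥ ((M s - L) *ᵥ v) := (abs_le.1 h1).1
  nlinarith

/-- Keeps only that the mean square of each single covariate is bounded. The bound is written as a
square because C later bounds a seminorm. -/
lemma TendstoPosDef.exists_diag_le [Preorder ι] {M : ι → Matrix n n ℝ} (hM : TendstoPosDef M) :
    ∃ C : ℝ, 0 ≤ C ∧ ∀ᶠ s in atTop, ∀ i, M s i i ≤ C ^ 2 := by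
  obtain ⟨L, hlim, -⟩ := hM
  refine ⟨1 + ∑ i, |L i i|, by positivity, ?_⟩
  rw [eventually_all]
  intro i
  have h1 : Tendsto (fun s => M s i i) atTop (𝓝 (L i i)) :=
    ((continuous_apply_apply i i).tendsto L).comp hlim
  filter_upwards [h1.eventually (gt_mem_nhds (lt_add_one (L i i)))] with s hs
  have h2 : |L i i| ≤ ∑ i, |L i i| :=
    Finset.single_le_sum (f := fun i => |L i i|) (fun i _ => abs_nonneg _) (Finset.mem_univ i)
  have h3 := le_abs_self (L i i)
  nlinarith [abs_nonneg (L i i)]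

end PosDefLimits

/-! ### Logarithmic growth of centred sequences -/

section Growth

/-- Logarithmic growth. -/
def lg (n : ℕ) : ℝ := 1 + Nat.log 2 n

lemma one_le_lg (n : ℕ) : 1 ≤ lg n := by simp [lg]

lemma tendsto_lg_sq_div_sqrt : Tendsto (fun n : ℕ => lg n ^ 2 / √(n : ℝ)) atTop (𝓝 0) := by
  have h1 : Tendsto (fun x : ℝ => Real.log x ^ 2 / x ^ (1 / 2 : ℝ)) atTop (𝓝 0) := by
    have := (isLittleO_log_rpow_rpow_atTop 2 (show (0 : ℝ) < 1 / 2 by norm_num)).tendsto_div_nhds_zero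
    simpa using this
  -- The 25 is the square of the constant in lg n ≤ 5 log n, valid for n ≥ 3.
  have h2 : Tendsto (fun n : ℕ => 25 * (Real.log (n : ℝ) ^ 2 / (n : ℝ) ^ (1 / 2 : ℝ))) atTop (𝓝 0) := by
    simpa using (h1.comp tendsto_natCast_atTop_atTop).const_mul 25
  refine squeeze_zero' (Eventually.of_forall fun n => by positivity) ?_ h2
  filter_upwards [eventually_ge_atTop 3] with n hn
  have hn' : (3 : ℝ) ≤ n := by exact_mod_cast hn
  rw [← Real.sqrt_eq_rpow, ← mul_div_assoc]
  have hl1 : 1 ≤ Real.log n := by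
    rw [Real.le_log_iff_exp_le (by linarith)]
    linarith [Real.exp_one_lt_d9]
  have hl2 : (Nat.log 2 n : ℝ) ≤ 2 * Real.log n := by
    have h3 := Real.natLog_le_logb n 2
    have h4 : Real.logb (2 : ℕ) n ≤ 2 * Real.log n := by
      rw [Real.logb, div_le_iff₀ (by push_cast; exact Real.log_pos (by norm_num))]
      have := Real.log_two_gt_d9
      push_cast
      nlinarith
    exact h3.trans h4
  have h5 : lg n ≤ 5 * Real.log n := by unfold lg; linarith
  gcongr
  have := one_le_lg n
  nlinarith

lemma tendsto_lg_div_sqrt : Tendsto (fun n : ℕ => lg n / √(n : ℝ)) atTop (𝓝 0) :=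
  squeeze_zero (fun n => div_nonneg (by linarith [one_le_lg n]) (Real.sqrt_nonneg _))
    (fun n => by
      have := one_le_lg n
      gcongr
      nlinarith) tendsto_lg_sq_div_sqrt

/-- If the averages of `N (f i - f̄ₙ)²` are bounded, then `N (f i - f̄ₙ)` grows at most
logarithmically for fixed `i`. -/
lemma seminorm_sub_avg_le {E : Type*} [AddCommGroup E] [Module ℝ E] (N : Seminorm ℝ E) (f : ℕ → E)
    {C : ℝ} (hC : 0 ≤ C) {n0 : ℕ}
    (hf : ∀ n ≥ n0, avg n (fun i => N (f i - avg n f) ^ 2) ≤ C ^ 2) {i : ℕ} (hi : i < n0) (n : ℕ)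
    (hn : n0 ≤ n) : N (f i - avg n f) ≤ C * (2 * n0) * lg n := by
  have hn0 : (1 : ℝ) ≤ n0 := by exact_mod_cast (by omega : 1 ≤ n0)
  have hsum : ∀ n ≥ n0, ∑ i ∈ Finset.range n, N (f i - avg n f) ^ 2 ≤ n * C ^ 2 := by
    intro n hn
    rw [sum_range_eq_avg (by omega)]
    exact mul_le_mul_of_nonneg_left (hf n hn) (by positivity)
  -- Halving. The first k = n/2 terms have bounded mean square distance from the mean over n terms,
  -- so the means over k and n differ by at most 2C, and each halving lowers lg by exactly one.
  -- Rounding gives n ≤ 3k rather than 2k. Below 2 n₀ a single term is at most √n C.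
  induction n using Nat.strong_induction_on with
  | _ n ih =>
    by_cases h2 : n < 2 * n0
    · have h3 : N (f i - avg n f) ^ 2 ≤ n * C ^ 2 :=
        (Finset.single_le_sum (f := fun i => N (f i - avg n f) ^ 2) (fun i _ => sq_nonneg _)
          (Finset.mem_range.2 (by omega))).trans (hsum n hn)
      have h4 : (n : ℝ) ≤ 2 * n0 := by exact_mod_cast h2.le
      have h5 : N (f i - avg n f) ≤ C * (2 * n0) := by
        refine abs_le_of_sq_le_sq' ?_ (by positivity) |>.2
        refine h3.trans ?_
        have : (n : ℝ) ≤ (2 * n0) ^ 2 := by nlinarith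
        nlinarith [sq_nonneg C]
      refine h5.trans (le_mul_of_one_le_right (by positivity) (one_le_lg n))
    · push Not at h2
      set k := n / 2 with hk
      have hk0 : n0 ≤ k := by omega
      have hkpos : 0 < k := by omega
      have hkn : n ≤ 3 * k := by omega
      have h3 := ih k (by omega) hk0
      have hdiff : avg k f - avg n f = avg k (fun i => f i - avg n f) := by
        rw [avg_sub', avg_const hkpos]
      have h4 : N (avg k f - avg n f) ^ 2 ≤ 4 * C ^ 2 := by
        have hkR : (0 : ℝ) < k := by exact_mod_cast hkpos
        have a1 : N (avg k f - avg n f) ≤ (k : ℝ)⁻¹ * ∑ i ∈ Finset.range k, N (f i - avg n f) := by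
          rw [hdiff, avg, map_smul_eq_mul, Real.norm_of_nonneg (by positivity)]
          gcongr
          exact Finset.le_sum_of_subadditive N (map_zero N).le (map_add_le_add N) _ _
        have a2 : (∑ i ∈ Finset.range k, N (f i - avg n f)) ^ 2
            ≤ k * ∑ i ∈ Finset.range k, N (f i - avg n f) ^ 2 := by
          simpa using sq_sum_le_card_mul_sum_sq (s := Finset.range k) (f := fun i => N (f i - avg n f))
        have a3 : ∑ i ∈ Finset.range k, N (f i - avg n f) ^ 2 ≤ n * C ^ 2 :=
          (Finset.sum_le_sum_of_subset_of_nonneg (Finset.range_mono (by omega))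
            fun i _ _ => sq_nonneg _).trans (hsum n hn)
        have hkn' : (n : ℝ) ≤ 3 * k := by exact_mod_cast hkn
        calc N (avg k f - avg n f) ^ 2
            ≤ ((k : ℝ)⁻¹ * ∑ i ∈ Finset.range k, N (f i - avg n f)) ^ 2 := by
              gcongr
          _ = ((k : ℝ)⁻¹) ^ 2 * (∑ i ∈ Finset.range k, N (f i - avg n f)) ^ 2 := by ring
          _ ≤ ((k : ℝ)⁻¹) ^ 2 * (k * ((3 * k) * C ^ 2)) := by
              gcongr
              exact a2.trans (by gcongr; exact a3.trans (by gcongr))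
          _ = 3 * C ^ 2 := by field_simp
          _ ≤ 4 * C ^ 2 := by nlinarith [sq_nonneg C]
      have h5 : N (avg k f - avg n f) ≤ 2 * C :=
        abs_le_of_sq_le_sq' (by nlinarith) (by positivity) |>.2
      have hlog : lg n = lg k + 1 := by
        have : Nat.log 2 n = Nat.log 2 k + 1 := Nat.log_of_one_lt_of_le (by norm_num) (by omega)
        simp only [lg, this]
        push_cast
        ring
      calc N (f i - avg n f) ≤ N (f i - avg k f) + N (avg k f - avg n f) := by
            have := map_add_le_add N (f i - avg k f) (avg k f - avg n f)
            simpa using this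
        _ ≤ C * (2 * n0) * lg k + 2 * C := add_le_add h3 h5
        _ ≤ C * (2 * n0) * lg n := by
            rw [hlog]
            nlinarith

/-- The standard deviation of the first `n` entries, as a seminorm on sequences. -/
def sdSeminorm (n : ℕ) : Seminorm ℝ (ℕ → ℝ) :=
  (normSeminorm ℝ (EuclideanSpace ℝ (Fin n))).comp
    ((WithLp.linearEquiv 2 ℝ (Fin n → ℝ)).symm.toLinearMap ∘ₗ
      (LinearMap.pi fun j : Fin n => (√(n : ℝ))⁻¹ •
        (LinearMap.proj (j : ℕ) - (n : ℝ)⁻¹ • ∑ i ∈ Finset.range n, LinearMap.proj i)))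

lemma sdSeminorm_sq (n : ℕ) (v : ℕ → ℝ) :
    sdSeminorm n v ^ 2 = avg n fun j => (v j - avg n v) ^ 2 := by
  have h1 : ((√(n : ℝ))⁻¹) ^ 2 = (n : ℝ)⁻¹ := by
    rw [inv_pow, Real.sq_sqrt (by positivity)]
  simp only [sdSeminorm, Seminorm.comp_apply, coe_normSeminorm, EuclideanSpace.norm_sq_eq]
  change ∑ x : Fin n, ‖(√(n : ℝ))⁻¹ * (v x - (n : ℝ)⁻¹ *
    ((∑ i ∈ Finset.range n, (LinearMap.proj i : (ℕ → ℝ) →ₗ[ℝ] ℝ)) v))‖ ^ 2 = _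
  simp only [LinearMap.sum_apply, LinearMap.proj_apply, Real.norm_eq_abs, sq_abs, mul_pow, h1,
    avg, smul_eq_mul, Finset.mul_sum, Finset.sum_range]

end Growth
end CrossedModel
end

open Filter Topology MeasureTheory ProbabilityTheory
noncomputable section
namespace CrossedModel
open Matrix

/-! ### Exchange of rows and columns -/

section Swap
variable {pa pb pab pw : ℕ} (x : Covariates pa pb pab pw)

/-- Exchange of rows and columns. -/
def Covariates.swap : Covariates pb pa pab pw :=
  ⟨x.b, x.a, fun i j => x.ab j i, fun i j k => x.w j i k⟩

lemma XA_swap (g h m j : ℕ) : x.swap.XA h g m j = x.XB g h m j := by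
  have e1 : x.swap.abAll h g = x.abAll g h := avg_comm _ _ _
  have e2 : x.swap.wAll h g m = x.wAll g h m := avg_comm _ _ _
  rw [Covariates.XA, e1, e2]
  rfl

lemma XB_swap (g h m i : ℕ) : x.swap.XB h g m i = x.XA g h m i := (XA_swap x.swap h g m i).symm

lemma XAB_swap (g h m i j : ℕ) : x.swap.XAB h g m j i = x.XAB g h m i j := by
  have e1 : x.swap.abAll h g = x.abAll g h := avg_comm _ _ _
  have e2 : x.swap.wAll h g m = x.wAll g h m := avg_comm _ _ _
  rw [Covariates.XAB, Covariates.XAB, Covariates.abC, Covariates.abC, Covariates.wCellC,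
    Covariates.wCellC, e1, e2]
  congr 1
  · change x.ab i j - x.abCol g j - x.abRow h i + _ = _
    abel
  · change x.wCell m i j - x.wCol g m j - x.wRow h m i + _ = _
    abel

lemma TendstoPosDef.comp {ι κ n : Type*} [Preorder ι] [Preorder κ] [Fintype n]
    {M : ι → Matrix n n ℝ} (hM : TendstoPosDef M) {f : κ → ι} (hf : Tendsto f atTop atTop) :
    TendstoPosDef (M ∘ f) := by
  obtain ⟨L, h1, h2⟩ := hM
  exact ⟨L, h1.comp hf, h2⟩

lemma EventuallyBounded.comp {ι κ : Type*} [Preorder ι] [Preorder κ] {F : ι → ℝ}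
    (hF : EventuallyBounded F) {f : κ → ι} (hf : Tendsto f atTop atTop) :
    EventuallyBounded (F ∘ f) := by
  obtain ⟨C, h⟩ := hF
  exact ⟨C, hf.eventually h⟩

lemma tendsto_swap_atTop {α β : Type*} [Preorder α] [Preorder β] :
    Tendsto (Prod.swap : α × β → β × α) atTop atTop :=
  Monotone.tendsto_atTop_atTop (fun _ _ h => ⟨h.2, h.1⟩) fun b => ⟨b.swap, by simp⟩

lemma tendsto_swap₁₂_atTop :
    Tendsto (fun s : ℕ × ℕ × ℕ => (s.2.1, s.1, s.2.2)) atTop atTop :=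
  Monotone.tendsto_atTop_atTop (fun _ _ h => ⟨h.2.1, h.1, h.2.2⟩)
    fun b => ⟨(b.2.1, b.1, b.2.2), le_rfl⟩

variable {x}

/-- The joint limits are symmetric in the sizes, so every statement about rows transfers to columns
through this exchange. -/
lemma CovariateCondition.swap (hx : CovariateCondition x) : CovariateCondition x.swap where
  mean_a := hx.mean_b
  mean_b := hx.mean_a
  row := by
    convert hx.col.comp tendsto_swap₁₂_atTop using 1
    funext s
    simp only [Function.comp_apply, XA_swap x s.2.1 s.1 s.2.2]
  col := by
    convert hx.row.comp tendsto_swap₁₂_atTop using 1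
    funext s
    simp only [Function.comp_apply, XB_swap x s.2.1 s.1 s.2.2]
  inter := by
    convert hx.inter.comp tendsto_swap₁₂_atTop using 1
    funext s
    simp only [Function.comp_apply, XAB_swap x s.2.1 s.1 s.2.2]
    rw [avg_comm]
  within := by
    convert hx.within.comp tendsto_swap₁₂_atTop using 1
    funext s
    simp only [Function.comp_apply]
    rw [avg_comm]
    rfl
  moment := by
    obtain ⟨δ, hδ, h1, h2, h3, h4⟩ := hx.moment
    refine ⟨δ, hδ, h2, h1, ?_, ?_⟩
    · convert h3.comp tendsto_swap_atTop using 1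
      funext s
      simp only [Function.comp_apply, Prod.fst_swap, Prod.snd_swap]
      rw [avg_comm]
      have e : ∀ i j, x.swap.abC s.1 s.2 j i = x.abC s.2 s.1 i j := fun i j => by
        have e1 : x.swap.abAll s.1 s.2 = x.abAll s.2 s.1 := avg_comm _ _ _
        rw [Covariates.abC, Covariates.abC, e1]
        change x.ab i j - x.abCol s.2 j - x.abRow s.1 i + _ = _
        abel
      simp only [e]
    · convert h4.comp tendsto_swap₁₂_atTop using 1
      funext s
      simp only [Function.comp_apply]
      rw [avg_comm]
      rfl

end Swap

/-! ### Size of the covariates at a fixed position -/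

section Pointwise
variable {pa pb pab pw : ℕ} {x : Covariates pa pb pab pw}

lemma avg_vecMulVec_apply {ι : Type*} (n : ℕ) (f : ℕ → ι → ℝ) (l l' : ι) :
    avg n (fun i => vecMulVec (f i) (f i)) l l' = avg n fun i => f i l * f i l' := by
  simp [avg, Matrix.sum_apply, vecMulVec_apply]

/-- Row averages of all covariates. -/
def Covariates.rowAll (x : Covariates pa pb pab pw) (h m i : ℕ) : Fin pa ⊕ Fin pab ⊕ Fin pw → ℝ :=
  Sum.elim (x.a i) (Sum.elim (x.abRow h i) (x.wRow h m i))

lemma XA_apply (g h m i : ℕ) (l : Fin pa ⊕ Fin pab ⊕ Fin pw) :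
    x.XA g h m i l = x.rowAll h m i l - avg g fun i => x.rowAll h m i l := by
  rcases l with l | l | l
  · simp [Covariates.XA, Covariates.rowAll, Covariates.aC, avg_apply]
  · simp [Covariates.XA, Covariates.rowAll, Covariates.abAll, avg_apply, Covariates.abRow]
  · simp [Covariates.XA, Covariates.rowAll, Covariates.wAll, avg_apply, Covariates.wRow]

/-- Cell averages of the covariates. -/
def Covariates.cellAll (x : Covariates pa pb pab pw) (m i j : ℕ) : Fin pab ⊕ Fin pw → ℝ :=
  Sum.elim (x.ab i j) (x.wCell m i j)

lemma XAB_apply (g h m i j : ℕ) (l : Fin pab ⊕ Fin pw) :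
    x.XAB g h m i j l = (x.cellAll m i j l - avg g fun i => x.cellAll m i j l)
      - avg h fun j => x.cellAll m i j l - avg g fun i => x.cellAll m i j l := by
  rw [avg_sub', avg_comm]
  rcases l with l | l
  · simp only [Covariates.XAB, Covariates.cellAll, Covariates.abC, Sum.elim_inl, Pi.add_apply,
      Pi.sub_apply, Covariates.abRow, Covariates.abCol, Covariates.abAll, avg_apply]
    ring
  · simp only [Covariates.XAB, Covariates.cellAll, Covariates.wCellC, Sum.elim_inr, Pi.add_apply,
      Pi.sub_apply, Covariates.wRow, Covariates.wCol, Covariates.wAll, avg_apply]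
    ring

/-- With h and m frozen, a diagonal entry of the row matrices bounds the mean square of the centred
row averages for all large g, so the growth lemma applies with constants independent of h and m. The
threshold contains i + 1 so that row i lies in the table. -/
lemma CovariateCondition.row_bound (hx : CovariateCondition x) :
    ∃ s0 : ℕ × ℕ × ℕ, 0 < s0.1 ∧ 0 < s0.2.1 ∧ 0 < s0.2.2 ∧ ∃ C : ℝ, 0 ≤ C ∧
      ∀ i g h m l, max s0.1 (i + 1) ≤ g → s0.2.1 ≤ h → s0.2.2 ≤ m →
      |x.XA g h m i l| ≤ C * (2 * max s0.1 (i + 1) : ℕ) * lg g := by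
  obtain ⟨C, hC, hev⟩ := hx.row.exists_diag_le
  obtain ⟨s0, hs0⟩ := eventually_atTop.1 hev
  refine ⟨(max 1 s0.1, max 1 s0.2.1, max 1 s0.2.2), by simp, by simp, by simp, C, hC,
    fun i g h m l hg hh hm => ?_⟩
  simp only at hg hh hm ⊢
  rw [XA_apply]
  have := seminorm_sub_avg_le (normSeminorm ℝ ℝ) (fun i => x.rowAll h m i l) hC
    (n0 := max (max 1 s0.1) (i + 1)) (fun n hn => ?_) (i := i) (by omega) g hg
  · simpa using this
  · have h1 := hs0 (n, h, m) ⟨by omega, by change s0.2.1 ≤ h; omega, by change s0.2.2 ≤ m; omega⟩ l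
    rw [avg_vecMulVec_apply] at h1
    simpa [XA_apply, pow_two] using h1

/-- The growth lemma is used twice, each time at the cost of a logarithm: first for whole rows of
the table, measured by their standard deviation across columns, as g grows; then for the entries of
the centred row i, as h grows. -/
lemma CovariateCondition.inter_bound (hx : CovariateCondition x) (i j : ℕ) :
    ∃ K : ℝ, 0 ≤ K ∧ ∀ᶠ s : ℕ × ℕ × ℕ in atTop, ∀ l,
      |x.XAB s.1 s.2.1 s.2.2 i j l| ≤ K * (lg s.1 * lg s.2.1) := by
  obtain ⟨C, hC, hev⟩ := hx.inter.exists_diag_le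
  obtain ⟨s0, hs0⟩ := eventually_atTop.1 hev
  set n1 := max s0.1 (i + 1) with hn1
  set n2 := max s0.2.1 (j + 1) with hn2
  refine ⟨C * (2 * n1) * (2 * n2), by positivity, ?_⟩
  filter_upwards [eventually_ge_atTop ((n1, n2, s0.2.2) : ℕ × ℕ × ℕ)] with s hs l
  obtain ⟨g, h, m⟩ := s
  obtain ⟨hg, hh, hm⟩ : n1 ≤ g ∧ n2 ≤ h ∧ s0.2.2 ≤ m := ⟨hs.1, hs.2.1, hs.2.2⟩
  simp only
  set F : ℕ → ℕ → ℝ := fun i j => x.cellAll m i j l with hF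
  have h1 : ∀ h' ≥ n2, sdSeminorm h' (F i - avg g F) ≤ C * (2 * n1) * lg g := by
    intro h' hh'
    refine seminorm_sub_avg_le (sdSeminorm h') F hC (n0 := n1) (fun n hn => ?_) (by omega) g hg
    have h2 := hs0 (n, h', m) ⟨by change s0.1 ≤ n; omega, by change s0.2.1 ≤ h'; omega, hm⟩ l
    have e : ∀ i j, x.XAB n h' m i j l = (F i - avg n F) j - avg h' (F i - avg n F) := fun i j => by
      have e1 : (F i - avg n F) = fun j => F i j - avg n fun i => F i j := by
        funext j; simp [avg_apply]
      rw [XAB_apply, e1]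
    simp only [sdSeminorm_sq, ← e]
    refine le_of_eq_of_le ?_ h2
    simp only [avg, Matrix.smul_apply, Matrix.sum_apply, vecMulVec_apply, pow_two]
  set v := F i - avg g F with hv
  have h3 := seminorm_sub_avg_le (normSeminorm ℝ ℝ) v (C := C * (2 * n1) * lg g)
    (mul_nonneg (by positivity) (by linarith [one_le_lg g])) (n0 := n2) (i := j) (fun n hn => ?_)
    (by omega) h hh
  · have e : x.XAB g h m i j l = v j - avg h v := by
      have e1 : v = fun j => F i j - avg g fun i => F i j := by
        funext j; simp [avg_apply, hv]
      rw [XAB_apply, e1]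
    rw [e]
    calc |v j - avg h v| ≤ C * (2 * n1) * lg g * (2 * n2) * lg h := by simpa using h3
      _ = _ := by ring
  · have h4 := h1 n hn
    have h5 := sdSeminorm_sq n v
    simp only [coe_normSeminorm, Real.norm_eq_abs, sq_abs]
    rw [← h5]
    exact pow_le_pow_left₀ (apply_nonneg _ _) h4 2

/-- The conditions on these two covariates concern centred versions only. Their grand means are
recovered by travelling to a fixed corner of the table: the mean over g × h equals XA for g₀ minus
XA for g, minus XB for g₀, plus a column mean over g₀ rows, all in row or column 0. For the
within-cell covariate that last mean still depends on m; the within-cell variance bound leaves a √m,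
which the extra m^(-1/2) in the rate of its slope will cancel. -/
lemma CovariateCondition.grand_bound (hx : CovariateCondition x) :
    ∃ K : ℝ, 0 ≤ K ∧ ∀ᶠ s : ℕ × ℕ × ℕ in atTop,
      (∀ l, |x.abAll s.1 s.2.1 l| ≤ K * (lg s.1 + lg s.2.1 + √(s.2.2 : ℝ))) ∧
      ∀ l, |x.wAll s.1 s.2.1 s.2.2 l| ≤ K * (lg s.1 + lg s.2.1 + √(s.2.2 : ℝ)) := by
  obtain ⟨r0, r1, r2, r3, C1, hC1, hrow⟩ := hx.row_bound
  obtain ⟨c0, c1, c2, c3, C2, hC2, hcol⟩ := hx.swap.row_bound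
  obtain ⟨C3, hC3, hev⟩ := hx.within.exists_diag_le
  obtain ⟨w0, hw0⟩ := eventually_atTop.1 hev
  -- a fixed corner of the table
  set g0 := max r0.1 (max c0.2.1 w0.1) with hg0
  set h0 := max r0.2.1 (max c0.1 w0.2.1) with hh0
  set K1 := C1 * (2 * max r0.1 1 : ℕ) with hK1
  set K2 := C2 * (2 * max c0.1 1 : ℕ) with hK2
  have hg0pos : 0 < g0 := by omega
  have hh0pos : 0 < h0 := by omega
  set K3 := (∑ l, |x.abCol g0 0 l|) + ∑ l, avg g0 (fun i => |x.w i 0 0 l|) with hK3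
  have hK30 : 0 ≤ K3 := add_nonneg (Finset.sum_nonneg fun _ _ => abs_nonneg _)
    (Finset.sum_nonneg fun _ _ => avg_nonneg fun _ => abs_nonneg _)
  set K4 := √(g0 * h0 : ℝ) * C3 with hK4
  refine ⟨K1 + K1 * lg g0 + K2 + K3 + K4, by have := one_le_lg g0; positivity, ?_⟩
  filter_upwards [eventually_ge_atTop ((g0, h0, max r0.2.2 (max c0.2.2 (max w0.2.2 1))) : ℕ × ℕ × ℕ)]
    with s hs
  obtain ⟨g, h, m⟩ := s
  obtain ⟨hg, hh, hm⟩ : g0 ≤ g ∧ h0 ≤ h ∧ max r0.2.2 (max c0.2.2 (max w0.2.2 1)) ≤ m :=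
    ⟨hs.1, hs.2.1, hs.2.2⟩
  simp only
  have hm1 : (1 : ℝ) ≤ √(m : ℝ) := by
    rw [Real.one_le_sqrt]
    exact_mod_cast (by omega : 1 ≤ m)
  have l0 := one_le_lg g0
  have l1 := one_le_lg g
  have l2 := one_le_lg h
  have a1 : ∀ l, |x.XA g h m 0 l| ≤ K1 * lg g := fun l =>
    hrow 0 g h m l (by omega) (by omega) (by omega)
  have a2 : ∀ l, |x.XA g0 h m 0 l| ≤ K1 * lg g0 := fun l =>
    hrow 0 g0 h m l (by omega) (by omega) (by omega)
  have a3 : ∀ l, |x.XB g0 h m 0 l| ≤ K2 * lg h := fun l => by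
    rw [← XA_swap]
    exact hcol 0 h g0 m l (by omega) (by omega) (by omega)
  have tri : ∀ a b c d : ℝ, ∀ q : ℝ, |q| ≤ K3 + K4 * √(m : ℝ) → a = b - c + d + q →
      |b| ≤ K1 * lg g0 → |c| ≤ K1 * lg g → |d| ≤ K2 * lg h →
      |a| ≤ (K1 + K1 * lg g0 + K2 + K3 + K4) * (lg g + lg h + √(m : ℝ)) := by
    intro a b c d q hq e hb hc hd
    have : |a| ≤ |b| + |c| + |d| + |q| := by
      rw [e]
      refine (abs_add_le _ _).trans (add_le_add_left ((abs_add_le _ _).trans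
        (add_le_add_left (abs_sub _ _) _)) _)
    have p1 : 0 ≤ K1 := by positivity
    have p2 : 0 ≤ K2 := by positivity
    have p4 : 0 ≤ K4 := by positivity
    have p0 : 0 ≤ K1 * lg g0 := by positivity
    nlinarith [mul_nonneg p1 (by linarith : 0 ≤ lg h + √(m : ℝ)),
      mul_nonneg p2 (by linarith : 0 ≤ lg g + √(m : ℝ)),
      mul_nonneg p4 (by linarith : 0 ≤ lg g + lg h),
      mul_nonneg hK30 (by linarith : 0 ≤ lg g + lg h + √(m : ℝ) - 1),
      mul_nonneg p0 (by linarith : 0 ≤ lg g + lg h + √(m : ℝ) - 1)]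
  constructor
  · intro l
    refine tri _ (x.XA g0 h m 0 (.inr (.inl l))) (x.XA g h m 0 (.inr (.inl l)))
      (-x.XB g0 h m 0 (.inr (.inl l))) (x.abCol g0 0 l) ?_ ?_ (a2 _) (a1 _) (by rw [abs_neg]; exact a3 _)
    · have h1 : |x.abCol g0 0 l| ≤ ∑ l, |x.abCol g0 0 l| :=
        Finset.single_le_sum (f := fun l => |x.abCol g0 0 l|) (fun _ _ => abs_nonneg _) (Finset.mem_univ l)
      have h2 : 0 ≤ ∑ l, avg g0 (fun i => |x.w i 0 0 l|) :=
        Finset.sum_nonneg fun _ _ => avg_nonneg fun _ => abs_nonneg _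
      have h3 : 0 ≤ K4 * √(m : ℝ) := by positivity
      linarith
    · simp only [Covariates.XA, Covariates.XB, Sum.elim_inr, Sum.elim_inl, Pi.sub_apply]
      ring
  · intro l
    refine tri _ (x.XA g0 h m 0 (.inr (.inr l))) (x.XA g h m 0 (.inr (.inr l)))
      (-x.XB g0 h m 0 (.inr (.inr l))) (x.wCol g0 m 0 l) ?_ ?_ (a2 _) (a1 _) (by rw [abs_neg]; exact a3 _)
    · have h1 := hw0 (g0, h0, m) ⟨by change w0.1 ≤ g0; omega, by change w0.2.1 ≤ h0; omega,
        by change w0.2.2 ≤ m; omega⟩ l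
      have hmpos : 0 < m := by omega
      have e : (avg g0 fun i => avg h0 fun j => avg m fun k =>
          vecMulVec (x.wC m i j k) (x.wC m i j k)) l l
          = avg g0 fun i => avg h0 fun j => avg m fun k => x.wC m i j k l ^ 2 := by
        simp only [avg, Matrix.smul_apply, Matrix.sum_apply, vecMulVec_apply, pow_two]
      simp only at h1
      rw [e] at h1
      have h2 : ∀ i < g0, x.wC m i 0 0 l ^ 2 ≤ g0 * h0 * m * C3 ^ 2 := by
        intro i hi
        have s1 : x.wC m i 0 0 l ^ 2 ≤ m * avg m fun k => x.wC m i 0 k l ^ 2 := by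
          rw [← sum_range_eq_avg hmpos]
          exact Finset.single_le_sum (f := fun k => x.wC m i 0 k l ^ 2) (fun _ _ => sq_nonneg _)
            (Finset.mem_range.2 hmpos)
        have s2 : (avg m fun k => x.wC m i 0 k l ^ 2)
            ≤ h0 * avg h0 fun j => avg m fun k => x.wC m i j k l ^ 2 := by
          rw [← sum_range_eq_avg hh0pos]
          exact Finset.single_le_sum (f := fun j => avg m fun k => x.wC m i j k l ^ 2)
            (fun _ _ => avg_nonneg fun _ => sq_nonneg _) (Finset.mem_range.2 hh0pos)
        have s3 : (avg h0 fun j => avg m fun k => x.wC m i j k l ^ 2)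
            ≤ g0 * avg g0 fun i => avg h0 fun j => avg m fun k => x.wC m i j k l ^ 2 := by
          rw [← sum_range_eq_avg hg0pos]
          exact Finset.single_le_sum (f := fun i => avg h0 fun j => avg m fun k => x.wC m i j k l ^ 2)
            (fun _ _ => avg_nonneg fun _ => avg_nonneg fun _ => sq_nonneg _) (Finset.mem_range.2 hi)
        calc _ ≤ (m : ℝ) * (h0 * (g0 * C3 ^ 2)) := by
              refine s1.trans ?_
              gcongr
              refine s2.trans ?_
              gcongr
              refine s3.trans ?_
              gcongr
          _ = _ := by ring
      have h3 : ∀ i < g0, |x.wCell m i 0 l| ≤ |x.w i 0 0 l| + K4 * √(m : ℝ) := by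
        intro i hi
        have h4 : |x.wC m i 0 0 l| ≤ K4 * √(m : ℝ) := by
          apply abs_le_of_sq_le_sq
          · refine (h2 i hi).trans_eq ?_
            rw [mul_pow, mul_pow, Real.sq_sqrt (by positivity), Real.sq_sqrt (by positivity)]
            ring
          · positivity
        have e2 : x.wCell m i 0 l = x.w i 0 0 l - x.wC m i 0 0 l := by
          simp [Covariates.wC]
        rw [e2]
        exact (abs_sub _ _).trans (by linarith)
      have h5 : |x.wCol g0 m 0 l| ≤ avg g0 (fun i => |x.w i 0 0 l|) + K4 * √(m : ℝ) := by
        have e3 : avg g0 (fun i => |x.w i 0 0 l|) + K4 * √(m : ℝ)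
            = avg g0 (fun i => |x.w i 0 0 l| + K4 * √(m : ℝ)) := by
          rw [avg_add', avg_const hg0pos]
        rw [e3, Covariates.wCol, avg_apply]
        simp only [avg, smul_eq_mul, abs_mul]
        rw [abs_of_nonneg (by positivity : (0 : ℝ) ≤ (g0 : ℝ)⁻¹)]
        refine mul_le_mul_of_nonneg_left ?_ (by positivity)
        exact (Finset.abs_sum_le_sum_abs _ _).trans
          (Finset.sum_le_sum fun i hi => h3 i (Finset.mem_range.1 hi))
      have h6 : avg g0 (fun i => |x.w i 0 0 l|) ≤ ∑ l, avg g0 (fun i => |x.w i 0 0 l|) :=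
        Finset.single_le_sum (f := fun l => avg g0 (fun i => |x.w i 0 0 l|))
          (fun _ _ => avg_nonneg fun _ => abs_nonneg _) (Finset.mem_univ l)
      have h7 : 0 ≤ ∑ l, |x.abCol g0 0 l| := Finset.sum_nonneg fun _ _ => abs_nonneg _
      linarith
    · simp only [Covariates.XA, Covariates.XB, Sum.elim_inr, Pi.sub_apply]
      ring

end Pointwise
end CrossedModel
end

open Filter Topology MeasureTheory ProbabilityTheory
noncomputable section
namespace CrossedModel
open Matrix

/-! ### The energy inequality for score equations -/

section Energy
variable {N K p : Type*} [Fintype N] [DecidableEq N] [Fintype K] [Fintype p]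
  {E : K → Matrix N N ℝ} (hE : IsResolution E) (X : Matrix N p ℝ)
include hE

/-- Squared length of the fitted values in each stratum is controlled by the projections of the
noise. -/
lemma IsResolution.energy_le {l : K → ℝ} (hl : ∀ k, 0 < l k) (r : N → ℝ) (ζ : p → ℝ)
    (hs : ∀ v, (X *ᵥ v) ⬝ᵥ ((∑ k, l k • E k)⁻¹ *ᵥ (r - X *ᵥ ζ)) = 0) :
    ∑ k, (l k)⁻¹ * ((E k *ᵥ (X *ᵥ ζ)) ⬝ᵥ (E k *ᵥ (X *ᵥ ζ)))
      ≤ ∑ k, (l k)⁻¹ * projSq (E k * X) r := by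
  have h1 := hs ζ
  rw [hE.inv_sum fun k => (hl k).ne', dotProduct_sum_smul_mulVec] at h1
  have h2 : ∀ k, (X *ᵥ ζ) ⬝ᵥ (E k *ᵥ (r - X *ᵥ ζ))
      = (E k *ᵥ (X *ᵥ ζ)) ⬝ᵥ r - (E k *ᵥ (X *ᵥ ζ)) ⬝ᵥ (E k *ᵥ (X *ᵥ ζ)) := fun k => by
    rw [mulVec_sub, dotProduct_sub, ← hE.dotProduct_mulVec_eq, hE.dotProduct_mulVec_comm k _ r,
      dotProduct_comm r]
  simp only [h2, mul_sub, Finset.sum_sub_distrib] at h1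
  -- Cauchy–Schwarz followed by the arithmetic–geometric mean inequality. Half of the energy is then
  -- absorbed into the left-hand side.
  have h3 : ∀ k, (l k)⁻¹ * ((E k *ᵥ (X *ᵥ ζ)) ⬝ᵥ r) ≤
      ((l k)⁻¹ * ((E k *ᵥ (X *ᵥ ζ)) ⬝ᵥ (E k *ᵥ (X *ᵥ ζ))) + (l k)⁻¹ * projSq (E k * X) r) / 2 := by
    intro k
    have h4 := sq_dotProduct_le_projSq (E k * X) ζ r
    rw [← mulVec_mulVec] at h4
    set b := (E k *ᵥ (X *ᵥ ζ)) ⬝ᵥ (E k *ᵥ (X *ᵥ ζ)) with hb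
    have hb0 : 0 ≤ b := Finset.sum_nonneg fun i _ => mul_self_nonneg _
    have hn := projSq_nonneg (E k * X) r
    have h5 : (E k *ᵥ (X *ᵥ ζ)) ⬝ᵥ r ≤ (b + projSq (E k * X) r) / 2 := by
      refine abs_le_of_sq_le_sq' ?_ (by positivity) |>.2
      nlinarith [sq_nonneg (b - projSq (E k * X) r)]
    rw [← mul_add, mul_div_assoc]
    exact mul_le_mul_of_nonneg_left h5 (inv_pos.2 (hl k)).le
  have h6 := Finset.sum_le_sum fun k (_ : k ∈ Finset.univ) => h3 k
  rw [← Finset.sum_div, Finset.sum_add_distrib] at h6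
  linarith

/-- Lower bound for the weighted residual sum of squares in a stratum. -/
lemma IsResolution.sub_projSq_le (k : K) (r : N → ℝ) (ζ : p → ℝ) :
    r ⬝ᵥ (E k *ᵥ r) - projSq (E k * X) r ≤ (r - X *ᵥ ζ) ⬝ᵥ (E k *ᵥ (r - X *ᵥ ζ)) := by
  have h4 := sq_dotProduct_le_projSq (E k * X) ζ r
  rw [← mulVec_mulVec] at h4
  have e : (r - X *ᵥ ζ) ⬝ᵥ (E k *ᵥ (r - X *ᵥ ζ)) = r ⬝ᵥ (E k *ᵥ r)
      - 2 * ((E k *ᵥ (X *ᵥ ζ)) ⬝ᵥ r) + (E k *ᵥ (X *ᵥ ζ)) ⬝ᵥ (E k *ᵥ (X *ᵥ ζ)) := by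
    rw [mulVec_sub, dotProduct_sub, sub_dotProduct, sub_dotProduct, ← hE.dotProduct_mulVec_eq,
      hE.dotProduct_mulVec_comm k (X *ᵥ ζ) r, dotProduct_comm _ r]
    ring
  rw [e]
  set b := (E k *ᵥ (X *ᵥ ζ)) ⬝ᵥ (E k *ᵥ (X *ᵥ ζ)) with hb
  have hb0 : 0 ≤ b := Finset.sum_nonneg fun i _ => mul_self_nonneg _
  have hn := projSq_nonneg (E k * X) r
  have h5 : 2 * ((E k *ᵥ (X *ᵥ ζ)) ⬝ᵥ r) ≤ b + projSq (E k * X) r := by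
    refine abs_le_of_sq_le_sq' ?_ (by positivity) |>.2
    nlinarith [sq_nonneg (b - projSq (E k * X) r)]
  linarith

end Energy

/-! ### Rates of the fixed effects, uniformly for θ near θ₀ -/

section Rates
variable {pa pb pab pw : ℕ} (x : Covariates pa pb pab pw)

/-- Total projection of the noise onto the fixed effects, stratum by stratum. -/
def fitNoise (g h m : ℕ) (θ : Fin 4 → ℝ) (r : Cell g h m → ℝ) : ℝ :=
  ∑ k, (lam g h m θ k)⁻¹ * projSq (strat g h m k * design x g h m) r

/-- A neighbourhood of `θ₀`. -/
def nearTheta (θ₀ : Fin 4 → ℝ) : Set (Fin 4 → ℝ) := {θ | ∀ l, θ₀ l / 2 ≤ θ l ∧ θ l ≤ 2 * θ₀ l}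

/-- The eigenvalues are linear in θ with nonnegative coefficients, so the factor two carries over
whatever the sizes of the table. -/
lemma lam_near {θ₀ θ : Fin 4 → ℝ} (hθ : θ ∈ nearTheta θ₀) (g h m : ℕ) (k : Fin 5) :
    lam g h m θ₀ k / 2 ≤ lam g h m θ k ∧ lam g h m θ k ≤ 2 * lam g h m θ₀ k := by
  have mono : ∀ (c : ℝ) (l : Fin 4), 0 ≤ c → c * θ₀ l / 2 ≤ c * θ l ∧ c * θ l ≤ 2 * (c * θ₀ l) := by
    intro c l hc
    have := hθ l
    constructor <;> nlinarith
  have a0 := mono (h * m) 0 (by positivity)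
  have a1 := mono (g * m) 1 (by positivity)
  have a2 := mono m 2 (by positivity)
  have a3 := hθ 3
  fin_cases k <;> simp only [lam, Fin.zero_eta, Fin.mk_one, Fin.reduceFinMk, cons_val] <;>
    constructor <;> linarith

lemma nearTheta_pos {θ₀ θ : Fin 4 → ℝ} (hθ₀ : ∀ l, 0 < θ₀ l) (hθ : θ ∈ nearTheta θ₀) (l : Fin 4) :
    0 < θ l := by linarith [hθ₀ l, (hθ l).1]

/-- Crude upper bounds for the eigenvalues. -/
lemma lam_le_sum {θ₀ : Fin 4 → ℝ} (hθ₀ : ∀ l, 0 < θ₀ l) {g h m : ℕ} (hg : (1 : ℝ) ≤ g)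
    (hh : (1 : ℝ) ≤ h) (hm : (1 : ℝ) ≤ m) :
    lam g h m θ₀ 0 ≤ (g + h) * m * (θ₀ 0 + θ₀ 1 + θ₀ 2 + θ₀ 3) ∧
    lam g h m θ₀ 1 ≤ h * m * (θ₀ 0 + θ₀ 1 + θ₀ 2 + θ₀ 3) ∧
    lam g h m θ₀ 2 ≤ g * m * (θ₀ 0 + θ₀ 1 + θ₀ 2 + θ₀ 3) ∧
    lam g h m θ₀ 3 ≤ m * (θ₀ 0 + θ₀ 1 + θ₀ 2 + θ₀ 3) ∧
    lam g h m θ₀ 4 ≤ θ₀ 0 + θ₀ 1 + θ₀ 2 + θ₀ 3 := by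
  have t0 := (hθ₀ 0).le
  have t1 := (hθ₀ 1).le
  have t2 := (hθ₀ 2).le
  have t3 := (hθ₀ 3).le
  have a : ∀ n : ℝ, 1 ≤ n → m * θ₀ 2 ≤ n * m * θ₀ 2 ∧ θ₀ 3 ≤ n * m * θ₀ 3 := fun n hn =>
    ⟨by rw [mul_assoc]; exact le_mul_of_one_le_left (by positivity) hn,
      le_mul_of_one_le_left t3 (one_le_mul_of_one_le_of_one_le hn hm)⟩
  have hp : ∀ (n : ℕ) l, 0 ≤ (n : ℝ) * m * θ₀ l := fun n l =>
    mul_nonneg (by positivity) (hθ₀ l).le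
  have lm1 : lam g h m θ₀ 1 ≤ h * m * (θ₀ 0 + θ₀ 1 + θ₀ 2 + θ₀ 3) := by
    simp only [lam, cons_val]
    linarith [a h hh, hp h 1]
  have lm2 : lam g h m θ₀ 2 ≤ g * m * (θ₀ 0 + θ₀ 1 + θ₀ 2 + θ₀ 3) := by
    simp only [lam, cons_val]
    linarith [a g hg, hp g 0]
  refine ⟨?_, lm1, lm2, ?_, ?_⟩
  · have e0 : lam g h m θ₀ 0 ≤ lam g h m θ₀ 1 + lam g h m θ₀ 2 := by
      simp only [lam, cons_val]
      have h2 : 0 ≤ m * θ₀ 2 := by positivity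
      linarith
    linarith
  · simp only [lam, cons_val]
    have : θ₀ 3 ≤ m * θ₀ 3 := le_mul_of_one_le_left t3 hm
    have h0 : 0 ≤ m * θ₀ 0 := by positivity
    have h1 : 0 ≤ m * θ₀ 1 := by positivity
    linarith
  · simp only [lam, cons_val]
    linarith

/-- From the energy of a stratum to a slope. -/
lemma rate_of_stratum {c q L A v d ck T Θ l : ℝ} (hc : 0 < c) (hq : 0 < q) (hL : 0 < L)
    (hck : c ≤ ck) (hA : ck * d ≤ A) (hv : v ^ 2 ≤ d) (hT : 0 ≤ T)
    (hB : q * L * A ≤ 4 * T * l) (hl : l ≤ L * Θ) : q * v ^ 2 ≤ 4 * Θ / c * T := by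
  have h1 : q * A ≤ 4 * T * Θ := by
    refine le_of_mul_le_mul_left (a := L) ?_ hL
    calc L * (q * A) = q * L * A := by ring
      _ ≤ 4 * T * l := hB
      _ ≤ 4 * T * (L * Θ) := mul_le_mul_of_nonneg_left hl (by positivity)
      _ = _ := by ring
  have h2 : c * v ^ 2 ≤ A :=
    (mul_le_mul hck hv (sq_nonneg v) (hc.le.trans hck)).trans hA
  rw [div_mul_eq_mul_div, le_div_iff₀ hc]
  calc q * v ^ 2 * c = q * (c * v ^ 2) := by ring
    _ ≤ q * A := mul_le_mul_of_nonneg_left h2 hq.le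
    _ ≤ _ := h1.trans_eq (by ring)

variable {x}

/-- Rates of convergence of the fixed effects. -/
lemma CovariateCondition.exists_rates (hx : CovariateCondition x) {θ₀ : Fin 4 → ℝ}
    (hθ₀ : ∀ l, 0 < θ₀ l) : ∃ C : ℝ, 0 ≤ C ∧ ∀ᶠ s : ℕ × ℕ × ℕ in atTop,
      ∀ θ ∈ nearTheta θ₀, ∀ r ζ,
        IsScoreZero x s.1 s.2.1 s.2.2 θ (r - design x s.1 s.2.1 s.2.2 *ᵥ ζ) →
        (∀ l, s.1 * slopeA ζ l ^ 2 ≤ C * fitNoise x s.1 s.2.1 s.2.2 θ₀ r) ∧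
        (∀ l, s.2.1 * slopeB ζ l ^ 2 ≤ C * fitNoise x s.1 s.2.1 s.2.2 θ₀ r) ∧
        (∀ l, s.1 * s.2.1 * slopeAB ζ l ^ 2 ≤ C * fitNoise x s.1 s.2.1 s.2.2 θ₀ r) ∧
        (∀ l, s.1 * s.2.1 * s.2.2 * slopeW ζ l ^ 2 ≤ C * fitNoise x s.1 s.2.1 s.2.2 θ₀ r) ∧
        s.1 * s.2.1 * grandMean s.1 s.2.1 s.2.2 (fixedTable x ζ) ^ 2
          ≤ C * fitNoise x s.1 s.2.1 s.2.2 θ₀ r * (s.1 + s.2.1) := by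
  obtain ⟨c1, hc1, e1⟩ := hx.row.exists_le
  obtain ⟨c2, hc2, e2⟩ := hx.col.exists_le
  obtain ⟨c3, hc3, e3⟩ := hx.inter.exists_le
  obtain ⟨c4, hc4, e4⟩ := hx.within.exists_le
  set Θ := θ₀ 0 + θ₀ 1 + θ₀ 2 + θ₀ 3 with hΘ
  have t0 := hθ₀ 0
  have t1 := hθ₀ 1
  have t2 := hθ₀ 2
  have t3 := hθ₀ 3
  set c := min (min c1 c2) (min (min c3 c4) 1) with hc
  have hcpos : 0 < c := by simp [hc, hc1, hc2, hc3, hc4]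
  have hcc1 : c ≤ c1 := (min_le_left _ _).trans (min_le_left _ _)
  have hcc2 : c ≤ c2 := (min_le_left _ _).trans (min_le_right _ _)
  have hcc3 : c ≤ c3 := (min_le_right _ _).trans ((min_le_left _ _).trans (min_le_left _ _))
  have hcc4 : c ≤ c4 := (min_le_right _ _).trans ((min_le_left _ _).trans (min_le_right _ _))
  have hcc0 : c ≤ 1 := (min_le_right _ _).trans (min_le_right _ _)
  refine ⟨4 * Θ / c, by positivity, ?_⟩
  filter_upwards [e1, e2, e3, e4, eventually_ge_atTop ((1, 1, 1) : ℕ × ℕ × ℕ)]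
    with s q1 q2 q3 q4 hs θ hθ r ζ hsc
  obtain ⟨g, h, m⟩ := s
  obtain ⟨hg, hh, hm⟩ : 1 ≤ g ∧ 1 ≤ h ∧ 1 ≤ m := ⟨hs.1, hs.2.1, hs.2.2⟩
  simp only at q1 q2 q3 q4 hsc ⊢
  have hg' : (1 : ℝ) ≤ g := by exact_mod_cast hg
  have hh' : (1 : ℝ) ≤ h := by exact_mod_cast hh
  have hm' : (1 : ℝ) ≤ m := by exact_mod_cast hm
  set T := fitNoise x g h m θ₀ r with hT
  set b : Fin 5 → ℝ := fun k => (strat g h m k *ᵥ (design x g h m *ᵥ ζ)) ⬝ᵥ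
    (strat g h m k *ᵥ (design x g h m *ᵥ ζ)) with hb
  have hb0 : ∀ k, 0 ≤ b k := fun k => Finset.sum_nonneg fun i _ => mul_self_nonneg _
  have hpos := nearTheta_pos hθ₀ hθ
  have hE := isResolution_strat hg hh hm
  have hl := fun k => lam_pos (g := g) (h := h) (m := m) hpos k
  have hl0 := fun k => lam_pos (g := g) (h := h) (m := m) hθ₀ k
  have henergy : ∑ k, (lam g h m θ k)⁻¹ * b k
      ≤ ∑ k, (lam g h m θ k)⁻¹ * projSq (strat g h m k * design x g h m) r := by
    refine hE.energy_le _ hl r ζ fun v => ?_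
    rw [← V_eq_sum hg hh hm]
    exact hsc v
  -- Passing from θ to θ₀ costs a factor two in the noise term and another two in the eigenvalue,
  -- hence the 4.
  have hbk : ∀ k, b k ≤ 4 * T * lam g h m θ₀ k := by
    intro k
    have h1 : (lam g h m θ k)⁻¹ * b k ≤ 2 * T := by
      refine (Finset.single_le_sum (f := fun k => (lam g h m θ k)⁻¹ * b k)
        (fun k _ => mul_nonneg (inv_pos.2 (hl k)).le (hb0 k)) (Finset.mem_univ k)).trans
        (henergy.trans ?_)
      rw [hT, fitNoise, Finset.mul_sum]
      refine Finset.sum_le_sum fun k _ => ?_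
      rw [← mul_assoc]
      refine mul_le_mul_of_nonneg_right ?_ (projSq_nonneg _ _)
      rw [inv_le_iff_one_le_mul₀ (hl k), mul_assoc, mul_comm _ (lam g h m θ k), ← mul_assoc,
        ← div_eq_mul_inv, le_div_iff₀ (hl0 k)]
      linarith [(lam_near hθ g h m k).1]
    rw [inv_mul_le_iff₀ (hl k)] at h1
    have hT0 : 0 ≤ T := Finset.sum_nonneg fun k _ =>
      mul_nonneg (inv_pos.2 (hl0 k)).le (projSq_nonneg _ _)
    nlinarith [(lam_near hθ g h m k).2]
  have hbc : ∀ k, b k = g * h * m * grandMean g h m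
      (fun i j l => component g h m (fixedTable x ζ) k i j l ^ 2) := fun k => by
    simp only [hb, design_mulVec, strat_mulVec_toCell, toCell_dotProduct hg hh hm, ← pow_two]
  have hT0 : 0 ≤ T := Finset.sum_nonneg fun k _ =>
    mul_nonneg (inv_pos.2 (hl0 k)).le (projSq_nonneg _ _)
  rw [component_fixedTable x ζ hg hh hm] at hbc
  have b0 := hbc 0
  have b1 := hbc 1
  have b2 := hbc 2
  have b3 := hbc 3
  have b4 := hbc 4
  simp only [cons_val, grandMean, avg_const hm, avg_const hh, avg_const hg] at b0 b1 b2 b3 b4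
  have le_dot : ∀ {ι : Type} [Fintype ι] (v : ι → ℝ) (l : ι), v l ^ 2 ≤ v ⬝ᵥ v := fun v l => by
    rw [pow_two]
    exact Finset.single_le_sum (f := fun i => v i * v i) (fun i _ => mul_self_nonneg (v i))
      (Finset.mem_univ l)
  have f1 := q1 (slopesRow ζ)
  rw [avg_quadForm] at f1
  have f2 := q2 (slopesCol ζ)
  rw [avg_quadForm] at f2
  have f3 : c3 * (slopesInter ζ ⬝ᵥ slopesInter ζ)
      ≤ avg g fun i => avg h fun j => (x.XAB g h m i j ⬝ᵥ slopesInter ζ) ^ 2 := by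
    simp only [← avg_quadForm]
    refine (q3 (slopesInter ζ)).trans_eq ?_
    simp only [avg, smul_mulVec, sum_mulVec, dotProduct_smul, dotProduct_sum, smul_eq_mul]
  have f4 : c4 * (slopeW ζ ⬝ᵥ slopeW ζ)
      ≤ avg g fun i => avg h fun j => avg m fun k => (x.wC m i j k ⬝ᵥ slopeW ζ) ^ 2 := by
    simp only [← avg_quadForm]
    refine (q4 (slopeW ζ)).trans_eq ?_
    simp only [avg, smul_mulVec, sum_mulVec, dotProduct_smul, dotProduct_sum, smul_eq_mul]
  obtain ⟨lm0, lm1, lm2, lm3, lm4⟩ := lam_le_sum hθ₀ hg' hh' hm'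
  -- The number of observations splits as q L: L is the order of the eigenvalue of the stratum, and
  -- q is the effective sample size left for its slopes.
  have key : ∀ (k : Fin 5) (q L A v d ck : ℝ), b k = q * L * A → lam g h m θ₀ k ≤ L * Θ →
      0 < q → 0 < L → c ≤ ck → ck * d ≤ A → v ^ 2 ≤ d → q * v ^ 2 ≤ 4 * Θ / c * T :=
    fun k q L A v d ck e1 e2 hq hL hck hA hv => rate_of_stratum hcpos hq hL hck hA hv hT0
      (e1 ▸ hbk k) e2
  refine ⟨fun l => ?_, fun l => ?_, fun l => ?_, fun l => ?_, ?_⟩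
  · exact key 1 g (h * m) _ _ _ c1 (by rw [b1]; ring) lm1 (by positivity) (by positivity)
      hcc1 f1 (le_dot (slopesRow ζ) (.inl l))
  · exact key 2 h (g * m) _ _ _ c2 (by rw [b2]; ring) lm2 (by positivity) (by positivity)
      hcc2 f2 (le_dot (slopesCol ζ) (.inl l))
  · exact key 3 (g * h) m _ _ _ c3 (by rw [b3]) lm3 (by positivity) (by positivity)
      hcc3 f3 (le_dot (slopesInter ζ) (.inl l))
  · exact key 4 (g * h * m) 1 _ _ _ c4 (by rw [b4]; ring) (by rw [one_mul]; exact lm4)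
      (by positivity) one_pos hcc4 f4 (le_dot (slopeW ζ) l)
  · have h0 := hbk 0
    rw [b0] at h0
    set M := grandMean g h m (fixedTable x ζ) with hM
    have hM' : (avg g fun i => avg h fun j => avg m fun k => fixedTable x ζ i j k) = M := rfl
    rw [hM'] at h0
    have h1 := mul_le_mul_of_nonneg_left lm0 (by positivity : 0 ≤ 4 * T)
    have h2 : (m : ℝ) * (g * h * M ^ 2) ≤ m * (4 * Θ * T * (g + h)) :=
      calc (m : ℝ) * (g * h * M ^ 2) = g * h * m * M ^ 2 := by ring
        _ ≤ _ := h0.trans h1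
        _ = _ := by ring
    have h3 := le_of_mul_le_mul_left h2 (by positivity)
    rw [div_mul_eq_mul_div, div_mul_eq_mul_div, le_div_iff₀ hcpos]
    have h4 : 0 ≤ g * h * M ^ 2 := by positivity
    exact (mul_le_of_le_one_right h4 hcc0).trans h3

end Rates
end CrossedModel
end

open Filter Topology MeasureTheory ProbabilityTheory
noncomputable section
namespace CrossedModel
open Matrix Asymptotics

/-! ### Negligibility criteria for averages and slopes -/

section Orders
variable {Ω : Type*} [MeasurableSpace Ω] {P : Measure Ω} [IsProbabilityMeasure P]

lemma isLittleO_mul_of_tendsto_zero {ε f ρ : ℕ → ℝ} (hε : Tendsto ε atTop (𝓝 0))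
    (hf : f =O[atTop] ρ) : (fun t => ε t * f t) =o[atTop] ρ := by
  simpa using ((isLittleO_one_iff ℝ).2 hε).mul_isBigO hf

lemma tendsto_one_div_sqrt {n : ℕ → ℕ} (hn : Tendsto n atTop atTop) :
    Tendsto (fun t => 1 / √(n t : ℝ)) atTop (𝓝 0) :=
  tendsto_const_nhds.div_atTop
    (Real.tendsto_sqrt_atTop.comp (tendsto_natCast_atTop_atTop.comp hn))

lemma tendsto_sizes {g h m : ℕ → ℕ} (hg : Tendsto g atTop atTop) (hh : Tendsto h atTop atTop)
    (hm : Tendsto m atTop atTop) : Tendsto (fun t => (g t, h t, m t)) atTop atTop := by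
  rw [← prod_atTop_atTop_eq, ← prod_atTop_atTop_eq]
  exact hg.prodMk (hh.prodMk hm)

omit [IsProbabilityMeasure P] in
lemma tight_of_isLittleO_one {R : ℕ × Ω → ℝ}
    (h : R =o[whp P] (fun _ => (1 : ℝ))) : Tight P R := by
  refine (tight_const (P := P) 1).of_le ?_
  simpa using h.bound one_pos

lemma eventually_pos_of_tendsto {n : ℕ → ℕ} (hn : Tendsto n atTop atTop) :
    ∀ᶠ t in atTop, 0 < n t := hn.eventually_gt_atTop 0

lemma Uncorrelated.isLittleO {w : ℕ → ℕ → Ω → ℝ} {v ρ : ℕ → ℝ}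
    (hw : ∀ᶠ t in atTop, 0 < v t ∧ Uncorrelated P (w t) (v t))
    (hv : (fun t => √(v t)) =o[atTop] ρ) (i : ℕ) :
    (fun q : ℕ × Ω => w q.1 i q.2) =o[whp P] fun q => ρ q.1 := by
  refine isLittleO_of_integral_sq_le 1 hv ?_ ?_
  · filter_upwards [hw] with t ht using (Real.sqrt_pos.2 ht.1).ne'
  · filter_upwards [hw] with t ht
    refine ⟨(ht.2.memLp i).integrable_sq, ?_⟩
    rw [Real.sq_sqrt ht.1.le, one_mul]
    simpa [pow_two] using (ht.2.sq i).le

lemma Uncorrelated.isLittleO_avg {w : ℕ → ℕ → Ω → ℝ} {v ρ : ℕ → ℝ} {n : ℕ → ℕ}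
    (hn : ∀ᶠ t in atTop, 0 < n t) (hw : ∀ᶠ t in atTop, 0 < v t ∧ Uncorrelated P (w t) (v t))
    (hv : (fun t => √(v t / n t)) =o[atTop] ρ) {c : ℕ → ℕ → ℝ} {C : ℝ}
    (hc : ∀ᶠ t in atTop, CrossedModel.avg (n t) (fun i => c t i ^ 2) ≤ C) :
    (fun q : ℕ × Ω => CrossedModel.avg (n q.1) fun i => c q.1 i * w q.1 i q.2)
      =o[whp P] fun q => ρ q.1 := by
  refine isLittleO_of_integral_sq_le C hv ?_ ?_
  · filter_upwards [hw, hn] with t ht hn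
    exact (Real.sqrt_pos.2 (div_pos ht.1 (by exact_mod_cast hn))).ne'
  · filter_upwards [hw, hn, hc] with t ht hn hc
    have := ht.2.integral_avg_sq hn (c t)
    refine ⟨this.1, ?_⟩
    have hp : 0 ≤ v t / n t := div_nonneg ht.1.le (by positivity)
    rw [this.2, Real.sq_sqrt hp, mul_div_assoc]
    exact mul_le_mul_of_nonneg_right hc hp

omit [IsProbabilityMeasure P] in
-- N is the sample size behind the slope z, so z is O_p(N^(-1/2)) and a coefficient b contributes at
-- most the order b/√N.
lemma isLittleO_slope {z T : ℕ × Ω → ℝ} (hT : Tight P T) {N b ρ : ℕ → ℝ}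
    (hz : ∀ᶠ q in whp P, N q.1 * z q ^ 2 ≤ T q) (hN : ∀ᶠ t in atTop, 0 < N t)
    (hb : (fun t => b t / √(N t)) =o[atTop] ρ) :
    (fun q => b q.1 * z q) =o[whp P] fun q => ρ q.1 := by
  refine isLittleO_of_le_mul hT.sqrt hb ?_
  filter_upwards [hz, tendsto_fst_whp.eventually hN] with q hq hN
  have h1 : |z q| ≤ √(T q) / √(N q.1) := by
    rw [le_div_iff₀ (Real.sqrt_pos.2 hN)]
    refine Real.le_sqrt_of_sq_le ?_
    rw [mul_pow, sq_abs, Real.sq_sqrt hN.le]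
    linarith
  rw [abs_mul, abs_mul, abs_div, abs_of_nonneg (Real.sqrt_nonneg (T q)),
    abs_of_nonneg (Real.sqrt_nonneg (N q.1)), div_mul_eq_mul_div, mul_div_assoc]
  exact mul_le_mul_of_nonneg_left h1 (abs_nonneg _)

end Orders

/-! ### Expansion of a shrunken row mean, in a form that also serves columns -/

section RowExpansion
variable {Ω : Type*} [MeasurableSpace Ω] {P : Measure Ω} [IsProbabilityMeasure P]
variable {pa pb pab pw : ℕ} {x : Covariates pa pb pab pw}

/-- The centred weighted means of the residuals vanish. -/
lemma row_score_identity {g h m : ℕ} (hg : 0 < g) {A W R : ℕ → ℝ}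
    {z : Fin pa ⊕ Fin pab ⊕ Fin pw → ℝ}
    (hR : ∀ i, R i = A i + W i - avg g (fun i => A i + W i) - x.XA g h m i ⬝ᵥ z)
    (hs : ∀ l, avg g (fun i => x.a i l * R i) = 0) (hX : ∀ l, avg g (fun i => x.XA g h m i l) = 0)
    (l : Fin pa) :
    avg g (fun i => x.aC g i l * A i) + avg g (fun i => x.aC g i l * W i)
      = ∑ l', avg g (fun i => x.aC g i l * x.XA g h m i l') * z l' := by
  have hX0 : avg g (fun i => x.XA g h m i ⬝ᵥ z) = 0 := by
    rw [avg_dotProduct]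
    simp [dotProduct, avg_apply, hX]
  have hR0 : avg g R = 0 := by
    rw [funext hR, avg_sub', avg_sub', avg_const hg, hX0]
    simp
  have haC0 : avg g (fun i => x.aC g i l) = 0 := hX (.inl l)
  have h1 : avg g (fun i => x.aC g i l * R i) = 0 := by
    have : ∀ i, x.aC g i l * R i = x.a i l * R i - avg g x.a l * R i := fun i => by
      simp [Covariates.aC, sub_mul]
    rw [funext this, avg_sub', hs, avg_const_mul, hR0]
    simp
  have h2 : ∀ i, x.aC g i l * R i = x.aC g i l * A i + x.aC g i l * W i
      - x.aC g i l * avg g (fun i => A i + W i) - ∑ l', x.aC g i l * x.XA g h m i l' * z l' := by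
    intro i
    rw [hR, dotProduct]
    simp only [mul_assoc, ← Finset.mul_sum]
    ring
  rw [funext h2, avg_sub', avg_sub', avg_add', avg_mul_const, haC0, zero_mul, sub_zero] at h1
  have h3 : avg g (fun i => ∑ l', x.aC g i l * x.XA g h m i l' * z l')
      = ∑ l', avg g (fun i => x.aC g i l * x.XA g h m i l') * z l' := by
    simp only [← avg_mul_const]
    simp only [avg, smul_eq_mul, Finset.mul_sum]
    rw [Finset.sum_comm]
  linarith

lemma avg_XA_eq_zero {g h m : ℕ} (hg : 0 < g) (l : Fin pa ⊕ Fin pab ⊕ Fin pw) :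
    avg g (fun i => x.XA g h m i l) = 0 := by
  simp only [XA_apply]
  rw [avg_sub', avg_const hg, sub_self]

/-- The remainder of the linear approximation of a shrunken residual row mean. -/
lemma row_remainder_identity {g h m : ℕ} (D1 : Matrix (Fin pa) (Fin pa) ℝ)
    (hD : IsUnit D1.det) {A W G R : ℕ → ℝ} {z : Fin pa ⊕ Fin pab ⊕ Fin pw → ℝ} {c : ℝ}
    (hR : ∀ i, R i = A i + W i - avg g (fun i => A i + W i) - x.XA g h m i ⬝ᵥ z)
    (hs : ∀ l, avg g (fun i => x.aC g i l * A i) + avg g (fun i => x.aC g i l * W i)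
      = ∑ l', avg g (fun i => x.aC g i l * x.XA g h m i l') * z l') (i : ℕ) :
    c * R i - A i - G i + avg g (fun r => Ha x D1 g i r * A r)
      = (c - 1) * R i + (W i - G i) - avg g W
        - ∑ l, ∑ l', x.aC g i l * D1⁻¹ l l' * (avg g (fun i => x.aC g i l' * W i)
          + (∑ b, (D1 l' b - avg g (fun i => x.aC g i l' * x.XA g h m i (.inl b))) * z (.inl b)
            - ∑ b, avg g (fun i => x.aC g i l' * x.XA g h m i (.inr b)) * z (.inr b)))
        - ∑ b, x.XA g h m i (.inr b) * z (.inr b) := by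
  -- By the score identity ε = D₁ z₁ - Q, so D₁⁻¹ ε is the error of the row slopes z₁ relative to
  -- their leading term D₁⁻¹ Q.
  set ε : Fin pa → ℝ := fun l' => avg g (fun i => x.aC g i l' * W i)
          + (∑ b, (D1 l' b - avg g (fun i => x.aC g i l' * x.XA g h m i (.inl b))) * z (.inl b)
            - ∑ b, avg g (fun i => x.aC g i l' * x.XA g h m i (.inr b)) * z (.inr b)) with hε
  set Q : Fin pa → ℝ := fun l => avg g (fun i => x.aC g i l * A i) with hQ
  set z1 : Fin pa → ℝ := fun l => z (.inl l) with hz1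
  have e1 : ε = D1 *ᵥ z1 - Q := by
    funext l
    have := hs l
    rw [Fintype.sum_sum_type] at this
    simp only [hε, hQ, sub_mul, Finset.sum_sub_distrib, Pi.sub_apply, mulVec, dotProduct, hz1]
    linarith
  have e2 : ∑ l, ∑ l', x.aC g i l * D1⁻¹ l l' * ε l' = x.aC g i ⬝ᵥ (D1⁻¹ *ᵥ ε) := by
    simp only [mulVec, dotProduct, Finset.mul_sum, mul_assoc]
  have e3 : D1⁻¹ *ᵥ ε = z1 - D1⁻¹ *ᵥ Q := by
    rw [e1, mulVec_sub, mulVec_mulVec, nonsing_inv_mul _ hD, one_mulVec]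
  have e4 : avg g (fun r => Ha x D1 g i r * A r) = avg g A + x.aC g i ⬝ᵥ (D1⁻¹ *ᵥ Q) := by
    have hQ' : Q = avg g (fun r => A r • x.aC g r) := by
      funext l
      rw [avg_apply]
      simp [hQ, mul_comm]
    have h5 : avg g (fun r => (A r • x.aC g r) ⬝ᵥ ((x.aC g i) ᵥ* D1⁻¹)) = x.aC g i ⬝ᵥ (D1⁻¹ *ᵥ Q) := by
      rw [avg_dotProduct, ← hQ', dotProduct_comm, dotProduct_mulVec]
    rw [← h5, ← avg_add']
    congr 1
    funext r
    rw [Ha, smul_dotProduct, dotProduct_comm _ (x.aC g i ᵥ* D1⁻¹), dotProduct_mulVec, smul_eq_mul]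
    ring
  have e5 : x.XA g h m i ⬝ᵥ z = x.aC g i ⬝ᵥ z1 + ∑ b, x.XA g h m i (.inr b) * z (.inr b) := by
    rw [dotProduct, Fintype.sum_sum_type]
    rfl
  rw [e2, e3, e4, dotProduct_sub]
  have := hR i
  rw [e5, avg_add'] at this
  linear_combination this

/-- D₁ is a principal block of the limiting row matrix, by uniqueness of limits along g = h = m.
Hence it is positive definite and invertible. -/
lemma CovariateCondition.exists_row_limit (hx : CovariateCondition x)
    {D1 : Matrix (Fin pa) (Fin pa) ℝ} (hD1 : Tendsto x.D1hat atTop (𝓝 D1)) :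
    ∃ L : Matrix (Fin pa ⊕ Fin pab ⊕ Fin pw) (Fin pa ⊕ Fin pab ⊕ Fin pw) ℝ,
      (∀ l l', Tendsto (fun s : ℕ × ℕ × ℕ => avg s.1 fun i =>
        x.XA s.1 s.2.1 s.2.2 i l * x.XA s.1 s.2.1 s.2.2 i l') atTop (𝓝 (L l l'))) ∧
      (∀ l l', L (.inl l) (.inl l') = D1 l l') ∧ IsUnit D1.det := by
  obtain ⟨L, hL, hpd⟩ := hx.row
  have h1 : ∀ l l', Tendsto (fun s : ℕ × ℕ × ℕ => avg s.1 fun i =>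
        x.XA s.1 s.2.1 s.2.2 i l * x.XA s.1 s.2.1 s.2.2 i l') atTop (𝓝 (L l l')) := fun l l' => by
    have := tendsto_pi_nhds.1 (tendsto_pi_nhds.1 hL l) l'
    simpa only [avg_vecMulVec_apply] using this
  have h2 : ∀ l l', L (.inl l) (.inl l') = D1 l l' := fun l l' => by
    have a := (h1 (.inl l) (.inl l')).comp (tendsto_sizes (tendsto_id (α := ℕ)) tendsto_id tendsto_id)
    have b := tendsto_pi_nhds.1 (tendsto_pi_nhds.1 hD1 l) l'
    refine tendsto_nhds_unique a (b.congr fun n => ?_)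
    simp only [Covariates.D1hat, avg_vecMulVec_apply]
    rfl
  refine ⟨L, h1, h2, ?_⟩
  have h3 : D1 = L.submatrix Sum.inl Sum.inl := by
    ext l l'
    exact (h2 l l').symm
  rw [h3]
  exact (hpd.submatrix Sum.inl_injective).det_pos.ne'.isUnit

/-- Row covariates have convergent means, so no logarithm is lost. This is needed because they
multiply slope errors known only to be negligible at the target rate. -/
lemma CovariateCondition.isBigO_aC (hx : CovariateCondition x) {g : ℕ → ℕ}
    (hg : Tendsto g atTop atTop) (i : ℕ) (l : Fin pa) :
    (fun t => x.aC (g t) i l) =O[atTop] (fun _ => (1 : ℝ)) := by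
  obtain ⟨a, ha⟩ := hx.mean_a
  have h1 := (tendsto_pi_nhds.1 ha l).comp hg
  exact (tendsto_const_nhds (x := x.a i l) |>.sub h1).isBigO_one ℝ

lemma CovariateCondition.isBigO_XA (hx : CovariateCondition x) {g h m : ℕ → ℕ}
    (hg : Tendsto g atTop atTop) (hh : Tendsto h atTop atTop) (hm : Tendsto m atTop atTop) (i : ℕ)
    (l : Fin pa ⊕ Fin pab ⊕ Fin pw) :
    (fun t => x.XA (g t) (h t) (m t) i l) =O[atTop] (fun t => lg (g t)) := by
  obtain ⟨s0, -, -, -, C, -, hC⟩ := hx.row_bound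
  refine IsBigO.of_bound (C * (2 * max s0.1 (i + 1) : ℕ)) ?_
  filter_upwards [hg.eventually_ge_atTop (max s0.1 (i + 1)), hh.eventually_ge_atTop s0.2.1,
    hm.eventually_ge_atTop s0.2.2] with t h1 h2 h3
  rw [Real.norm_eq_abs, Real.norm_of_nonneg (zero_le_one.trans (one_le_lg _))]
  exact hC i _ _ _ l h1 h2 h3

/-- Row effects together with row means of the interaction effects and of the errors. -/
structure RowNoise (P : Measure Ω) (g h m : ℕ → ℕ) (α : ℕ → Ω → ℝ) (Γ E : ℕ → ℕ → Ω → ℝ) :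
    Prop where
  rows : ∃ v : ℝ, 0 < v ∧ Uncorrelated P α v
  inter : ∃ v : ℝ, 0 < v ∧ ∀ᶠ t in atTop, Uncorrelated P (Γ t) (v / h t)
  within : ∃ v : ℝ, 0 < v ∧ ∀ᶠ t in atTop, Uncorrelated P (E t) (v / m t / h t)
  tendsto_g : Tendsto g atTop atTop
  tendsto_h : Tendsto h atTop atTop
  tendsto_m : Tendsto m atTop atTop

namespace RowNoise
variable {g h m : ℕ → ℕ} {α : ℕ → Ω → ℝ} {Γ E : ℕ → ℕ → Ω → ℝ} (hN : RowNoise P g h m α Γ E)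
include hN

omit [IsProbabilityMeasure P] in
lemma within' : ∃ v : ℝ, 0 < v ∧ ∀ᶠ t in atTop, 0 < v / m t / h t ∧ Uncorrelated P (E t) (v / m t / h t) := by
  obtain ⟨v, hv, hE⟩ := hN.within
  refine ⟨v, hv, ?_⟩
  filter_upwards [hE, eventually_pos_of_tendsto hN.tendsto_h, eventually_pos_of_tendsto hN.tendsto_m]
    with t ht h1 h2 using ⟨by positivity, ht⟩

omit [IsProbabilityMeasure P] in
lemma inter' : ∃ v : ℝ, 0 < v ∧ ∀ᶠ t in atTop, 0 < v / h t ∧ Uncorrelated P (Γ t) (v / h t) := by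
  obtain ⟨v, hv, hE⟩ := hN.inter
  refine ⟨v, hv, ?_⟩
  filter_upwards [hE, eventually_pos_of_tendsto hN.tendsto_h] with t ht h1 using ⟨by positivity, ht⟩

/-- The variance v/(mh) contains an extra 1/m, which makes the row mean of the errors negligible
against h^(-1/2). -/
lemma isLittleO_within (i : ℕ) :
    (fun q : ℕ × Ω => E q.1 i q.2) =o[whp P] fun q => 1 / √(h q.1 : ℝ) := by
  obtain ⟨v, hv, hE⟩ := hN.within'
  refine Uncorrelated.isLittleO (ρ := fun t => 1 / √(h t : ℝ)) hE ?_ i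
  refine (isLittleO_mul_of_tendsto_zero (ε := fun t => √v * (1 / √(m t : ℝ)))
    (by simpa using (tendsto_one_div_sqrt hN.tendsto_m).const_mul √v)
    (isBigO_refl _ _)).congr_left fun t => ?_
  rw [Real.sqrt_div (by positivity), Real.sqrt_div hv.le]
  ring

lemma isLittleO_inter (i : ℕ) : (fun q : ℕ × Ω => Γ q.1 i q.2) =o[whp P] fun _ => (1 : ℝ) := by
  obtain ⟨v, hv, hE⟩ := hN.inter'
  refine Uncorrelated.isLittleO (ρ := fun _ => (1 : ℝ)) hE ((isLittleO_one_iff ℝ).2 ?_) i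
  have : Tendsto (fun t => √v * (1 / √(h t : ℝ))) atTop (𝓝 0) := by
    simpa using (tendsto_one_div_sqrt hN.tendsto_h).const_mul √v
  refine this.congr fun t => ?_
  rw [Real.sqrt_div hv.le]
  ring

lemma isLittleO_avg_rows :
    (fun q : ℕ × Ω => avg (g q.1) fun i => α i q.2) =o[whp P] fun _ => (1 : ℝ) := by
  obtain ⟨v, hv, hα⟩ := hN.rows
  have := Uncorrelated.isLittleO_avg (P := P) (w := fun _ => α) (v := fun _ => v) (ρ := fun _ => (1 : ℝ))
    (n := g) (c := fun _ _ => 1) (C := 1) (eventually_pos_of_tendsto hN.tendsto_g)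
    (Eventually.of_forall fun _ => ⟨hv, hα⟩) ?_ ?_
  · simpa using this
  · refine (isLittleO_one_iff ℝ).2 ?_
    have : Tendsto (fun t => √v * (1 / √(g t : ℝ))) atTop (𝓝 0) := by
      simpa using (tendsto_one_div_sqrt hN.tendsto_g).const_mul √v
    refine this.congr fun t => ?_
    rw [Real.sqrt_div hv.le]
    ring
  · filter_upwards [eventually_pos_of_tendsto hN.tendsto_g] with t ht
    simp [avg_const ht]

/-- Averaging over g rows quantities of variance v/h or v/(mh) gives a standard deviation of smaller
order than g^(-1/2). Hence only the row effects survive in the leading term of the row slopes. -/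
lemma isLittleO_weighted {c : ℕ → ℕ → ℝ} {C : ℝ}
    (hc : ∀ᶠ t in atTop, avg (g t) (fun i => c t i ^ 2) ≤ C) :
    (fun q : ℕ × Ω => avg (g q.1) fun i => c q.1 i * (Γ q.1 i q.2 + E q.1 i q.2))
      =o[whp P] fun q => 1 / √(g q.1 : ℝ) := by
  obtain ⟨v, hv, hΓ⟩ := hN.inter'
  obtain ⟨v', hv', hE⟩ := hN.within'
  have hg := eventually_pos_of_tendsto hN.tendsto_g
  have ih := tendsto_one_div_sqrt hN.tendsto_h
  have im := tendsto_one_div_sqrt hN.tendsto_m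
  have a := Uncorrelated.isLittleO_avg (ρ := fun t => 1 / √(g t : ℝ)) hg hΓ ?_ hc
  have b := Uncorrelated.isLittleO_avg (ρ := fun t => 1 / √(g t : ℝ)) hg hE ?_ hc
  · refine (a.add b).congr_left fun q => ?_
    rw [← avg_add']
    simp only [mul_add]
  · refine (isLittleO_mul_of_tendsto_zero
      (ε := fun t => √v' * (1 / √(m t : ℝ)) * (1 / √(h t : ℝ)))
      (by simpa using (im.const_mul √v').mul ih) (isBigO_refl _ _)).congr_left fun t => ?_
    rw [Real.sqrt_div (by positivity), Real.sqrt_div (by positivity), Real.sqrt_div hv'.le]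
    ring
  · refine (isLittleO_mul_of_tendsto_zero (ε := fun t => √v * (1 / √(h t : ℝ)))
      (by simpa using ih.const_mul √v) (isBigO_refl _ _)).congr_left fun t => ?_
    rw [Real.sqrt_div (by positivity), Real.sqrt_div hv.le]
    ring

lemma isLittleO_avg :
    (fun q : ℕ × Ω => CrossedModel.avg (g q.1) fun i => Γ q.1 i q.2 + E q.1 i q.2)
      =o[whp P] fun q => 1 / √(g q.1 : ℝ) := by
  have := hN.isLittleO_weighted (c := fun _ _ => 1) (C := 1) (by
    filter_upwards [eventually_pos_of_tendsto hN.tendsto_g] with t ht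
    simp [avg_const ht])
  simpa using this

lemma tight_rows (i : ℕ) : Tight P fun q => α i q.2 := by
  obtain ⟨v, hv, hα⟩ := hN.rows
  refine tight_of_integral_sq_le v (Eventually.of_forall fun t => ⟨(hα.memLp i).integrable_sq, ?_⟩)
  simpa [pow_two] using (hα.sq i).le

end RowNoise

/-- Slopes of the row-level covariates that tend to zero at the usual rates. -/
structure RowSlopes (P : Measure Ω) (g h : ℕ → ℕ)
    (z : ℕ × Ω → Fin pa ⊕ Fin pab ⊕ Fin pw → ℝ) (T : ℕ × Ω → ℝ) : Prop where
  tight : Tight P T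
  row : ∀ l, ∀ᶠ q in whp P, g q.1 * z q (.inl l) ^ 2 ≤ T q
  inter : ∀ l, ∀ᶠ q in whp P, g q.1 * h q.1 * z q (.inr l) ^ 2 ≤ T q

namespace RowSlopes
variable {g h m : ℕ → ℕ} {z : ℕ × Ω → Fin pa ⊕ Fin pab ⊕ Fin pw → ℝ} {T : ℕ × Ω → ℝ}
  (hz : RowSlopes P g h z T) (hg : Tendsto g atTop atTop) (hh : Tendsto h atTop atTop)
include hz hg

omit [IsProbabilityMeasure P] in
lemma isLittleO_row {b : ℕ → ℝ} (hb : Tendsto b atTop (𝓝 0)) (l : Fin pa) :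
    (fun q => b q.1 * z q (.inl l)) =o[whp P] fun q => 1 / √(g q.1 : ℝ) := by
  refine isLittleO_slope (z := fun q => z q (.inl l)) (T := T) (N := fun t => g t) (b := b)
    (ρ := fun t => 1 / √(g t : ℝ)) hz.tight (hz.row l) ?_ ?_
  · filter_upwards [eventually_pos_of_tendsto hg] with t ht using by exact_mod_cast ht
  · refine (isLittleO_mul_of_tendsto_zero hb (isBigO_refl _ _)).congr_left fun t => ?_
    ring

omit [IsProbabilityMeasure P] in
include hh in
-- These slopes have rate (gh)^(-1/2), so any coefficient of order o(√g) is harmless. That leaves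
-- room for logarithmic growth of the covariates.
lemma isLittleO_inter {b : ℕ → ℝ} (hb : Tendsto (fun t => b t / √(g t : ℝ)) atTop (𝓝 0))
    (l : Fin pab ⊕ Fin pw) :
    (fun q => b q.1 * z q (.inr l)) =o[whp P] fun q => 1 / √(h q.1 : ℝ) := by
  refine isLittleO_slope (z := fun q => z q (.inr l)) (T := T) (N := fun t => g t * h t) (b := b)
    (ρ := fun t => 1 / √(h t : ℝ)) hz.tight (hz.inter l) ?_ ?_
  · filter_upwards [eventually_pos_of_tendsto hg, eventually_pos_of_tendsto hh] with t h1 h2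
    positivity
  · refine (isLittleO_mul_of_tendsto_zero hb (isBigO_refl _ _)).congr_left fun t => ?_
    rw [Real.sqrt_mul (by positivity)]
    ring

include hh in
omit [IsProbabilityMeasure P] in
/-- Fitted row deviations. -/
lemma isLittleO_fitted (hx : CovariateCondition x) (hm : Tendsto m atTop atTop) (i : ℕ) :
    (∀ l, (fun q => x.XA (g q.1) (h q.1) (m q.1) i (.inr l) * z q (.inr l))
      =o[whp P] fun q => 1 / √(h q.1 : ℝ)) ∧
    (fun q => x.XA (g q.1) (h q.1) (m q.1) i ⬝ᵥ z q) =o[whp P] fun _ => (1 : ℝ) := by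
  have hlg : ∀ l, Tendsto (fun t => x.XA (g t) (h t) (m t) i l / √(g t : ℝ)) atTop (𝓝 0) := fun l => by
    refine (isLittleO_one_iff ℝ).1 (IsBigO.trans_isLittleO (g := fun t => lg (g t) / √(g t : ℝ)) ?_
      ((isLittleO_one_iff ℝ).2 (tendsto_lg_div_sqrt.comp hg)))
    simp only [div_eq_mul_inv]
    exact (hx.isBigO_XA hg hh hm i l).mul (isBigO_refl _ _)
  have h1 : ∀ l, (fun q => x.XA (g q.1) (h q.1) (m q.1) i (.inr l) * z q (.inr l))
      =o[whp P] fun q => 1 / √(h q.1 : ℝ) := fun l =>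
    hz.isLittleO_inter hg hh (b := fun t => x.XA (g t) (h t) (m t) i (.inr l)) (hlg _) l
  refine ⟨h1, ?_⟩
  have ih := ((isLittleO_one_iff ℝ).2 (tendsto_one_div_sqrt hh)).comp_tendsto
    (tendsto_fst_whp (P := P))
  simp only [dotProduct, Fintype.sum_sum_type (α₁ := Fin pa)]
  refine IsLittleO.add (IsLittleO.fun_sum fun l _ => ?_) (IsLittleO.fun_sum fun l _ => (h1 l).trans ih)
  refine isLittleO_slope (z := fun q => z q (.inl l)) (T := T) (N := fun t => g t)
    (ρ := fun _ => (1 : ℝ)) (b := fun t => x.XA (g t) (h t) (m t) i (.inl l)) hz.tight (hz.row l) ?_ ((isLittleO_one_iff ℝ).2 (hlg _))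
  filter_upwards [eventually_pos_of_tendsto hg] with t ht using by exact_mod_cast ht

end RowSlopes

section
variable {D1 : Matrix (Fin pa) (Fin pa) ℝ} {g h m : ℕ → ℕ} {α : ℕ → Ω → ℝ} {Γ E : ℕ → ℕ → Ω → ℝ}
  {z : ℕ × Ω → Fin pa ⊕ Fin pab ⊕ Fin pw → ℝ} {T : ℕ × Ω → ℝ} {R : ℕ × Ω → ℕ → ℝ}
  (hx : CovariateCondition x) (hN : RowNoise P g h m α Γ E) (hz : RowSlopes P g h z T)
include hx hN hz

lemma tight_rowMean
    (hR : ∀ᶠ q in whp P, ∀ i, R q i = α i q.2 + (Γ q.1 i q.2 + E q.1 i q.2)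
      - avg (g q.1) (fun i => α i q.2 + (Γ q.1 i q.2 + E q.1 i q.2))
      - x.XA (g q.1) (h q.1) (m q.1) i ⬝ᵥ z q) (i : ℕ) : Tight P fun q => R q i := by
  have one : ∀ {n : ℕ → ℕ}, Tendsto n atTop atTop →
      (fun q : ℕ × Ω => 1 / √(n q.1 : ℝ)) =o[whp P] fun _ => (1 : ℝ) := fun hn =>
    ((isLittleO_one_iff ℝ).2 (tendsto_one_div_sqrt hn)).comp_tendsto tendsto_fst_whp
  have h1 := (hN.isLittleO_inter i).add ((hN.isLittleO_within i).trans (one hN.tendsto_h))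
  have h2 := hN.isLittleO_avg_rows.add (hN.isLittleO_avg.trans (one hN.tendsto_g))
  have h3 := (hz.isLittleO_fitted hN.tendsto_g hN.tendsto_h hx hN.tendsto_m i).2
  refine ((hN.tight_rows i).add (tight_of_isLittleO_one ((h1.sub h2).sub h3))).of_le ?_
  filter_upwards [hR] with q hq
  rw [hq i, avg_add']
  exact le_of_eq (congrArg _ (by ring))

/-- Deviation of the row slopes from their leading terms, before inversion of the limiting
matrix. -/
def slopeError (x : Covariates pa pb pab pw) (D1 : Matrix (Fin pa) (Fin pa) ℝ) (g h m : ℕ)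
    (W : ℕ → ℝ) (z : Fin pa ⊕ Fin pab ⊕ Fin pw → ℝ) (l : Fin pa) : ℝ :=
  avg g (fun i => x.aC g i l * W i)
    + (∑ b, (D1 l b - avg g (fun i => x.aC g i l * x.XA g h m i (.inl b))) * z (.inl b)
      - ∑ b, avg g (fun i => x.aC g i l * x.XA g h m i (.inr b)) * z (.inr b))

omit [IsProbabilityMeasure P] hx hN hz in
lemma isBigO_rates (g h : ℕ → ℕ) :
    ((fun q : ℕ × Ω => 1 / √(g q.1 : ℝ)) =O[whp P] fun q => 1 / √(g q.1 : ℝ) + 1 / √(h q.1 : ℝ)) ∧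
    (fun q : ℕ × Ω => 1 / √(h q.1 : ℝ)) =O[whp P] fun q => 1 / √(g q.1 : ℝ) + 1 / √(h q.1 : ℝ) := by
  constructor <;> refine IsBigO.of_norm_le fun q => ?_ <;> rw [Real.norm_of_nonneg (by positivity)]
  · exact le_add_of_nonneg_right (by positivity)
  · exact le_add_of_nonneg_left (by positivity)

/-- Three sources of error: row-averaged noise, o_p(g^(-1/2)); replacement of the Gram matrix by its
limit, an o(1) factor against slopes of rate g^(-1/2); and correlation with the other covariates, a
bounded factor against slopes of rate (gh)^(-1/2). -/
lemma isLittleO_slopeError (hD1 : Tendsto x.D1hat atTop (𝓝 D1)) (l : Fin pa) :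
    (fun q => slopeError x D1 (g q.1) (h q.1) (m q.1) (fun i => Γ q.1 i q.2 + E q.1 i q.2) (z q) l)
      =o[whp P] fun q => 1 / √(g q.1 : ℝ) + 1 / √(h q.1 : ℝ) := by
  obtain ⟨L, hL, hLD, -⟩ := hx.exists_row_limit hD1
  have hL' : ∀ l', Tendsto (fun t => avg (g t) fun i =>
      x.aC (g t) i l * x.XA (g t) (h t) (m t) i l') atTop (𝓝 (L (.inl l) l')) :=
    fun l' => ((hL (.inl l) l').comp (tendsto_sizes hN.tendsto_g hN.tendsto_h hN.tendsto_m)).congr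
      fun t => rfl
  obtain ⟨Og, Oh⟩ := isBigO_rates (P := P) g h
  have a1 : (fun q : ℕ × Ω => avg (g q.1) (fun i => x.aC (g q.1) i l * (Γ q.1 i q.2 + E q.1 i q.2)))
      =o[whp P] fun q => 1 / √(g q.1 : ℝ) := by
    have hb : ∀ᶠ t in atTop, avg (g t) (fun i => x.aC (g t) i l ^ 2) ≤ L (.inl l) (.inl l) + 1 := by
      filter_upwards [(hL' (.inl l)).eventually_lt_const (lt_add_one _)] with t ht
      simp only [pow_two]
      exact ht.le
    exact hN.isLittleO_weighted hb
  have a2 : ∀ b, (fun q => (D1 l b - avg (g q.1) (fun i =>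
      x.aC (g q.1) i l * x.XA (g q.1) (h q.1) (m q.1) i (.inl b))) * z q (.inl b))
      =o[whp P] fun q => 1 / √(g q.1 : ℝ) := fun b => by
    have hb := (tendsto_const_nhds (x := D1 l b)).sub (hL' (.inl b))
    rw [hLD, sub_self] at hb
    exact hz.isLittleO_row hN.tendsto_g hb b
  have a3 : ∀ b, (fun q => avg (g q.1) (fun i =>
      x.aC (g q.1) i l * x.XA (g q.1) (h q.1) (m q.1) i (.inr b)) * z q (.inr b))
      =o[whp P] fun q => 1 / √(h q.1 : ℝ) := fun b => by
    have hb := (hL' (.inr b)).mul (tendsto_one_div_sqrt hN.tendsto_g)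
    simp only [mul_zero, mul_one_div] at hb
    exact hz.isLittleO_inter hN.tendsto_g hN.tendsto_h hb b
  exact (a1.trans_isBigO Og).add (((IsLittleO.fun_sum fun b _ => a2 b).trans_isBigO Og).sub
    ((IsLittleO.fun_sum fun b _ => a3 b).trans_isBigO Oh))

/-- A tight residual row mean times a factor O(1/h) is O_p(1/h). -/
lemma isLittleO_shrink
    (hR : ∀ᶠ q in whp P, ∀ i, R q i = α i q.2 + (Γ q.1 i q.2 + E q.1 i q.2)
      - avg (g q.1) (fun i => α i q.2 + (Γ q.1 i q.2 + E q.1 i q.2))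
      - x.XA (g q.1) (h q.1) (m q.1) i ⬝ᵥ z q)
    {c : ℕ × Ω → ℝ} {K : ℝ} (hc : ∀ᶠ q in whp P, |c q - 1| ≤ K / h q.1) (i : ℕ) :
    (fun q => (c q - 1) * R q i) =o[whp P] fun q => 1 / √(h q.1 : ℝ) := by
  refine isLittleO_of_le_mul (R := fun q => (c q - 1) * R q i)
    (T := fun q => R q i) (X := fun t => K / h t) (ρ := fun t => 1 / √(h t : ℝ))
    (tight_rowMean hx hN hz hR i) ?_ ?_
  · refine (isLittleO_mul_of_tendsto_zero (ε := fun t => K * (1 / √(h t : ℝ)))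
      (by simpa using (tendsto_one_div_sqrt hN.tendsto_h).const_mul K)
      (isBigO_refl _ _)).congr_left fun t => ?_
    rw [mul_assoc, div_mul_div_comm, Real.mul_self_sqrt (by positivity)]
    ring
  · filter_upwards [hc] with q hq
    rw [abs_mul, abs_mul]
    exact mul_le_mul_of_nonneg_right (hq.trans (le_abs_self _)) (abs_nonneg _)

/-- Linear approximation of a shrunken residual row mean. -/
theorem row_expansion (hD1 : Tendsto x.D1hat atTop (𝓝 D1))
    (hR : ∀ᶠ q in whp P, ∀ i, R q i = α i q.2 + (Γ q.1 i q.2 + E q.1 i q.2)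
      - avg (g q.1) (fun i => α i q.2 + (Γ q.1 i q.2 + E q.1 i q.2))
      - x.XA (g q.1) (h q.1) (m q.1) i ⬝ᵥ z q)
    (hs : ∀ᶠ q in whp P, ∀ l, avg (g q.1) (fun i => x.a i l * R q i) = 0)
    {c : ℕ × Ω → ℝ} {K : ℝ} (hc : ∀ᶠ q in whp P, |c q - 1| ≤ K / h q.1) (i : ℕ) :
    (fun q => c q * R q i - α i q.2 - Γ q.1 i q.2
        + avg (g q.1) fun r => Ha x D1 (g q.1) i r * α r q.2)
      =o[whp P] fun q => 1 / √(g q.1 : ℝ) + 1 / √(h q.1 : ℝ) := by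
  obtain ⟨-, -, -, hdet⟩ := hx.exists_row_limit hD1
  obtain ⟨Og, Oh⟩ := isBigO_rates (P := P) g h
  have s1 := (isLittleO_shrink hx hN hz hR hc i).trans_isBigO Oh
  have s2 := (hN.isLittleO_within i).trans_isBigO Oh
  have s3 := hN.isLittleO_avg.trans_isBigO Og
  have s5 : (fun q => ∑ b, x.XA (g q.1) (h q.1) (m q.1) i (.inr b) * z q (.inr b))
      =o[whp P] fun q => 1 / √(g q.1 : ℝ) + 1 / √(h q.1 : ℝ) := IsLittleO.fun_sum fun b _ =>
    ((hz.isLittleO_fitted hN.tendsto_g hN.tendsto_h hx hN.tendsto_m i).1 b).trans_isBigO Oh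
  have s4 : (fun q => ∑ l, ∑ l', x.aC (g q.1) i l * D1⁻¹ l l' *
        slopeError x D1 (g q.1) (h q.1) (m q.1) (fun i => Γ q.1 i q.2 + E q.1 i q.2) (z q) l')
      =o[whp P] fun q => 1 / √(g q.1 : ℝ) + 1 / √(h q.1 : ℝ) := by
    refine IsLittleO.fun_sum fun l _ => IsLittleO.fun_sum fun l' _ => ?_
    have hO : (fun q : ℕ × Ω => x.aC (g q.1) i l * D1⁻¹ l l') =O[whp P] fun _ => (1 : ℝ) := by
      have h1 : (fun q : ℕ × Ω => x.aC (g q.1) i l) =O[whp P] fun _ => (1 : ℝ) :=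
        (hx.isBigO_aC hN.tendsto_g i l).comp_tendsto (tendsto_fst_whp (P := P))
      simpa [mul_comm] using h1.const_mul_left (D1⁻¹ l l')
    simpa using hO.mul_isLittleO (isLittleO_slopeError hx hN hz hD1 l')
  refine ((((s1.add s2).sub s3).sub s4).sub s5).congr' ?_ EventuallyEq.rfl
  filter_upwards [hR, hs, tendsto_fst_whp.eventually (eventually_pos_of_tendsto hN.tendsto_g)]
    with q hq hq' hg
  have := row_remainder_identity (x := x) (g := g q.1) (h := h q.1) (m := m q.1) D1 hdet
    (A := fun i => α i q.2) (W := fun i => Γ q.1 i q.2 + E q.1 i q.2) (G := fun i => Γ q.1 i q.2)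
    (R := R q) (z := z q) (c := c q) hq
    (row_score_identity hg hq hq' fun l => avg_XA_eq_zero hg l) i
  rw [this, add_sub_cancel_left]
  rfl
end

end RowExpansion
end CrossedModel
end

open Filter Topology MeasureTheory ProbabilityTheory
noncomputable section
namespace CrossedModel
open Matrix Asymptotics

/-! ### Noise of the crossed model -/

section ModelNoise
variable {Ω : Type*} [MeasurableSpace Ω] {P : Measure Ω} [IsProbabilityMeasure P]
  {u : RandomTerms Ω} {θ : Fin 4 → ℝ} (hu : RandomTermsCondition P u θ) (hθ : ∀ l, 0 < θ l)
include hu hθ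

lemma RandomTermsCondition.uncorrelated :
    Uncorrelated P u.α (θ 0) ∧ Uncorrelated P u.β (θ 1) ∧ Uncorrelated P u.γ (θ 2) ∧
      Uncorrelated P u.e (θ 3) := by
  obtain ⟨κ, -, hw⟩ := hu.exists_indepTerms hθ
  exact ⟨(hw.precomp Sum.inl_injective).uncorrelated fun _ => rfl,
    (hw.precomp (Sum.inr_injective.comp Sum.inl_injective)).uncorrelated fun _ => rfl,
    (hw.precomp (Sum.inr_injective.comp (Sum.inr_injective.comp Sum.inl_injective))).uncorrelated
      fun _ => rfl,
    (hw.precomp (Sum.inr_injective.comp (Sum.inr_injective.comp Sum.inr_injective))).uncorrelated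
      fun _ => rfl⟩

variable {g h m : ℕ → ℕ} (hg : Tendsto g atTop atTop) (hh : Tendsto h atTop atTop)
  (hm : Tendsto m atTop atTop)
include hm

lemma RandomTermsCondition.uncorrelated_cell :
    ∀ᶠ t in atTop, Uncorrelated P (fun (c : ℕ × ℕ) s => avg (m t) fun k => u.e (c.1, c.2, k) s)
      (θ 3 / m t) := by
  filter_upwards [eventually_pos_of_tendsto hm] with t ht
  exact ((hu.uncorrelated hθ).2.2.2.precomp (f := fun c : (ℕ × ℕ) × ℕ => (c.1.1, c.1.2, c.2))
    (fun a b h => by simp_all [Prod.ext_iff])).avg ht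

include hg hh

lemma RandomTermsCondition.rowNoise :
    RowNoise P g h m u.α (fun t i s => avg (h t) fun l => u.γ (i, l) s)
      (fun t i s => avg (h t) fun j => avg (m t) fun k => u.e (i, j, k) s) where
  rows := ⟨θ 0, hθ 0, (hu.uncorrelated hθ).1⟩
  inter := ⟨θ 2, hθ 2, by
    filter_upwards [eventually_pos_of_tendsto hh] with t ht
    exact (hu.uncorrelated hθ).2.2.1.avg ht⟩
  within := ⟨θ 3, hθ 3, by
    filter_upwards [eventually_pos_of_tendsto hh, hu.uncorrelated_cell hθ hm] with t ht hc
    exact hc.avg ht⟩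
  tendsto_g := hg
  tendsto_h := hh
  tendsto_m := hm

lemma RandomTermsCondition.colNoise :
    RowNoise P h g m u.β (fun t j s => avg (g t) fun r => u.γ (r, j) s)
      (fun t j s => avg (g t) fun i => avg (m t) fun k => u.e (i, j, k) s) where
  rows := ⟨θ 1, hθ 1, (hu.uncorrelated hθ).2.1⟩
  inter := ⟨θ 2, hθ 2, by
    filter_upwards [eventually_pos_of_tendsto hg] with t ht
    exact ((hu.uncorrelated hθ).2.2.1.precomp (f := Prod.swap) Prod.swap_injective).avg ht⟩
  within := ⟨θ 3, hθ 3, by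
    filter_upwards [eventually_pos_of_tendsto hg, hu.uncorrelated_cell hθ hm] with t ht hc
    exact (hc.precomp (f := Prod.swap) Prod.swap_injective).avg ht⟩
  tendsto_g := hh
  tendsto_h := hg
  tendsto_m := hm

variable {pa pb pab pw : ℕ} (x : Covariates pa pb pab pw)

/-- After division by its eigenvalue each stratum contributes an expectation of at most the number
of fixed effects, whatever the sizes. Markov's inequality then gives tightness. -/
lemma RandomTermsCondition.tight_fitNoise :
    Tight P fun q => fitNoise x (g q.1) (h q.1) (m q.1) θ (toCell (g q.1) (h q.1) (m q.1) (noise u q.2)) := by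
  obtain ⟨κ, -, hw⟩ := hu.exists_indepTerms hθ
  refine tight_of_integral_le (∑ k : Fin 5, (Fintype.card (FixedIdx pa pb pab pw) : ℝ)) ?_
  filter_upwards [eventually_pos_of_tendsto hg, eventually_pos_of_tendsto hh,
    eventually_pos_of_tendsto hm] with t hg hh hm
  have hl := fun k => lam_pos (g := g t) (h := h t) (m := m t) hθ k
  have hk := fun k => (hw.precomp (termIndex_injective (g t) (h t) (m t))).integral_projSq_le
    (isResolution_strat hg hh hm)
    ((randomDesign_covariance (g t) (h t) (m t) θ).trans (V_eq_sum hg hh hm θ)) k (hl k).le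
    (design x (g t) (h t) (m t))
  simp only [randomDesign_mulVec] at hk
  refine ⟨Eventually.of_forall fun s => Finset.sum_nonneg fun k _ =>
    mul_nonneg (inv_pos.2 (hl k)).le (projSq_nonneg _ _),
    integrable_finsetSum _ fun k _ => (hk k).1.const_mul _, ?_⟩
  simp only [fitNoise]
  rw [integral_finsetSum _ fun k _ => (hk k).1.const_mul _]
  refine Finset.sum_le_sum fun k _ => ?_
  rw [integral_const_mul, inv_mul_le_iff₀ (hl k), mul_comm (lam _ _ _ _ _)]
  exact (hk k).2

end ModelNoise

/-! ### Means of the residual table -/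

section ResidualTable
variable {Ω : Type*} {pa pb pab pw : ℕ} (x : Covariates pa pb pab pw) (u : RandomTerms Ω)

/-- Residuals at fixed effects that are off by `ζ`. -/
def residTable (ζ : FixedIdx pa pb pab pw → ℝ) (s : Ω) (i j k : ℕ) : ℝ :=
  noise u s i j k - fixedTable x ζ i j k

lemma resid_response (g h m : ℕ) (ξ₀ ξ : FixedIdx pa pb pab pw → ℝ) (s : Ω) :
    resid x g h m (response x g h m ξ₀ u s) ξ = toCell g h m (residTable x u (ξ - ξ₀) s) := by
  have h1 : resid x g h m (response x g h m ξ₀ u s) ξ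
      = toCell g h m (noise u s) - design x g h m *ᵥ (ξ - ξ₀) := by
    funext c
    simp only [resid, response, mulVec_sub, Pi.sub_apply, toCell, noise]
    ring
  rw [h1, design_mulVec]
  rfl

lemma response_sub (g h m : ℕ) (ξ₀ ξ : FixedIdx pa pb pab pw → ℝ) (s : Ω) :
    resid x g h m (response x g h m ξ₀ u s) ξ
      = toCell g h m (noise u s) - design x g h m *ᵥ (ξ - ξ₀) := by
  rw [resid_response, design_mulVec]
  rfl

variable {g h m : ℕ} (hg : 0 < g) (hh : 0 < h) (hm : 0 < m) {ζ : FixedIdx pa pb pab pw → ℝ} {s : Ω}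
  (h0 : grandMean g h m (residTable x u ζ s) = 0)
include hg hh hm h0

/-- Every row mean contains the same average of the column effects. Subtracting the grand mean,
which is zero, removes it and turns the fixed part into its row component. -/
lemma rowMean_residTable (i : ℕ) : rowMean h m (residTable x u ζ s) i =
    u.α i s + ((avg h fun l => u.γ (i, l) s) + avg h fun j => avg m fun k => u.e (i, j, k) s)
      - avg g (fun i => u.α i s + ((avg h fun l => u.γ (i, l) s)
        + avg h fun j => avg m fun k => u.e (i, j, k) s)) - x.XA g h m i ⬝ᵥ slopesRow ζ := by
  have hr : ∀ i, rowMean h m (noise u s) i = avg h (fun j => u.β j s) + (u.α i s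
      + ((avg h fun l => u.γ (i, l) s) + avg h fun j => avg m fun k => u.e (i, j, k) s)) := by
    intro i
    simp only [rowMean, noise, avg_add', avg_const hm, avg_const hh]
    ring
  have hr' : ∀ i, rowMean h m (residTable x u ζ s) i
      = rowMean h m (noise u s) i - rowMean h m (fixedTable x ζ) i := fun i => by
    simp only [rowMean, residTable, avg_sub']
  have hG : grandMean g h m (noise u s) = avg g (rowMean h m (noise u s)) := rfl
  have hG' : grandMean g h m (residTable x u ζ s)
      = grandMean g h m (noise u s) - grandMean g h m (fixedTable x ζ) := by
    simp only [grandMean, residTable, avg_sub']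
  have hf : rowMean h m (fixedTable x ζ) i - grandMean g h m (fixedTable x ζ)
      = x.XA g h m i ⬝ᵥ slopesRow ζ :=
    congrFun (congrFun (congrFun (congrFun (component_fixedTable x ζ hg hh hm) 1) i) 0) 0
  rw [funext hr, avg_add', avg_const hg] at hG
  rw [hr', hr]
  linarith

lemma colMean_residTable (j : ℕ) : colMean g m (residTable x u ζ s) j =
    u.β j s + ((avg g fun r => u.γ (r, j) s) + avg g fun i => avg m fun k => u.e (i, j, k) s)
      - avg h (fun j => u.β j s + ((avg g fun r => u.γ (r, j) s)
        + avg g fun i => avg m fun k => u.e (i, j, k) s)) - x.XB g h m j ⬝ᵥ slopesCol ζ := by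
  have hr : ∀ j, colMean g m (noise u s) j = avg g (fun i => u.α i s) + (u.β j s
      + ((avg g fun r => u.γ (r, j) s) + avg g fun i => avg m fun k => u.e (i, j, k) s)) := by
    intro j
    simp only [colMean, noise, avg_add', avg_const hm, avg_const hg]
    ring
  have hr' : ∀ j, colMean g m (residTable x u ζ s) j
      = colMean g m (noise u s) j - colMean g m (fixedTable x ζ) j := fun j => by
    simp only [colMean, residTable, avg_sub']
  have hG : grandMean g h m (noise u s) = avg h (colMean g m (noise u s)) := avg_comm _ _ _
  have hG' : grandMean g h m (residTable x u ζ s)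
      = grandMean g h m (noise u s) - grandMean g h m (fixedTable x ζ) := by
    simp only [grandMean, residTable, avg_sub']
  have hf : colMean g m (fixedTable x ζ) j - grandMean g h m (fixedTable x ζ)
      = x.XB g h m j ⬝ᵥ slopesCol ζ :=
    congrFun (congrFun (congrFun (congrFun (component_fixedTable x ζ hg hh hm) 2) 0) j) 0
  rw [funext hr, avg_add', avg_const hh] at hG
  rw [hr', hr]
  linarith

/-- Row and column effects cancel under double centring, and the vanishing grand mean supplies the
missing term of that centring. -/
lemma interaction_residTable (i j : ℕ) : cellMean m (residTable x u ζ s) i j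
      - rowMean h m (residTable x u ζ s) i - colMean g m (residTable x u ζ s) j =
    u.γ (i, j) s + avg m (fun k => u.e (i, j, k) s)
      - ((avg h fun l => u.γ (i, l) s) + avg h fun j => avg m fun k => u.e (i, j, k) s)
      - ((avg g fun r => u.γ (r, j) s) + avg g fun i => avg m fun k => u.e (i, j, k) s)
      + avg g (fun i => (avg h fun l => u.γ (i, l) s)
        + avg h fun j => avg m fun k => u.e (i, j, k) s)
      - x.XAB g h m i j ⬝ᵥ slopesInter ζ := by
  have hf : cellMean m (fixedTable x ζ) i j - rowMean h m (fixedTable x ζ) i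
      - colMean g m (fixedTable x ζ) j + grandMean g h m (fixedTable x ζ)
      = x.XAB g h m i j ⬝ᵥ slopesInter ζ :=
    congrFun (congrFun (congrFun (congrFun (component_fixedTable x ζ hg hh hm) 3) i) j) 0
  simp only [cellMean, rowMean, colMean, grandMean, residTable, avg_sub'] at h0 hf ⊢
  have hn : noise u s = fun i j k => u.α i s + u.β j s + u.γ (i, j) s + u.e (i, j, k) s := rfl
  simp only [hn, avg_add', avg_const hm, avg_const hg, avg_const hh] at h0 ⊢
  linarith

end ResidualTable

/-! ### Shrinkage factors -/

section Shrinkage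
variable {g h m : ℕ} (hg : (1 : ℝ) ≤ g) (hh : (1 : ℝ) ≤ h) (hm : (1 : ℝ) ≤ m) {θ₀ θ : Fin 4 → ℝ}
  (hθ₀ : ∀ l, 0 < θ₀ l) (hθ : θ ∈ nearTheta θ₀)
include hm hθ₀ hθ

include hh in
-- The deficit is (m θ₂ + θ₃)/λ₁, with numerator of order m and denominator of order hm.
lemma abs_shrink_row_sub_one_le :
    |θ 0 * (h * m) / lam g h m θ 1 - 1| ≤ 4 * (θ₀ 2 + θ₀ 3) / θ₀ 0 / h := by
  have hp := nearTheta_pos hθ₀ hθ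
  have hl := lam_pos (g := g) (h := h) (m := m) hp 1
  have e : θ 0 * (h * m) / lam g h m θ 1 - 1 = -((m * θ 2 + θ 3) / lam g h m θ 1) := by
    rw [div_sub_one hl.ne', ← neg_div]
    congr 1
    simp only [lam, cons_val]
    ring
  have h1 : h * m * θ₀ 0 / 2 ≤ lam g h m θ 1 := by
    have a := hp 2
    have b := hp 3
    have c := (hθ 0).1
    have : h * m * (θ₀ 0 / 2) ≤ h * m * θ 0 := mul_le_mul_of_nonneg_left c (by positivity)
    simp only [lam, cons_val]
    have : 0 ≤ m * θ 2 := by positivity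
    linarith
  have h2 : m * θ 2 + θ 3 ≤ 2 * m * (θ₀ 2 + θ₀ 3) := by
    have a := (hθ 2).2
    have b := (hθ 3).2
    have : m * θ 2 ≤ m * (2 * θ₀ 2) := mul_le_mul_of_nonneg_left a (by positivity)
    have : θ₀ 3 ≤ m * θ₀ 3 := le_mul_of_one_le_left (hθ₀ 3).le hm
    linarith
  have p2 := hp 2
  have p3 := hp 3
  have q0 := hθ₀ 0
  have q2 := hθ₀ 2
  have q3 := hθ₀ 3
  rw [e, abs_neg, abs_of_nonneg (div_nonneg (by positivity) hl.le)]
  calc (m * θ 2 + θ 3) / lam g h m θ 1 ≤ 2 * m * (θ₀ 2 + θ₀ 3) / (h * m * θ₀ 0 / 2) :=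
        div_le_div₀ (by positivity) h2 (by positivity) h1
    _ = _ := by field_simp; norm_num

include hh in
lemma abs_inter_row_le : |θ 2 * m / lam g h m θ 1| ≤ 4 * θ₀ 2 / θ₀ 0 / h := by
  have hp := nearTheta_pos hθ₀ hθ
  have hl := lam_pos (g := g) (h := h) (m := m) hp 1
  have h1 : h * m * θ₀ 0 / 2 ≤ lam g h m θ 1 := by
    have a := hp 2
    have b := hp 3
    have c := (hθ 0).1
    have : h * m * (θ₀ 0 / 2) ≤ h * m * θ 0 := mul_le_mul_of_nonneg_left c (by positivity)
    simp only [lam, cons_val]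
    have : 0 ≤ m * θ 2 := by positivity
    linarith
  have p2 := hp 2
  have q0 := hθ₀ 0
  have q2 := hθ₀ 2
  rw [abs_of_nonneg (div_nonneg (by positivity) hl.le)]
  calc θ 2 * m / lam g h m θ 1 ≤ 2 * θ₀ 2 * m / (h * m * θ₀ 0 / 2) :=
        div_le_div₀ (by positivity) (mul_le_mul_of_nonneg_right (hθ 2).2 (by positivity))
          (by positivity) h1
    _ = _ := by field_simp; norm_num

/-- The deficit is θ₃/λ₃, and λ₃ is of order m. This is the source of the O_p(1/m) term. -/
lemma abs_shrink_inter_sub_one_le : |θ 2 * m / lam g h m θ 3 - 1| ≤ 4 * θ₀ 3 / θ₀ 2 / m := by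
  have hp := nearTheta_pos hθ₀ hθ
  have hl := lam_pos (g := g) (h := h) (m := m) hp 3
  have e : θ 2 * m / lam g h m θ 3 - 1 = -(θ 3 / lam g h m θ 3) := by
    rw [div_sub_one hl.ne', ← neg_div]
    congr 1
    simp only [lam, cons_val]
    ring
  have h1 : m * θ₀ 2 / 2 ≤ lam g h m θ 3 := by
    have b := hp 3
    have : m * (θ₀ 2 / 2) ≤ m * θ 2 := mul_le_mul_of_nonneg_left (hθ 2).1 (by positivity)
    simp only [lam, cons_val]
    linarith
  have p3 := hp 3
  have q2 := hθ₀ 2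
  have q3 := hθ₀ 3
  rw [e, abs_neg, abs_of_nonneg (div_nonneg p3.le hl.le)]
  calc θ 3 / lam g h m θ 3 ≤ 2 * θ₀ 3 / (m * θ₀ 2 / 2) :=
        div_le_div₀ (by positivity) (hθ 3).2 (by positivity) h1
    _ = _ := by field_simp; norm_num

omit hm hθ₀ hθ in
/-- Interchanging the roles of rows and columns. -/
lemma lam_swap (g h m : ℕ) (θ : Fin 4 → ℝ) :
    lam g h m θ 2 = lam h g m ![θ 1, θ 0, θ 2, θ 3] 1 := by
  simp [lam]

end Shrinkage
end CrossedModel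
end

open Filter Topology MeasureTheory ProbabilityTheory
noncomputable section
namespace CrossedModel
open Matrix Asymptotics

/-! ### Expansions of the predictors -/

section Predictors
variable {Ω : Type*} [MeasurableSpace Ω] {P : Measure Ω} [IsProbabilityMeasure P]
  {pa pb pab pw : ℕ} {x : Covariates pa pb pab pw} {u : RandomTerms Ω} {ω₀ : Param pa pb pab pw}
  {g h m : ℕ → ℕ} {ω : ℕ × Ω → Param pa pb pab pw}

/-- The estimates that are eventually close to the true parameter and solve the estimating
equations for the fixed effects. -/
def IsAdmissible (P : Measure Ω) (x : Covariates pa pb pab pw) (u : RandomTerms Ω)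
    (ω₀ : Param pa pb pab pw) (g h m : ℕ → ℕ) (ω : ℕ × Ω → Param pa pb pab pw) : Prop :=
  ∀ᶠ q in whp P, IsScoreZero x (g q.1) (h q.1) (m q.1) (ω q).2
    (resid x (g q.1) (h q.1) (m q.1) (response x (g q.1) (h q.1) (m q.1) ω₀.1 u q.2) (ω q).1) ∧
    (ω q).2 ∈ nearTheta ω₀.2

/-- The table of residuals at the estimates. -/
def residAt (x : Covariates pa pb pab pw) (u : RandomTerms Ω) (ω₀ : Param pa pb pab pw)
    (ω : ℕ × Ω → Param pa pb pab pw) (q : ℕ × Ω) : ℕ → ℕ → ℕ → ℝ :=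
  residTable x u ((ω q).1 - ω₀.1) q.2

variable (hx : CovariateCondition x) (hu : RandomTermsCondition P u ω₀.2) (hθ₀ : ∀ l, 0 < ω₀.2 l)
  (hg : Tendsto g atTop atTop) (hh : Tendsto h atTop atTop) (hm : Tendsto m atTop atTop)
  (hω : IsAdmissible P x u ω₀ g h m ω)

include hθ₀ hg hh hm hω

omit [IsProbabilityMeasure P] in
lemma IsAdmissible.means : ∀ᶠ q in whp P, (0 < g q.1 ∧ 0 < h q.1 ∧ 0 < m q.1) ∧
    grandMean (g q.1) (h q.1) (m q.1) (residAt x u ω₀ ω q) = 0 ∧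
    (∀ l, avg (g q.1) (fun i => x.a i l * rowMean (h q.1) (m q.1) (residAt x u ω₀ ω q) i) = 0) ∧
    ∀ l, avg (h q.1) (fun j => x.b j l * colMean (g q.1) (m q.1) (residAt x u ω₀ ω q) j) = 0 := by
  filter_upwards [hω, tendsto_fst_whp.eventually (eventually_pos_of_tendsto hg),
    tendsto_fst_whp.eventually (eventually_pos_of_tendsto hh),
    tendsto_fst_whp.eventually (eventually_pos_of_tendsto hm)] with q hq h1 h2 h3
  refine ⟨⟨h1, h2, h3⟩, ?_⟩
  rw [resid_response] at hq
  exact hq.1.means h1 h2 h3 (nearTheta_pos hθ₀ hq.2)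

include hx hu

/-- One tight variable bounds all slopes. For the within-cell slopes the factor m of their rate is
given up, so that they can be handled together with the interaction slopes. -/
lemma IsAdmissible.exists_slopes : ∃ T : ℕ × Ω → ℝ,
    RowSlopes (pa := pa) (pab := pab) (pw := pw) P g h
      (fun q => slopesRow ((ω q).1 - ω₀.1)) T ∧
    RowSlopes (pa := pb) (pab := pab) (pw := pw) P h g
      (fun q => slopesCol ((ω q).1 - ω₀.1)) T ∧
    ∀ l, ∀ᶠ q in whp P, g q.1 * h q.1 * slopesInter ((ω q).1 - ω₀.1) l ^ 2 ≤ T q := by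
  obtain ⟨C, hC, hr⟩ := hx.exists_rates hθ₀
  have hT := (hu.tight_fitNoise hθ₀ hg hh hm x).const_mul C
  have hr' := ((tendsto_sizes hg hh hm).comp (tendsto_fst_whp (P := P))).eventually hr
  have key : ∀ᶠ q in whp P, ∀ T, T = C * fitNoise x (g q.1) (h q.1) (m q.1) ω₀.2
        (toCell (g q.1) (h q.1) (m q.1) (noise u q.2)) →
      (∀ l, g q.1 * slopeA ((ω q).1 - ω₀.1) l ^ 2 ≤ T) ∧
      (∀ l, h q.1 * slopeB ((ω q).1 - ω₀.1) l ^ 2 ≤ T) ∧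
      (∀ l, g q.1 * h q.1 * slopeAB ((ω q).1 - ω₀.1) l ^ 2 ≤ T) ∧
      ∀ l, g q.1 * h q.1 * slopeW ((ω q).1 - ω₀.1) l ^ 2 ≤ T := by
    filter_upwards [hr', hω, tendsto_fst_whp.eventually (eventually_pos_of_tendsto hm)]
      with q hq hq' hm
    rw [response_sub] at hq'
    rintro T rfl
    obtain ⟨r1, r2, r3, r4, -⟩ := hq _ hq'.2 _ _ hq'.1
    refine ⟨r1, r2, r3, fun l => le_trans ?_ (r4 l)⟩
    refine mul_le_mul_of_nonneg_right ?_ (sq_nonneg _)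
    exact le_mul_of_one_le_right (by positivity) (by exact_mod_cast hm)
  refine ⟨_, ⟨hT, fun l => ?_, fun l => ?_⟩, ⟨hT, fun l => ?_, fun l => ?_⟩, fun l => ?_⟩
  · filter_upwards [key] with q hq using (hq _ rfl).1 l
  · filter_upwards [key] with q hq
    rcases l with l | l
    · exact (hq _ rfl).2.2.1 l
    · exact (hq _ rfl).2.2.2 l
  · filter_upwards [key] with q hq using (hq _ rfl).2.1 l
  · filter_upwards [key] with q hq
    rw [mul_comm (h q.1 : ℝ)]
    rcases l with l | l
    · exact (hq _ rfl).2.2.1 l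
    · exact (hq _ rfl).2.2.2 l
  · filter_upwards [key] with q hq
    rcases l with l | l
    · exact (hq _ rfl).2.2.1 l
    · exact (hq _ rfl).2.2.2 l

lemma IsAdmissible.row_expansion {D1 : Matrix (Fin pa) (Fin pa) ℝ}
    (hD1 : Tendsto x.D1hat atTop (𝓝 D1)) (i : ℕ) :
    Tight P (fun q => rowMean (h q.1) (m q.1) (residAt x u ω₀ ω q) i) ∧
    (fun q => (ω q).2 0 * (h q.1 * m q.1) / lam (g q.1) (h q.1) (m q.1) (ω q).2 1
        * rowMean (h q.1) (m q.1) (residAt x u ω₀ ω q) i - u.α i q.2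
        - avg (h q.1) (fun l => u.γ (i, l) q.2)
        + avg (g q.1) fun r => Ha x D1 (g q.1) i r * u.α r q.2)
      =o[whp P] fun q => 1 / √(g q.1 : ℝ) + 1 / √(h q.1 : ℝ) := by
  obtain ⟨T, hz, -, -⟩ := hω.exists_slopes hx hu hθ₀ hg hh hm
  have hN := hu.rowNoise hθ₀ hg hh hm
  have hme := hω.means hθ₀ hg hh hm
  have hR : ∀ᶠ q in whp P, ∀ i, rowMean (h q.1) (m q.1) (residAt x u ω₀ ω q) i = _ :=
    hme.mono fun q hq i => rowMean_residTable x u hq.1.1 hq.1.2.1 hq.1.2.2 hq.2.1 i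
  refine ⟨tight_rowMean hx hN hz hR i,
    CrossedModel.row_expansion hx hN hz hD1 hR (hme.mono fun q hq => hq.2.2.1)
      (K := 4 * (ω₀.2 2 + ω₀.2 3) / ω₀.2 0) ?_ i⟩
  filter_upwards [hme, hω] with q hq hq'
  exact abs_shrink_row_sub_one_le (by exact_mod_cast hq.1.2.1) (by exact_mod_cast hq.1.2.2) hθ₀ hq'.2

/-- This is the row expansion for the swapped covariates: λ₂ is the row eigenvalue of the exchanged
model, in which θ₀ and θ₁ trade places. -/
lemma IsAdmissible.col_expansion {D2 : Matrix (Fin pb) (Fin pb) ℝ}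
    (hD2 : Tendsto x.D2hat atTop (𝓝 D2)) (j : ℕ) :
    Tight P (fun q => colMean (g q.1) (m q.1) (residAt x u ω₀ ω q) j) ∧
    (fun q => (ω q).2 1 * (g q.1 * m q.1) / lam (g q.1) (h q.1) (m q.1) (ω q).2 2
        * colMean (g q.1) (m q.1) (residAt x u ω₀ ω q) j - u.β j q.2
        - avg (g q.1) (fun r => u.γ (r, j) q.2)
        + avg (h q.1) fun l => Hb x D2 (h q.1) j l * u.β l q.2)
      =o[whp P] fun q => 1 / √(g q.1 : ℝ) + 1 / √(h q.1 : ℝ) := by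
  obtain ⟨T, -, hz, -⟩ := hω.exists_slopes hx hu hθ₀ hg hh hm
  have hN := hu.colNoise hθ₀ hg hh hm
  have hme := hω.means hθ₀ hg hh hm
  have hR : ∀ᶠ q in whp P, ∀ j, colMean (g q.1) (m q.1) (residAt x u ω₀ ω q) j =
      u.β j q.2 + ((avg (g q.1) fun r => u.γ (r, j) q.2)
        + avg (g q.1) fun i => avg (m q.1) fun k => u.e (i, j, k) q.2)
      - avg (h q.1) (fun j => u.β j q.2 + ((avg (g q.1) fun r => u.γ (r, j) q.2)
        + avg (g q.1) fun i => avg (m q.1) fun k => u.e (i, j, k) q.2))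
      - x.swap.XA (h q.1) (g q.1) (m q.1) j ⬝ᵥ slopesCol ((ω q).1 - ω₀.1) :=
    hme.mono fun q hq j => by
      rw [XA_swap]
      exact colMean_residTable x u hq.1.1 hq.1.2.1 hq.1.2.2 hq.2.1 j
  refine ⟨tight_rowMean hx.swap hN hz hR j, ?_⟩
  have := CrossedModel.row_expansion hx.swap hN hz (D1 := D2) hD2 hR
    (hme.mono fun q hq => hq.2.2.2) (K := 4 * (ω₀.2 2 + ω₀.2 3) / ω₀.2 1)
    (c := fun q => (ω q).2 1 * (g q.1 * m q.1) / lam (g q.1) (h q.1) (m q.1) (ω q).2 2) ?_ j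
  · simp only [add_comm (1 / √(g _ : ℝ))]
    exact this
  filter_upwards [hme, hω] with q hq hq'
  rw [lam_swap]
  have := abs_shrink_row_sub_one_le (g := h q.1) (h := g q.1) (m := m q.1)
    (θ₀ := ![ω₀.2 1, ω₀.2 0, ω₀.2 2, ω₀.2 3]) (θ := ![(ω q).2 1, (ω q).2 0, (ω q).2 2, (ω q).2 3])
    (by exact_mod_cast hq.1.1) (by exact_mod_cast hq.1.2.2)
    (fun l => by fin_cases l <;> exact hθ₀ _) (fun l => by fin_cases l <;> exact hq'.2 _)
  exact this

omit [IsProbabilityMeasure P] hx hu hθ₀ hm hω in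
/-- The rate of the doubly centred covariates. -/
lemma isLittleO_lg_mul_lg :
    (fun t => lg (g t) * lg (h t) / √(g t * h t : ℝ))
      =o[atTop] fun t => 1 / √(g t : ℝ) + 1 / √(h t : ℝ) := by
  have h1 : Tendsto (fun t => lg (g t) ^ 2 / √(g t : ℝ) + lg (h t) ^ 2 / √(h t : ℝ)) atTop (𝓝 0) := by
    simpa using (tendsto_lg_sq_div_sqrt.comp hg).add (tendsto_lg_sq_div_sqrt.comp hh)
  refine IsBigO.trans_isLittleO (IsBigO.of_bound 1 (Eventually.of_forall fun t => ?_))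
    (isLittleO_mul_of_tendsto_zero h1 (isBigO_refl _ _))
  have p1 := zero_le_one.trans (one_le_lg (g t))
  have p2 := zero_le_one.trans (one_le_lg (h t))
  rw [Real.norm_of_nonneg (by positivity), Real.norm_of_nonneg (by positivity), one_mul,
    Real.sqrt_mul (by positivity)]
  have e : (lg (g t) ^ 2 / √(g t : ℝ) + lg (h t) ^ 2 / √(h t : ℝ))
      * (1 / √(g t : ℝ) + 1 / √(h t : ℝ)) = (lg (g t) ^ 2 + lg (h t) ^ 2) / (√(g t : ℝ) * √(h t : ℝ))
      + (lg (g t) ^ 2 / √(g t : ℝ) / √(g t : ℝ) + lg (h t) ^ 2 / √(h t : ℝ) / √(h t : ℝ)) := by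
    simp only [div_eq_mul_inv, mul_inv]
    ring
  rw [e]
  refine le_add_of_le_of_nonneg (div_le_div_of_nonneg_right ?_ (by positivity)) (by positivity)
  nlinarith [sq_nonneg (lg (g t) - lg (h t))]

/-- A doubly centred covariate at a fixed cell is at most of order lg g · lg h, against slopes of
rate (gh)^(-1/2). -/
lemma IsAdmissible.isLittleO_inter (i j : ℕ) :
    (fun q => x.XAB (g q.1) (h q.1) (m q.1) i j ⬝ᵥ slopesInter ((ω q).1 - ω₀.1))
      =o[whp P] fun q => 1 / √(g q.1 : ℝ) + 1 / √(h q.1 : ℝ) := by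
  obtain ⟨T, hz, -, hi⟩ := hω.exists_slopes hx hu hθ₀ hg hh hm
  obtain ⟨K, hK, hb⟩ := hx.inter_bound i j
  have hb' := (tendsto_sizes hg hh hm).eventually hb
  refine IsLittleO.fun_sum fun l _ => ?_
  refine isLittleO_slope (z := fun q => slopesInter ((ω q).1 - ω₀.1) l) (T := T)
    (N := fun t => g t * h t) (b := fun t => x.XAB (g t) (h t) (m t) i j l)
    (ρ := fun t => 1 / √(g t : ℝ) + 1 / √(h t : ℝ)) hz.tight (hi l) ?_ ?_
  · filter_upwards [eventually_pos_of_tendsto hg, eventually_pos_of_tendsto hh] with t h1 h2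
    positivity
  · refine IsBigO.trans_isLittleO (IsBigO.of_bound K ?_) (isLittleO_lg_mul_lg hg hh)
    filter_upwards [hb'] with t ht
    rw [norm_div, norm_div, ← mul_div_assoc]
    refine div_le_div_of_nonneg_right ((ht l).trans_eq ?_) (norm_nonneg _)
    rw [Real.norm_of_nonneg (mul_nonneg (zero_le_one.trans (one_le_lg _))
      (zero_le_one.trans (one_le_lg _)))]

omit [IsProbabilityMeasure P] hx hu hθ₀ hm hω in
lemma isLittleO_rate_one :
    (fun q : ℕ × Ω => 1 / √(g q.1 : ℝ) + 1 / √(h q.1 : ℝ)) =o[whp P] fun _ => (1 : ℝ) := by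
  refine IsLittleO.comp_tendsto (f := fun t => 1 / √(g t : ℝ) + 1 / √(h t : ℝ))
    (g := fun _ : ℕ => (1 : ℝ)) ((isLittleO_one_iff ℝ).2 ?_) tendsto_fst_whp
  simpa using (tendsto_one_div_sqrt hg).add (tendsto_one_div_sqrt hh)

/-- The part of the residual interaction that is negligible. -/
lemma IsAdmissible.inter_expansion (i j : ℕ) :
    (fun q => cellMean (m q.1) (residAt x u ω₀ ω q) i j
      - rowMean (h q.1) (m q.1) (residAt x u ω₀ ω q) i
      - colMean (g q.1) (m q.1) (residAt x u ω₀ ω q) j - u.γ (i, j) q.2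
      - avg (m q.1) (fun k => u.e (i, j, k) q.2) + avg (h q.1) (fun l => u.γ (i, l) q.2)
      + avg (g q.1) (fun r => u.γ (r, j) q.2))
      =o[whp P] fun q => 1 / √(g q.1 : ℝ) + 1 / √(h q.1 : ℝ) := by
  obtain ⟨Og, Oh⟩ := isBigO_rates (P := P) g h
  have hN := hu.rowNoise hθ₀ hg hh hm
  have hN' := hu.colNoise hθ₀ hg hh hm
  refine ((((hN.isLittleO_avg.trans_isBigO Og).sub ((hN.isLittleO_within i).trans_isBigO Oh)).sub
    ((hN'.isLittleO_within j).trans_isBigO Og)).sub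
    (hω.isLittleO_inter hx hu hθ₀ hg hh hm i j)).congr' ?_ EventuallyEq.rfl
  filter_upwards [hω.means hθ₀ hg hh hm] with q hq
  have := interaction_residTable x u hq.1.1 hq.1.2.1 hq.1.2.2 hq.2.1 i j
  simp only [residAt] at this ⊢
  rw [this]
  ring

lemma IsAdmissible.tight_inter (i j : ℕ) : Tight P fun q =>
    cellMean (m q.1) (residAt x u ω₀ ω q) i j - rowMean (h q.1) (m q.1) (residAt x u ω₀ ω q) i
      - colMean (g q.1) (m q.1) (residAt x u ω₀ ω q) j := by
  have hN := hu.rowNoise hθ₀ hg hh hm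
  have hN' := hu.colNoise hθ₀ hg hh hm
  obtain ⟨-, -, hγ, he⟩ := hu.uncorrelated hθ₀
  have h1 := tight_of_isLittleO_one ((hω.inter_expansion hx hu hθ₀ hg hh hm i j).trans
    (isLittleO_rate_one hg hh))
  have h2 := tight_of_isLittleO_one (hN.isLittleO_inter i)
  have h3 := tight_of_isLittleO_one (hN'.isLittleO_inter j)
  have h4 : Tight P fun q : ℕ × Ω => u.γ (i, j) q.2 :=
    tight_of_integral_sq_le (ω₀.2 2) (Eventually.of_forall fun t =>
      ⟨(hγ.memLp (i, j)).integrable_sq, by simpa [pow_two] using (hγ.sq (i, j)).le⟩)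
  have h5 : Tight P fun q : ℕ × Ω => avg (m q.1) fun k => u.e (i, j, k) q.2 := by
    refine tight_of_integral_sq_le (ω₀.2 3) ?_
    filter_upwards [hu.uncorrelated_cell hθ₀ hm, eventually_pos_of_tendsto hm] with t ht hm
    refine ⟨(ht.memLp (i, j)).integrable_sq, ?_⟩
    have := ht.sq (i, j)
    simp only [← pow_two] at this
    rw [this]
    exact div_le_self (hθ₀ 3).le (by exact_mod_cast hm)
  refine ((((h1.add h4).add h5).sub h2).sub h3).of_le (Eventually.of_forall fun q => ?_)
  exact le_of_eq (congrArg _ (by ring))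

/-- Expansions of the empirical best linear unbiased predictors. -/
theorem IsAdmissible.expansions {D1 : Matrix (Fin pa) (Fin pa) ℝ}
    (hD1 : Tendsto x.D1hat atTop (𝓝 D1)) {D2 : Matrix (Fin pb) (Fin pb) ℝ}
    (hD2 : Tendsto x.D2hat atTop (𝓝 D2)) (i j : ℕ) :
    (fun q => (blupα x (g q.1) (h q.1) (m q.1) (response x (g q.1) (h q.1) (m q.1) ω₀.1 u q.2)
          (ω q) i - u.α i q.2) - (avg (h q.1) (fun l => u.γ (i, l) q.2)
            - avg (g q.1) (fun r => Ha x D1 (g q.1) i r * u.α r q.2)))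
      =o[whp P] (fun q => 1 / √(g q.1 : ℝ) + 1 / √(h q.1 : ℝ)) ∧
    (fun q => (blupβ x (g q.1) (h q.1) (m q.1) (response x (g q.1) (h q.1) (m q.1) ω₀.1 u q.2)
          (ω q) j - u.β j q.2) - (avg (g q.1) (fun r => u.γ (r, j) q.2)
            - avg (h q.1) (fun l => Hb x D2 (h q.1) j l * u.β l q.2)))
      =o[whp P] (fun q => 1 / √(g q.1 : ℝ) + 1 / √(h q.1 : ℝ)) ∧
    ∃ R₁ : ℕ → Ω → ℝ, IsBigOp P R₁ (fun t => 1 / (m t : ℝ)) ∧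
      (fun q => (blupγ x (g q.1) (h q.1) (m q.1) (response x (g q.1) (h q.1) (m q.1) ω₀.1 u q.2)
          (ω q) i j - u.γ (i, j) q.2) - (avg (m q.1) (fun k => u.e (i, j, k) q.2)
            - avg (h q.1) (fun l => u.γ (i, l) q.2) - avg (g q.1) (fun r => u.γ (r, j) q.2)
            + R₁ q.1 q.2))
      =o[whp P] (fun q => 1 / √(g q.1 : ℝ) + 1 / √(h q.1 : ℝ)) := by
  obtain ⟨Og, Oh⟩ := isBigO_rates (P := P) g h
  obtain ⟨tr, er⟩ := hω.row_expansion hx hu hθ₀ hg hh hm hD1 i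
  obtain ⟨tc, ec⟩ := hω.col_expansion hx hu hθ₀ hg hh hm hD2 j
  have hme := hω.means hθ₀ hg hh hm
  have hb := (hme.and (hω.and ((tendsto_fst_whp.eventually (hg.eventually_gt_atTop i)).and
      (tendsto_fst_whp.eventually (hh.eventually_gt_atTop j))))).mono fun q hq =>
    blup_eq hq.1.1.1 hq.1.1.2.1 hq.1.1.2.2 (nearTheta_pos hθ₀ hq.2.1.2)
      (resid_response x u _ _ _ ω₀.1 (ω q).1 q.2) hq.1.2.1 hq.2.2.1 hq.2.2.2
  refine ⟨er.congr' ?_ EventuallyEq.rfl, ec.congr' ?_ EventuallyEq.rfl, ?_⟩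
  · filter_upwards [hb] with q hq
    rw [hq.1]
    simp only [residAt]
    ring
  · filter_upwards [hb] with q hq
    rw [hq.2.1]
    simp only [residAt]
    ring
  set I : ℕ × Ω → ℝ := fun q => cellMean (m q.1) (residAt x u ω₀ ω q) i j
    - rowMean (h q.1) (m q.1) (residAt x u ω₀ ω q) i
    - colMean (g q.1) (m q.1) (residAt x u ω₀ ω q) j with hI
  -- R₁ is the amount by which the residual interaction is shrunk towards zero. It stays separate
  -- because 1/m is not comparable with the other rates when the sizes grow at arbitrary relative
  -- speed.
  refine ⟨fun t s => ((ω (t, s)).2 2 * m t / lam (g t) (h t) (m t) (ω (t, s)).2 3 - 1) * I (t, s),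
    ?_, ?_⟩
  · refine isBigOp_of_le_mul ((hω.tight_inter hx hu hθ₀ hg hh hm i j).const_mul
      (4 * ω₀.2 3 / ω₀.2 2)) (Eventually.of_forall fun t => by positivity) ?_
    filter_upwards [hω, hme] with q hq hq'
    have h1 := abs_shrink_inter_sub_one_le (g := g q.1) (h := h q.1) (m := m q.1)
      (by exact_mod_cast hq'.1.2.2) hθ₀ hq.2
    have h2 : 0 ≤ 4 * ω₀.2 3 / ω₀.2 2 := by
      have := hθ₀ 3
      have := hθ₀ 2
      positivity
    rw [abs_mul, abs_mul, abs_of_nonneg h2]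
    refine (mul_le_mul_of_nonneg_right h1 (abs_nonneg _)).trans_eq ?_
    ring
  -- The predictor of γ_ij also contains the residual row and column means, with coefficients of
  -- order 1/h and 1/g. Both products are negligible because those means are tight.
  · have small : ∀ {n : ℕ → ℕ} {c R : ℕ × Ω → ℝ} {K : ℝ}, Tendsto n atTop atTop → Tight P R →
        (∀ᶠ q in whp P, |c q| ≤ K / n q.1) →
        (fun q => c q * R q) =o[whp P] fun q => 1 / √(n q.1 : ℝ) := by
      intro n c R K hn hR hc
      refine isLittleO_of_le_mul (R := fun q => c q * R q)
        (T := R) (X := fun t => K / n t) (ρ := fun t => 1 / √(n t : ℝ)) hR ?_ ?_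
      · refine (isLittleO_mul_of_tendsto_zero (ε := fun t => K * (1 / √(n t : ℝ)))
          (by simpa using (tendsto_one_div_sqrt hn).const_mul K)
          (isBigO_refl _ _)).congr_left fun t => ?_
        rw [mul_assoc, div_mul_div_comm, Real.mul_self_sqrt (by positivity)]
        ring
      · filter_upwards [hc] with q hq
        rw [abs_mul, abs_mul]
        exact mul_le_mul_of_nonneg_right (hq.trans (le_abs_self _)) (abs_nonneg _)
    have s1 := small (c := fun q => (ω q).2 2 * m q.1 / lam (g q.1) (h q.1) (m q.1) (ω q).2 1)
      (K := 4 * ω₀.2 2 / ω₀.2 0) hh tr (by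
        filter_upwards [hω, hme] with q hq hq'
        exact abs_inter_row_le (by exact_mod_cast hq'.1.2.1) (by exact_mod_cast hq'.1.2.2) hθ₀ hq.2)
    have s2 := small (c := fun q => (ω q).2 2 * m q.1 / lam (g q.1) (h q.1) (m q.1) (ω q).2 2)
      (K := 4 * ω₀.2 2 / ω₀.2 1) hg tc (by
        filter_upwards [hω, hme] with q hq hq'
        rw [lam_swap]
        have := abs_inter_row_le (g := h q.1) (h := g q.1) (m := m q.1)
          (θ₀ := ![ω₀.2 1, ω₀.2 0, ω₀.2 2, ω₀.2 3])
          (θ := ![(ω q).2 1, (ω q).2 0, (ω q).2 2, (ω q).2 3])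
          (by exact_mod_cast hq'.1.1) (by exact_mod_cast hq'.1.2.2)
          (fun l => by fin_cases l <;> exact hθ₀ _) (fun l => by fin_cases l <;> exact hq.2 _)
        exact this)
    refine (((s1.trans_isBigO Oh).add (s2.trans_isBigO Og)).add
      (hω.inter_expansion hx hu hθ₀ hg hh hm i j)).congr' ?_ EventuallyEq.rfl
    filter_upwards [hb] with q hq
    rw [hq.2.2]
    simp only [hI, residAt]
    ring

end Predictors
end CrossedModel
end

open Filter Topology MeasureTheory ProbabilityTheory
noncomputable section
namespace CrossedModel
open Matrix

/-! ### Monotonicity of the determinant -/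

section Determinants
variable {n : Type*} [Fintype n] [DecidableEq n]

lemma one_le_det_of_posSemidef {M : Matrix n n ℝ} (hM : M.PosSemidef) : 1 ≤ (1 + M).det := by
  have hH : (1 + M).IsHermitian := isHermitian_one.add hM.1
  have hd : (1 + M).det = ∏ i, hH.eigenvalues i := by
    rw [hH.det_eq_prod_eigenvalues]
    simp
  rw [hd]
  refine Finset.one_le_prod fun i _ => ?_
  have h1 := hH.mulVec_eigenvectorBasis i
  set v := (hH.eigenvectorBasis i).ofLp with hv
  have hv1 : v ⬝ᵥ v = 1 := by
    have := hH.eigenvectorBasis.orthonormal.1 i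
    have h2 : inner ℝ (hH.eigenvectorBasis i) (hH.eigenvectorBasis i) = (1 : ℝ) := by
      rw [real_inner_self_eq_norm_sq, this, one_pow]
    rw [EuclideanSpace.inner_eq_star_dotProduct] at h2
    simpa using h2
  have h3 : v ⬝ᵥ ((1 + M) *ᵥ v) = hH.eigenvalues i := by
    rw [h1, dotProduct_smul, hv1, smul_eq_mul, mul_one]
  have h4 := hM.dotProduct_mulVec_nonneg v
  rw [add_mulVec, one_mulVec, dotProduct_add, hv1] at h3
  rw [star_trivial] at h4
  exact (le_add_of_nonneg_right h4).trans_eq h3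

open scoped MatrixOrder Matrix.Norms.L2Operator in
lemma exists_eq_conjTranspose_mul_self {A : Matrix n n ℝ} (hA : A.PosSemidef) :
    ∃ C : Matrix n n ℝ, A = Cᴴ * C :=
  CStarAlgebra.nonneg_iff_eq_star_mul_self.mp hA.nonneg

/-- Congruence by the factor C of A = CᴴC reduces to A = 1, where all eigenvalues of the sum are at
least 1. -/
lemma det_le_det_add {A B : Matrix n n ℝ} (hA : A.PosDef) (hB : B.PosSemidef) :
    A.det ≤ (A + B).det := by
  obtain ⟨C, hC⟩ := exists_eq_conjTranspose_mul_self hA.posSemidef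
  have hu : IsUnit C.det := by
    have := hA.det_pos
    rw [hC, det_mul] at this
    exact (right_ne_zero_of_mul this.ne').isUnit
  have hu' : IsUnit Cᴴ.det := by rwa [det_conjTranspose, star_trivial]
  have e : A + B = Cᴴ * (1 + (C⁻¹)ᴴ * B * C⁻¹) * C := by
    rw [conjTranspose_nonsing_inv, Matrix.mul_add, Matrix.add_mul, Matrix.mul_one, ← hC,
      ← Matrix.mul_assoc, mul_nonsing_inv_cancel_left _ _ hu', nonsing_inv_mul_cancel_right _ _ hu]
  have h1 := one_le_det_of_posSemidef (hB.conjTranspose_mul_mul_same C⁻¹)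
  have h2 := hA.det_pos
  rw [e, det_mul, det_mul, mul_right_comm, ← det_mul, ← hC]
  exact le_mul_of_one_le_right h2.le h1

end Determinants

/-! ### Scalar inequalities for one stratum -/

section Scalars

/-- With r = √w, log w = 2 log r ≤ 2(r - 1) yields w - 1 - log w ≥ (r - 1)², and (r + 1)² ≤ 6 when
r² ≤ 2. -/
lemma sq_le_sub_log {w : ℝ} (h1 : 0 < w) (h2 : w ≤ 2) : (w - 1) ^ 2 / 6 ≤ w - 1 - Real.log w := by
  have hs := Real.sqrt_pos.2 h1
  have e : Real.log w = 2 * Real.log √w := by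
    rw [Real.log_sqrt h1.le]
    ring
  have h3 := Real.log_le_sub_one_of_pos hs
  have h4 := Real.sq_sqrt h1.le
  set r := √w
  have h5 : (w - 1) ^ 2 = (r - 1) ^ 2 * (r + 1) ^ 2 := by rw [← h4]; ring
  have h6 : (r + 1) ^ 2 ≤ 6 := by nlinarith [sq_nonneg (r - 1)]
  have h7 : w - 1 - Real.log w ≥ (r - 1) ^ 2 := by rw [e]; nlinarith
  have h8 : (w - 1) ^ 2 ≤ (r - 1) ^ 2 * 6 := by
    rw [h5]
    exact mul_le_mul_of_nonneg_left h6 (sq_nonneg _)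
  linarith

/-- Contribution of a stratum with `n` degrees of freedom to the profile criterion, at the ratio
`w` of the true eigenvalue to the trial one. -/
lemma stratum_contribution_ge {w n q N B : ℝ} (hw : 1 / 2 ≤ w) (hw2 : w ≤ 2) (hn : 0 ≤ n)
    (hB : 0 ≤ B) (hq : (q - n) ^ 2 ≤ B ^ 2 * n) (hN : N ≤ B) :
    n * (w - 1) ^ 2 / 12 - 3 * B ^ 2 - 2 * B ≤ -(n * Real.log w) + (w - 1) * q - w * N := by
  have h1 := mul_le_mul_of_nonneg_left (sq_le_sub_log (by linarith) hw2) hn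
  have h2 : w * N ≤ 2 * B := by nlinarith
  have h3 : |q - n| ≤ B * √n := by
    refine abs_le_of_sq_le_sq ?_ (by positivity)
    rwa [mul_pow, Real.sq_sqrt hn]
  have h4 : -(|w - 1| * (B * √n)) ≤ (w - 1) * (q - n) := by
    refine neg_le_of_abs_le ?_
    rw [abs_mul]
    exact mul_le_mul_of_nonneg_left h3 (abs_nonneg _)
  -- Half of the quadratic gain n(w - 1)²/6 is spent on the fluctuation of q, at the price of 3B².
  -- The term 2B of the final bound comes from w N ≤ 2B.
  have h5 : |w - 1| * (B * √n) ≤ n * (w - 1) ^ 2 / 12 + 3 * B ^ 2 := by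
    have := Real.sq_sqrt hn
    have e : n * (w - 1) ^ 2 = (|w - 1| * √n) ^ 2 := by rw [mul_pow, sq_abs, this]; ring
    rw [e]
    nlinarith [sq_nonneg (|w - 1| * √n / 6 - B)]
  nlinarith

end Scalars

/-! ### Generalised least squares -/

section GLS
variable {pa pb pab pw : ℕ} {x : Covariates pa pb pab pw} {g h m : ℕ}

/-- Residual sum of squares in a stratum. -/
def stratumSS (x : Covariates pa pb pab pw) (g h m : ℕ) (y : Cell g h m → ℝ)
    (ξ : FixedIdx pa pb pab pw → ℝ) (k : Fin 5) : ℝ :=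
  resid x g h m y ξ ⬝ᵥ (strat g h m k *ᵥ resid x g h m y ξ)

variable (hg : 0 < g) (hh : 0 < h) (hm : 0 < m)
include hg hh hm

lemma quadForm_eq_sum (y : Cell g h m → ℝ) (ξ : FixedIdx pa pb pab pw → ℝ) {θ : Fin 4 → ℝ}
    (hθ : ∀ l, 0 < θ l) :
    quadForm x g h m y (ξ, θ) = ∑ k, (lam g h m θ k)⁻¹ * stratumSS x g h m y ξ k := by
  rw [quadForm, V_inv_eq hg hh hm hθ, dotProduct_sum_smul_mulVec]
  rfl

lemma fixedInfo_eq_sum {θ : Fin 4 → ℝ} (hθ : ∀ l, 0 < θ l) :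
    fixedInfo x g h m θ
      = ∑ k, (lam g h m θ k)⁻¹ • ((design x g h m)ᵀ * strat g h m k * design x g h m) := by
  rw [fixedInfo, V_inv_eq hg hh hm hθ, Matrix.mul_sum, Matrix.sum_mul]
  simp only [Matrix.mul_smul, Matrix.smul_mul]

lemma dotProduct_fixedInfo_mulVec {θ : Fin 4 → ℝ} (hθ : ∀ l, 0 < θ l)
    (v : FixedIdx pa pb pab pw → ℝ) :
    v ⬝ᵥ (fixedInfo x g h m θ *ᵥ v) = ∑ k, (lam g h m θ k)⁻¹ *
      ((strat g h m k *ᵥ (design x g h m *ᵥ v)) ⬝ᵥ (strat g h m k *ᵥ (design x g h m *ᵥ v))) := by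
  rw [fixedInfo, ← mulVec_mulVec, ← mulVec_mulVec, V_inv_eq hg hh hm hθ, dotProduct_mulVec,
    vecMul_transpose, dotProduct_sum_smul_mulVec]
  exact Finset.sum_congr rfl fun k _ =>
    congrArg _ ((isResolution_strat hg hh hm).dotProduct_mulVec_eq k _ _)

lemma fixedInfo_isHermitian {θ : Fin 4 → ℝ} (hθ : ∀ l, 0 < θ l) :
    (fixedInfo x g h m θ).IsHermitian := by
  rw [IsHermitian, conjTranspose_eq_transpose_of_trivial, fixedInfo_eq_sum hg hh hm hθ,
    transpose_sum]
  refine Finset.sum_congr rfl fun k _ => ?_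
  rw [transpose_smul, transpose_mul, transpose_mul, transpose_transpose,
    (isResolution_strat hg hh hm).symm, Matrix.mul_assoc]

variable (hinj : ∀ v, design x g h m *ᵥ v = 0 → v = 0)
include hinj

lemma fixedInfo_posDef {θ : Fin 4 → ℝ} (hθ : ∀ l, 0 < θ l) : (fixedInfo x g h m θ).PosDef := by
  refine PosDef.of_dotProduct_mulVec_pos (fixedInfo_isHermitian hg hh hm hθ) fun v hv => ?_
  have hl := fun k => lam_pos (g := g) (h := h) (m := m) hθ k
  rw [star_trivial, dotProduct_fixedInfo_mulVec hg hh hm hθ]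
  have h0 : ∀ k, 0 ≤ (strat g h m k *ᵥ (design x g h m *ᵥ v)) ⬝ᵥ
    (strat g h m k *ᵥ (design x g h m *ᵥ v)) := fun k => Finset.sum_nonneg fun i _ => mul_self_nonneg _
  refine (Finset.sum_nonneg fun k _ => mul_nonneg (inv_pos.2 (hl k)).le (h0 k)).lt_of_ne' fun he => ?_
  refine hv (hinj v ?_)
  rw [Finset.sum_eq_zero_iff_of_nonneg fun k _ => mul_nonneg (inv_pos.2 (hl k)).le (h0 k)] at he
  have h1 : ∀ k, strat g h m k *ᵥ (design x g h m *ᵥ v) = 0 := fun k => by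
    refine dotProduct_self_eq_zero.1 ?_
    exact (mul_eq_zero.1 (he k (Finset.mem_univ k))).resolve_left (inv_pos.2 (hl k)).ne'
  have h2 := sum_mulVec Finset.univ (strat g h m) (design x g h m *ᵥ v)
  rw [(isResolution_strat hg hh hm).sum_eq, one_mulVec] at h2
  rw [h2, Finset.sum_eq_zero fun k _ => h1 k]

lemma isScoreZero_gls (y : Cell g h m → ℝ) {θ : Fin 4 → ℝ} (hθ : ∀ l, 0 < θ l) :
    IsScoreZero x g h m θ (resid x g h m y (gls x g h m y θ)) := by
  intro v
  have hu := (fixedInfo_posDef hg hh hm hinj hθ).det_pos.ne'.isUnit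
  have h1 : fixedInfo x g h m θ *ᵥ gls x g h m y θ
      = (design x g h m)ᵀ *ᵥ ((V g h m θ)⁻¹ *ᵥ y) := by
    rw [gls, mulVec_mulVec, mul_nonsing_inv _ hu, one_mulVec]
  rw [← vecMul_transpose, ← dotProduct_mulVec, resid, mulVec_sub, mulVec_sub, ← h1, fixedInfo,
    mulVec_mulVec, mulVec_mulVec, Matrix.mul_assoc, sub_self, dotProduct_zero]

/-- Pythagoras in the metric of V⁻¹: the generalised least squares residual is orthogonal to the
fixed effects. -/
lemma quadForm_gls_le (y : Cell g h m → ℝ) {θ : Fin 4 → ℝ} (hθ : ∀ l, 0 < θ l)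
    (ξ : FixedIdx pa pb pab pw → ℝ) :
    quadForm x g h m y (gls x g h m y θ, θ) ≤ quadForm x g h m y (ξ, θ) := by
  have hs := isScoreZero_gls hg hh hm hinj y hθ
  set ξ' := gls x g h m y θ
  have e : resid x g h m y ξ = resid x g h m y ξ' - design x g h m *ᵥ (ξ - ξ') := by
    rw [resid, resid, mulVec_sub]
    abel
  have hs1 := hs (ξ - ξ')
  have hpos : 0 ≤ (design x g h m *ᵥ (ξ - ξ')) ⬝ᵥ
      ((V g h m θ)⁻¹ *ᵥ (design x g h m *ᵥ (ξ - ξ'))) := by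
    rw [V_inv_eq hg hh hm hθ, dotProduct_sum_smul_mulVec]
    refine Finset.sum_nonneg fun k _ => mul_nonneg
      (inv_pos.2 (lam_pos (g := g) (h := h) (m := m) hθ k)).le ?_
    rw [(isResolution_strat hg hh hm).dotProduct_mulVec_eq]
    exact Finset.sum_nonneg fun i _ => mul_self_nonneg _
  have hs2 : resid x g h m y ξ' ⬝ᵥ ((V g h m θ)⁻¹ *ᵥ (design x g h m *ᵥ (ξ - ξ'))) = 0 := by
    rw [dotProduct_mulVec, ← mulVec_transpose, transpose_nonsing_inv, V_transpose, dotProduct_comm]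
    exact hs1
  simp only [quadForm]
  rw [e, mulVec_sub (V g h m θ)⁻¹, dotProduct_sub, sub_dotProduct, sub_dotProduct, hs1, hs2]
  linarith

/-- The eigenvalues at θ are at most twice those at θ₀, so the information at θ dominates half of
the information at θ₀, and determinants are monotone. The REML correction thus costs only a bounded
amount, which allows ML and REML to be treated together. -/
lemma log_det_fixedInfo_ge {θ₀ θ : Fin 4 → ℝ} (hθ₀ : ∀ l, 0 < θ₀ l) (hθ : θ ∈ nearTheta θ₀) :
    Real.log (fixedInfo x g h m θ₀).det - Fintype.card (FixedIdx pa pb pab pw) * Real.log 2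
      ≤ Real.log (fixedInfo x g h m θ).det := by
  have hp := nearTheta_pos hθ₀ hθ
  have hA := fixedInfo_posDef hg hh hm hinj hθ₀
  have hl := fun k => lam_pos (g := g) (h := h) (m := m) hp k
  have hl0 := fun k => lam_pos (g := g) (h := h) (m := m) hθ₀ k
  have hA' : ((1 / 2 : ℝ) • fixedInfo x g h m θ₀).PosDef := hA.smul (by norm_num)
  have hB : (fixedInfo x g h m θ - (1 / 2 : ℝ) • fixedInfo x g h m θ₀).PosSemidef := by
    refine PosSemidef.of_dotProduct_mulVec_nonneg
      ((fixedInfo_isHermitian hg hh hm hp).sub hA'.1) fun v => ?_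
    rw [star_trivial, sub_mulVec, dotProduct_sub, smul_mulVec, dotProduct_smul,
      dotProduct_fixedInfo_mulVec hg hh hm hp, dotProduct_fixedInfo_mulVec hg hh hm hθ₀, smul_eq_mul,
      Finset.mul_sum, ← Finset.sum_sub_distrib]
    refine Finset.sum_nonneg fun k _ => ?_
    rw [← mul_assoc, ← sub_mul]
    refine mul_nonneg (sub_nonneg.2 ?_) (Finset.sum_nonneg fun i _ => mul_self_nonneg _)
    rw [one_div, ← mul_inv]
    exact inv_anti₀ (hl k) (lam_near hθ g h m k).2
  have h1 := det_le_det_add hA' hB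
  rw [add_sub_cancel, det_smul] at h1
  have h2 := Real.log_le_log (mul_pos (by positivity) hA.det_pos) h1
  rw [Real.log_mul (by positivity) hA.det_pos.ne', Real.log_pow, one_div, Real.log_inv] at h2
  linarith

end GLS
end CrossedModel
end

open Filter Topology MeasureTheory ProbabilityTheory
noncomputable section
namespace CrossedModel
open Matrix

/-! ### Smoothness of the criteria, and local minima of the profile as solutions -/

section DifferentiableMatrices
variable {E n : Type*} [NormedAddCommGroup E] [NormedSpace ℝ E] [Fintype n] [DecidableEq n]
  {A : E → Matrix n n ℝ} {t : E}

lemma differentiableAt_det (hA : ∀ i j, DifferentiableAt ℝ (fun t => A t i j) t) :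
    DifferentiableAt ℝ (fun t => (A t).det) t := by
  simp only [det_apply']
  refine DifferentiableAt.fun_sum fun σ _ => DifferentiableAt.const_mul ?_ _
  exact (HasFDerivAt.finsetProd (g := fun i t => A t (σ i) i)
    fun i _ => (hA (σ i) i).hasFDerivAt).differentiableAt

lemma differentiableAt_inv (hA : ∀ i j, DifferentiableAt ℝ (fun t => A t i j) t)
    (h0 : (A t).det ≠ 0) (i j : n) : DifferentiableAt ℝ (fun t => (A t)⁻¹ i j) t := by
  simp only [inv_def, Ring.inverse_eq_inv', Matrix.smul_apply, smul_eq_mul, adjugate_apply]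
  refine ((differentiableAt_det hA).inv h0).mul (differentiableAt_det fun a b => ?_)
  simp only [updateRow_apply]
  split_ifs
  · exact differentiableAt_const _
  · exact hA _ _

end DifferentiableMatrices

section Smoothness
variable {pa pb pab pw : ℕ} {x : Covariates pa pb pab pw} {g h m : ℕ}

lemma differentiable_lam (g h m : ℕ) (k : Fin 5) : Differentiable ℝ fun θ => lam g h m θ k := by
  fin_cases k <;> simp only [lam, Fin.zero_eta, Fin.mk_one, Fin.reduceFinMk, cons_val] <;> fun_prop

lemma eventually_pos_nhds {θ : Fin 4 → ℝ} (hθ : ∀ l, 0 < θ l) : ∀ᶠ θ' in 𝓝 θ, ∀ l, 0 < θ' l :=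
  eventually_all.2 fun l => (continuous_apply l).continuousAt.eventually_const_lt (hθ l)

lemma differentiableAt_lam_inv {θ : Fin 4 → ℝ} (hθ : ∀ l, 0 < θ l) (k : Fin 5) :
    DifferentiableAt ℝ (fun θ => (lam g h m θ k)⁻¹) θ :=
  (differentiable_lam g h m k θ).inv (lam_pos hθ k).ne'

variable (hg : 0 < g) (hh : 0 < h) (hm : 0 < m) {θ : Fin 4 → ℝ} (hθ : ∀ l, 0 < θ l)
include hg hh hm hθ

lemma log_det_V : Real.log (V g h m θ).det
    = ∑ k, (strat g h m k).trace * Real.log (lam g h m θ k) := by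
  rw [V_eq_sum hg hh hm]
  exact ((isResolution_strat hg hh hm).log_det fun k => lam_pos hθ k).2

lemma differentiableAt_log_det_V : DifferentiableAt ℝ (fun θ => Real.log (V g h m θ).det) θ := by
  have h1 : DifferentiableAt ℝ (fun θ => ∑ k, (strat g h m k).trace * Real.log (lam g h m θ k)) θ :=
    DifferentiableAt.fun_sum fun k _ =>
      ((differentiable_lam g h m k θ).log (lam_pos hθ k).ne').const_mul _
  refine h1.congr_of_eventuallyEq ?_
  filter_upwards [eventually_pos_nhds hθ] with θ' hθ' using log_det_V hg hh hm hθ'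

lemma differentiableAt_quadForm (y : Cell g h m → ℝ) (ξ : FixedIdx pa pb pab pw → ℝ) :
    DifferentiableAt ℝ (quadForm x g h m y) (ξ, θ) := by
  have h1 : DifferentiableAt ℝ (fun ω : Param pa pb pab pw =>
      ∑ k, (lam g h m ω.2 k)⁻¹ * stratumSS x g h m y ω.1 k) (ξ, θ) := by
    refine DifferentiableAt.fun_sum fun k _ => DifferentiableAt.mul ?_ ?_
    · exact DifferentiableAt.comp (g := fun θ => (lam g h m θ k)⁻¹) (f := Prod.snd) (ξ, θ)
        (differentiableAt_lam_inv hθ k) differentiableAt_snd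
    · simp only [stratumSS, resid, dotProduct, mulVec, Pi.sub_apply]
      fun_prop
  refine h1.congr_of_eventuallyEq ?_
  have h2 : ∀ᶠ ω : Param pa pb pab pw in 𝓝 (ξ, θ), ∀ l, 0 < ω.2 l :=
    continuousAt_snd.eventually (eventually_pos_nhds hθ)
  filter_upwards [h2] with ω hω using quadForm_eq_sum hg hh hm y ω.1 hω

lemma differentiableAt_fixedInfo (a b : FixedIdx pa pb pab pw) :
    DifferentiableAt ℝ (fun θ => fixedInfo x g h m θ a b) θ := by
  have h1 : DifferentiableAt ℝ (fun θ => ∑ k, (lam g h m θ k)⁻¹ *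
      ((design x g h m)ᵀ * strat g h m k * design x g h m) a b) θ :=
    DifferentiableAt.fun_sum fun k _ => (differentiableAt_lam_inv hθ k).mul_const _
  refine h1.congr_of_eventuallyEq ?_
  filter_upwards [eventually_pos_nhds hθ] with θ' hθ'
  rw [fixedInfo_eq_sum hg hh hm hθ', Matrix.sum_apply]
  rfl

variable (hinj : ∀ v, design x g h m *ᵥ v = 0 → v = 0)
include hinj

lemma differentiableAt_gls (y : Cell g h m → ℝ) : DifferentiableAt ℝ (gls x g h m y) θ := by
  refine differentiableAt_pi.2 fun a => ?_
  have hd := (fixedInfo_posDef hg hh hm hinj hθ).det_pos.ne'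
  have h1 : DifferentiableAt ℝ (fun θ => ∑ b, (fixedInfo x g h m θ)⁻¹ a b *
      ∑ c, design x g h m c b * ∑ k, (lam g h m θ k)⁻¹ * (strat g h m k *ᵥ y) c) θ := by
    refine DifferentiableAt.fun_sum fun b _ => DifferentiableAt.mul
      (differentiableAt_inv (differentiableAt_fixedInfo hg hh hm hθ) hd a b) ?_
    refine DifferentiableAt.fun_sum fun c _ => DifferentiableAt.const_mul ?_ _
    exact DifferentiableAt.fun_sum fun k _ => (differentiableAt_lam_inv hθ k).mul_const _
  refine h1.congr_of_eventuallyEq ?_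
  filter_upwards [eventually_pos_nhds hθ] with θ' hθ'
  rw [gls, V_inv_eq hg hh hm hθ', sum_smul_mulVec]
  simp only [mulVec, dotProduct, transpose_apply, Finset.sum_apply, Pi.smul_apply, smul_eq_mul]

/-- Minus twice the profile log-likelihood (`c = 0`) or restricted log-likelihood (`c = 1`), up to
a constant. -/
def profileCrit (x : Covariates pa pb pab pw) (g h m : ℕ) (y : Cell g h m → ℝ) (c : ℝ)
    (θ : Fin 4 → ℝ) : ℝ :=
  Real.log (V g h m θ).det + c * Real.log (fixedInfo x g h m θ).det
    + quadForm x g h m y (gls x g h m y θ, θ)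

lemma differentiableAt_profileCrit (y : Cell g h m → ℝ) (c : ℝ) :
    DifferentiableAt ℝ (profileCrit x g h m y c) θ := by
  refine ((differentiableAt_log_det_V hg hh hm hθ).add (DifferentiableAt.const_mul ?_ _)).add ?_
  · exact (differentiableAt_det (differentiableAt_fixedInfo hg hh hm hθ)).log
      (fixedInfo_posDef hg hh hm hinj hθ).det_pos.ne'
  · exact DifferentiableAt.comp (f := fun θ => (gls x g h m y θ, θ)) θ
      (differentiableAt_quadForm hg hh hm hθ y _)
      ((differentiableAt_gls hg hh hm hθ hinj y).prodMk differentiableAt_id)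

/-- For each θ the likelihood is maximal in ξ at generalised least squares. A local minimum of the
profile criterion is therefore a local maximum of the likelihood in both arguments jointly, where
the derivative vanishes. -/
lemma isMLSolution_of_isLocalMin {y : Cell g h m → ℝ}
    (hmin : IsLocalMin (profileCrit x g h m y 0) θ) :
    IsMLSolution x g h m y (gls x g h m y θ, θ) := by
  refine ⟨⟨(hθ 0).le, (hθ 1).le, (hθ 2).le, hθ 3⟩, ?_⟩
  have hd : DifferentiableAt ℝ (logLik x g h m y) (gls x g h m y θ, θ) := by
    have h1 : DifferentiableAt ℝ (fun ω : Param pa pb pab pw => Real.log (V g h m ω.2).det)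
        (gls x g h m y θ, θ) :=
      DifferentiableAt.comp (g := fun θ => Real.log (V g h m θ).det) (f := Prod.snd)
        (gls x g h m y θ, θ) (differentiableAt_log_det_V hg hh hm hθ) differentiableAt_snd
    have h2 := differentiableAt_quadForm (x := x) hg hh hm hθ y (gls x g h m y θ)
    unfold logLik
    fun_prop
  have hmax : IsLocalMax (logLik x g h m y) (gls x g h m y θ, θ) := by
    have h2 : ∀ᶠ ω : Param pa pb pab pw in 𝓝 (gls x g h m y θ, θ),
        (∀ l, 0 < ω.2 l) ∧ profileCrit x g h m y 0 θ ≤ profileCrit x g h m y 0 ω.2 :=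
      (continuousAt_snd (p := (gls x g h m y θ, θ))).eventually
        ((eventually_pos_nhds hθ).and hmin)
    filter_upwards [h2] with ω hω
    have := quadForm_gls_le hg hh hm hinj y hω.1 ω.1
    simp only [profileCrit, zero_mul, add_zero] at hω
    simp only [logLik]
    linarith [hω.2]
  have := hd.hasFDerivAt
  rwa [hmax.fderiv_eq_zero] at this

/-- The REML criterion is minus half the profile criterion with c = 1, and for fixed θ the least
squares estimate maximises the likelihood over all ξ. -/
lemma isREMLSolution_of_isLocalMin {y : Cell g h m → ℝ}
    (hmin : IsLocalMin (profileCrit x g h m y 1) θ) :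
    IsREMLSolution x g h m y (gls x g h m y θ, θ) := by
  refine ⟨⟨(hθ 0).le, (hθ 1).le, (hθ 2).le, hθ 3⟩, ?_, ?_⟩
  · have e : remlCrit x g h m y = fun θ => -(1 / 2) * profileCrit x g h m y 1 θ := by
      funext θ
      simp only [remlCrit, profileCrit]
      ring
    have hmax : IsLocalMax (remlCrit x g h m y) θ := by
      filter_upwards [hmin] with θ' hθ'
      rw [e]
      linarith
    have hd : DifferentiableAt ℝ (remlCrit x g h m y) θ := by
      rw [e]
      exact (differentiableAt_profileCrit hg hh hm hθ hinj y 1).const_mul _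
    have := hd.hasFDerivAt
    rwa [hmax.fderiv_eq_zero] at this
  · have hd : DifferentiableAt ℝ (fun ξ => logLik x g h m y (ξ, θ)) (gls x g h m y θ) := by
      have h1 : DifferentiableAt ℝ (fun ξ => quadForm x g h m y (ξ, θ)) (gls x g h m y θ) :=
        DifferentiableAt.comp (f := fun ξ : FixedIdx pa pb pab pw → ℝ => (ξ, θ))
          (gls x g h m y θ) (differentiableAt_quadForm hg hh hm hθ y _)
          (differentiableAt_id.prodMk (differentiableAt_const _))
      simp only [logLik]
      fun_prop
    have hmax : IsLocalMax (fun ξ => logLik x g h m y (ξ, θ)) (gls x g h m y θ) := by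
      refine Eventually.of_forall fun ξ => ?_
      have := quadForm_gls_le hg hh hm hinj y hθ ξ
      simp only [logLik]
      linarith
    have := hd.hasFDerivAt
    rwa [hmax.fderiv_eq_zero] at this

end Smoothness
end CrossedModel
end

open Filter Topology MeasureTheory ProbabilityTheory
noncomputable section
namespace CrossedModel
open Matrix

/-! ### Boxes in the eigenvalues -/

section Box

/-- Variance components whose eigenvalues have relative error at most `ε`. -/
def thetaBox (g h m : ℕ) (θ₀ : Fin 4 → ℝ) (ε : ℝ) : Set (Fin 4 → ℝ) :=
  {θ | ∀ k : Fin 5, k ≠ 0 → |lam g h m θ k - lam g h m θ₀ k| ≤ ε * lam g h m θ₀ k}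

variable {g h m : ℕ} {θ₀ θ : Fin 4 → ℝ} {ε : ℝ}

lemma isClosed_thetaBox : IsClosed (thetaBox g h m θ₀ ε) := by
  simp only [thetaBox, Set.ofPred_forall]
  refine isClosed_iInter fun k => isClosed_iInter fun _ => isClosed_le ?_ continuous_const
  exact ((differentiable_lam g h m k).continuous.sub continuous_const).abs

/-- The components are recovered by differences: λ₄ is θ₃, λ₃ - λ₄ is m θ₂, λ₁ - λ₃ is hm θ₀ and λ₂
- λ₃ is gm θ₁. In each difference the smaller eigenvalue is at most of the order of the scale
divided out, so relative errors ε give errors of order ε. The eigenvalue λ₀ is not needed, and its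
single degree of freedom could not control it. -/
lemma abs_sub_le_of_mem_thetaBox (hg : 0 < g) (hh : 0 < h) (hm : 0 < m) (hθ₀ : ∀ l, 0 < θ₀ l)
    (hε : 0 < ε) (hθ : θ ∈ thetaBox g h m θ₀ ε) (l : Fin 4) : |θ l - θ₀ l| ≤ 2 * ε * ∑ l, θ₀ l := by
  have b1 := hθ 1 (by decide)
  have b2 := hθ 2 (by decide)
  have b3 := hθ 3 (by decide)
  have b4 := hθ 4 (by decide)
  have t0 := hθ₀ 0
  have t1 := hθ₀ 1
  have t2 := hθ₀ 2
  have t3 := hθ₀ 3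
  have hg' : (1 : ℝ) ≤ g := by exact_mod_cast hg
  have hh' : (1 : ℝ) ≤ h := by exact_mod_cast hh
  have hm' : (1 : ℝ) ≤ m := by exact_mod_cast hm
  have le_of_scaled : ∀ {c d s : ℝ}, 1 ≤ c → |c * d| ≤ ε * (c * s) → |d| ≤ ε * s := by
    intro c d s hc hd
    rw [abs_mul, abs_of_pos (by linarith), mul_left_comm] at hd
    exact le_of_mul_le_mul_left hd (by linarith)
  have a3 : ∀ {c : ℝ}, 1 ≤ c → θ₀ 3 ≤ c * θ₀ 3 := fun hc => le_mul_of_one_le_left t3.le hc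
  simp only [lam, cons_val] at b1 b2 b3 b4
  rw [Fin.sum_univ_four]
  have key : ∀ {c : ℝ} (l : Fin 4) (s : ℝ), 1 ≤ c → s ≤ 2 * (θ₀ 0 + θ₀ 1 + θ₀ 2 + θ₀ 3) →
      |c * (θ l - θ₀ l)| ≤ ε * (c * s) → |θ l - θ₀ l| ≤ 2 * ε * (θ₀ 0 + θ₀ 1 + θ₀ 2 + θ₀ 3) := by
    intro c l s hc hs hd
    refine (le_of_scaled hc hd).trans ?_
    rw [mul_comm 2 ε, mul_assoc]
    exact mul_le_mul_of_nonneg_left hs hε.le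
  have hhm : (1 : ℝ) ≤ h * m := one_le_mul_of_one_le_of_one_le hh' hm'
  have hgm : (1 : ℝ) ≤ g * m := one_le_mul_of_one_le_of_one_le hg' hm'
  have scale : ∀ (n : ℝ), 1 ≤ n → ε * (2 * (m * θ₀ 2) + 2 * θ₀ 3)
      ≤ ε * (n * m * (2 * θ₀ 2 + 2 * θ₀ 3)) := fun n hn => by
    refine mul_le_mul_of_nonneg_left ?_ hε.le
    have e1 : m * θ₀ 2 ≤ n * m * θ₀ 2 := by
      rw [mul_assoc]
      exact le_mul_of_one_le_left (by positivity) hn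
    linarith [a3 (one_le_mul_of_one_le_of_one_le hn hm')]
  fin_cases l
  · refine key (c := h * m) 0 (θ₀ 0 + (2 * θ₀ 2 + 2 * θ₀ 3)) hhm (by linarith) ?_
    have e : h * m * (θ 0 - θ₀ 0) = (h * m * θ 0 + m * θ 2 + θ 3 - (h * m * θ₀ 0 + m * θ₀ 2 + θ₀ 3))
      - (m * θ 2 + θ 3 - (m * θ₀ 2 + θ₀ 3)) := by ring
    rw [e]
    refine (abs_sub _ _).trans ((add_le_add b1 b3).trans ?_)
    linarith [scale h hh']
  · refine key (c := g * m) 1 (θ₀ 1 + (2 * θ₀ 2 + 2 * θ₀ 3)) hgm (by linarith) ?_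
    have e : g * m * (θ 1 - θ₀ 1) = (g * m * θ 1 + m * θ 2 + θ 3 - (g * m * θ₀ 1 + m * θ₀ 2 + θ₀ 3))
      - (m * θ 2 + θ 3 - (m * θ₀ 2 + θ₀ 3)) := by ring
    rw [e]
    refine (abs_sub _ _).trans ((add_le_add b2 b3).trans ?_)
    linarith [scale g hg']
  · refine key (c := m) 2 (θ₀ 2 + 2 * θ₀ 3) hm' (by linarith) ?_
    have e : m * (θ 2 - θ₀ 2) = (m * θ 2 + θ 3 - (m * θ₀ 2 + θ₀ 3)) - (θ 3 - θ₀ 3) := by ring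
    rw [e]
    refine (abs_sub _ _).trans ((add_le_add b3 b4).trans ?_)
    rw [← mul_add]
    refine mul_le_mul_of_nonneg_left ?_ hε.le
    linarith [a3 hm']
  · exact key (c := 1) 3 (θ₀ 3) le_rfl (by linarith) (by simpa using b4)

lemma thetaBox_subset_nearTheta (hg : 0 < g) (hh : 0 < h) (hm : 0 < m) (hθ₀ : ∀ l, 0 < θ₀ l)
    (hε : 0 < ε) (hε' : ∀ l, 2 * ε * ∑ l, θ₀ l ≤ θ₀ l / 2) :
    thetaBox g h m θ₀ ε ⊆ nearTheta θ₀ := fun θ hθ l => by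
  have := abs_le.1 ((abs_sub_le_of_mem_thetaBox hg hh hm hθ₀ hε hθ l).trans (hε' l))
  constructor <;> linarith [this.1, this.2, hθ₀ l]

lemma isCompact_thetaBox (hg : 0 < g) (hh : 0 < h) (hm : 0 < m) (hθ₀ : ∀ l, 0 < θ₀ l)
    (hε : 0 < ε) : IsCompact (thetaBox g h m θ₀ ε) := by
  refine Metric.isCompact_of_isClosed_isBounded isClosed_thetaBox
    ((Metric.isBounded_iff_subset_closedBall θ₀).2 ⟨2 * ε * ∑ l, θ₀ l, fun θ hθ => ?_⟩)
  rw [Metric.mem_closedBall, dist_pi_le_iff]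
  · exact fun l => abs_sub_le_of_mem_thetaBox hg hh hm hθ₀ hε hθ l
  · exact mul_nonneg (by linarith) (Finset.sum_nonneg fun l _ => (hθ₀ l).le)

end Box

/-! ### The profile criterion on a box -/

section Profile
variable {pa pb pab pw : ℕ} {x : Covariates pa pb pab pw} {g h m : ℕ}

/-- The sums of squares of the true residuals are close to what they estimate. -/
structure IsTypical (x : Covariates pa pb pab pw) (g h m : ℕ) (θ₀ : Fin 4 → ℝ)
    (r : Cell g h m → ℝ) (B : ℝ) : Prop where
  fit : fitNoise x g h m θ₀ r ≤ B
  strata : ∀ k, (r ⬝ᵥ (strat g h m k *ᵥ r) - lam g h m θ₀ k * (strat g h m k).trace) ^ 2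
    ≤ B ^ 2 * (lam g h m θ₀ k ^ 2 * (strat g h m k).trace)

variable (hg : 0 < g) (hh : 0 < h) (hm : 0 < m) (hinj : ∀ v, design x g h m *ᵥ v = 0 → v = 0)
  {θ₀ : Fin 4 → ℝ} (hθ₀ : ∀ l, 0 < θ₀ l)
include hg hh hm hinj hθ₀

/-- At θ₀ the minimal quadratic form is bounded above by that of the true residuals. At θ it is
bounded below, stratum by stratum, by the true sum of squares minus its projection on the fixed
effects, which `fitNoise` controls. What remains in stratum k is a function of w = λ_k(θ₀)/λ_k(θ).
-/
lemma profileCrit_sub_ge {θ : Fin 4 → ℝ} (hθ : θ ∈ nearTheta θ₀)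
    {y : Cell g h m → ℝ} {ξ₀ : FixedIdx pa pb pab pw → ℝ} {B : ℝ} (hB : 0 ≤ B)
    (hr : IsTypical x g h m θ₀ (resid x g h m y ξ₀) B) {c : ℝ} (hc0 : 0 ≤ c) (hc1 : c ≤ 1) :
    ∑ k, ((strat g h m k).trace * (lam g h m θ₀ k / lam g h m θ k - 1) ^ 2 / 12
      - 3 * B ^ 2 - 2 * B) - Fintype.card (FixedIdx pa pb pab pw) * Real.log 2
      ≤ profileCrit x g h m y c θ - profileCrit x g h m y c θ₀ := by
  have hp := nearTheta_pos hθ₀ hθ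
  have hl := fun k => lam_pos (g := g) (h := h) (m := m) hp k
  have hl0 := fun k => lam_pos (g := g) (h := h) (m := m) hθ₀ k
  have hE := isResolution_strat hg hh hm
  set r := resid x g h m y ξ₀ with hrdef
  have h1 := log_det_fixedInfo_ge hg hh hm hinj hθ₀ hθ
  have h2 : -(Fintype.card (FixedIdx pa pb pab pw) * Real.log 2)
      ≤ c * Real.log (fixedInfo x g h m θ).det - c * Real.log (fixedInfo x g h m θ₀).det := by
    have hlog : 0 ≤ Fintype.card (FixedIdx pa pb pab pw) * Real.log 2 :=
      mul_nonneg (by positivity) (Real.log_nonneg one_le_two)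
    rw [← mul_sub]
    nlinarith
  have h3 : quadForm x g h m y (gls x g h m y θ₀, θ₀)
      ≤ ∑ k, (lam g h m θ₀ k)⁻¹ * (r ⬝ᵥ (strat g h m k *ᵥ r)) :=
    (quadForm_gls_le hg hh hm hinj y hθ₀ ξ₀).trans_eq (quadForm_eq_sum hg hh hm y ξ₀ hθ₀)
  have h4 : ∑ k, (lam g h m θ k)⁻¹ * (r ⬝ᵥ (strat g h m k *ᵥ r)
      - projSq (strat g h m k * design x g h m) r) ≤ quadForm x g h m y (gls x g h m y θ, θ) := by
    rw [quadForm_eq_sum hg hh hm y _ hp]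
    refine Finset.sum_le_sum fun k _ => mul_le_mul_of_nonneg_left ?_ (inv_pos.2 (hl k)).le
    have e : resid x g h m y (gls x g h m y θ) = r - design x g h m *ᵥ (gls x g h m y θ - ξ₀) := by
      rw [hrdef, resid, resid, mulVec_sub]
      abel
    rw [stratumSS, e]
    exact hE.sub_projSq_le _ k r _
  have h5 : ∀ k, (strat g h m k).trace * (lam g h m θ₀ k / lam g h m θ k - 1) ^ 2 / 12
      - 3 * B ^ 2 - 2 * B ≤ (strat g h m k).trace * Real.log (lam g h m θ k)
        - (strat g h m k).trace * Real.log (lam g h m θ₀ k)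
        + (lam g h m θ k)⁻¹ * (r ⬝ᵥ (strat g h m k *ᵥ r)
          - projSq (strat g h m k * design x g h m) r)
        - (lam g h m θ₀ k)⁻¹ * (r ⬝ᵥ (strat g h m k *ᵥ r)) := by
    intro k
    have hn := lam_near hθ g h m k
    have hN : (lam g h m θ₀ k)⁻¹ * projSq (strat g h m k * design x g h m) r ≤ B :=
      (Finset.single_le_sum (f := fun k => (lam g h m θ₀ k)⁻¹ *
        projSq (strat g h m k * design x g h m) r) (fun k _ => mul_nonneg (inv_pos.2 (hl0 k)).le
          (projSq_nonneg _ _)) (Finset.mem_univ k)).trans hr.fit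
    have htr : 0 ≤ (strat g h m k).trace := by
      have : (strat g h m k).trace = ∑ i, strat g h m k i ⬝ᵥ strat g h m k i := by
        conv_lhs => rw [← hE.idem k]
        rw [trace]
        refine Finset.sum_congr rfl fun i _ => ?_
        rw [diag_apply, mul_apply]
        refine Finset.sum_congr rfl fun j _ => ?_
        rw [← congrFun (congrFun (hE.symm k) j) i, transpose_apply]
      rw [this]
      exact Finset.sum_nonneg fun i _ => Finset.sum_nonneg fun j _ => mul_self_nonneg _
    have hq : ((lam g h m θ₀ k)⁻¹ * (r ⬝ᵥ (strat g h m k *ᵥ r)) - (strat g h m k).trace) ^ 2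
        ≤ B ^ 2 * (strat g h m k).trace := by
      have e : (lam g h m θ₀ k)⁻¹ * (r ⬝ᵥ (strat g h m k *ᵥ r)) - (strat g h m k).trace
          = (r ⬝ᵥ (strat g h m k *ᵥ r) - lam g h m θ₀ k * (strat g h m k).trace)
            / lam g h m θ₀ k := by
        field_simp [(hl0 k).ne']
      rw [e, div_pow, div_le_iff₀ (pow_pos (hl0 k) 2)]
      exact (hr.strata k).trans_eq (by ring)
    have hw : 1 / 2 ≤ lam g h m θ₀ k / lam g h m θ k := by
      rw [div_le_div_iff₀ two_pos (hl k)]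
      linarith [hn.2]
    have hw2 : lam g h m θ₀ k / lam g h m θ k ≤ 2 := by
      rw [div_le_iff₀ (hl k)]
      linarith [hn.1]
    refine (stratum_contribution_ge hw hw2 htr hB hq hN).trans_eq ?_
    rw [Real.log_div (hl0 k).ne' (hl k).ne']
    field_simp [(hl0 k).ne', (hl k).ne']
    ring
  have h6 := Finset.sum_le_sum fun k (_ : k ∈ Finset.univ) => h5 k
  simp only [Finset.sum_add_distrib, Finset.sum_sub_distrib] at h6 ⊢
  simp only [profileCrit]
  rw [log_det_V hg hh hm hp, log_det_V hg hh hm hθ₀]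
  linarith

/-- A local minimum of the profile criterion near the true variance components. -/
lemma exists_isLocalMin_profileCrit {ε : ℝ} (hε : 0 < ε) (hε' : ∀ l, 2 * ε * ∑ l, θ₀ l ≤ θ₀ l / 2)
    {y : Cell g h m → ℝ} {ξ₀ : FixedIdx pa pb pab pw → ℝ} {B : ℝ} (hB : 0 ≤ B)
    (hr : IsTypical x g h m θ₀ (resid x g h m y ξ₀) B)
    (hn : ∀ k : Fin 5, k ≠ 0 → 5 * (3 * B ^ 2 + 2 * B) + Fintype.card (FixedIdx pa pb pab pw) *
      Real.log 2 < (strat g h m k).trace * (ε ^ 2 / 48))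
    {c : ℝ} (hc0 : 0 ≤ c) (hc1 : c ≤ 1) :
    ∃ θ ∈ thetaBox g h m θ₀ ε, IsLocalMin (profileCrit x g h m y c) θ := by
  have hsub := thetaBox_subset_nearTheta hg hh hm hθ₀ hε hε'
  have hl0 := fun k => lam_pos (g := g) (h := h) (m := m) hθ₀ k
  have h0 : θ₀ ∈ thetaBox g h m θ₀ ε := fun k _ => by
    rw [sub_self, abs_zero]
    exact mul_nonneg hε.le (hl0 k).le
  obtain ⟨θ, hθ, hmin⟩ := (isCompact_thetaBox hg hh hm hθ₀ hε).exists_isMinOn ⟨θ₀, h0⟩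
    (f := profileCrit x g h m y c) fun θ hθ => (differentiableAt_profileCrit hg hh hm
      (nearTheta_pos hθ₀ (hsub hθ)) hinj y c).continuousAt.continuousWithinAt
  have hlpos := fun k => lam_pos (g := g) (h := h) (m := m) (nearTheta_pos hθ₀ (hsub hθ)) k
  have hB' : 0 ≤ 3 * B ^ 2 + 2 * B := by positivity
  have htr : ∀ k, 0 ≤ (strat g h m k).trace * (lam g h m θ₀ k / lam g h m θ k - 1) ^ 2 / 12 := by
    intro k
    refine div_nonneg (mul_nonneg ?_ (sq_nonneg _)) (by norm_num)
    by_cases hk : k = 0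
    · subst hk
      have := congrFun (trace_strat hg hh hm) 0
      simp only [cons_val] at this
      rw [this]
      exact zero_le_one
    · have hlog : 0 ≤ Fintype.card (FixedIdx pa pb pab pw) * Real.log 2 :=
        mul_nonneg (by positivity) (Real.log_nonneg one_le_two)
      have := hn k hk
      by_contra! hneg
      nlinarith [sq_nonneg ε, mul_neg_of_neg_of_pos hneg (by positivity : 0 < ε ^ 2 / 48)]
  -- On a face of the box |λ_k(θ₀)/λ_k(θ) - 1| ≥ ε/2, so that stratum alone contributes at least n_k
  -- ε²/48. This exceeds the total of the error terms of the five strata and of the REML correction,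
  -- so the criterion would be larger at the minimiser than at θ₀.
  have hstrict : ∀ k : Fin 5, k ≠ 0 → |lam g h m θ k - lam g h m θ₀ k| < ε * lam g h m θ₀ k := by
    intro k hk
    refine (hθ k hk).lt_of_ne fun he => ?_
    have h1 := profileCrit_sub_ge hg hh hm hinj hθ₀ (hsub hθ) hB hr hc0 hc1
    have h2 := hmin h0
    have h3 : ε ^ 2 / 4 ≤ (lam g h m θ₀ k / lam g h m θ k - 1) ^ 2 := by
      have e : |lam g h m θ₀ k / lam g h m θ k - 1| = ε * lam g h m θ₀ k / lam g h m θ k := by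
        rw [div_sub_one (hlpos k).ne', abs_div, abs_of_pos (hlpos k), abs_sub_comm, he]
      have h4 : ε / 2 ≤ |lam g h m θ₀ k / lam g h m θ k - 1| := by
        rw [e, le_div_iff₀ (hlpos k)]
        nlinarith [(lam_near (hsub hθ) g h m k).2]
      rw [← sq_abs (_ - 1)]
      nlinarith
    have h5 : (strat g h m k).trace * (ε ^ 2 / 48)
        ≤ ∑ k, (strat g h m k).trace * (lam g h m θ₀ k / lam g h m θ k - 1) ^ 2 / 12 := by
      refine le_trans ?_ (Finset.single_le_sum (fun k _ => htr k) (Finset.mem_univ k))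
      have h6 : 0 ≤ (strat g h m k).trace := by
        by_contra! hneg
        have hlog : 0 ≤ Fintype.card (FixedIdx pa pb pab pw) * Real.log 2 :=
          mul_nonneg (by positivity) (Real.log_nonneg one_le_two)
        linarith [hn k hk, mul_neg_of_neg_of_pos hneg (by positivity : 0 < ε ^ 2 / 48)]
      linarith [mul_le_mul_of_nonneg_left h3 h6]
    simp only [Finset.sum_sub_distrib, Finset.sum_const, Finset.card_univ, Fintype.card_fin,
      nsmul_eq_mul, Nat.cast_ofNat] at h1
    have h7 := hn k hk
    have h8 : profileCrit x g h m y c θ ≤ profileCrit x g h m y c θ₀ := h2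
    linarith
  refine ⟨θ, hθ, ?_⟩
  have hnhds : ∀ᶠ θ' in 𝓝 θ, θ' ∈ thetaBox g h m θ₀ ε := by
    refine eventually_all.2 fun k => ?_
    by_cases hk : k = 0
    · exact Eventually.of_forall fun _ h => absurd hk h
    · have hcont : ContinuousAt (fun θ => |lam g h m θ k - lam g h m θ₀ k|) θ :=
        ((differentiable_lam g h m k).continuous.sub continuous_const).abs.continuousAt
      filter_upwards [hcont.eventually_lt_const (hstrict k hk)] with θ' h _ using h.le
  filter_upwards [hnhds] with θ' h using hmin h

end Profile
end CrossedModel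
end

open Filter Topology MeasureTheory ProbabilityTheory
noncomputable section
namespace CrossedModel
open Matrix

/-! ### Consistency of the fixed effects -/

section SmallEffects
variable {pa pb pab pw : ℕ} {x : Covariates pa pb pab pw} {g h m : ℕ → ℕ}

lemma abs_le_of_rate {N z D : ℝ} (hN : 0 < N) (hz : N * z ^ 2 ≤ D) : |z| ≤ √D * (1 / √N) := by
  rw [mul_one_div, le_div_iff₀ (Real.sqrt_pos.2 hN)]
  refine Real.le_sqrt_of_sq_le ?_
  rw [mul_pow, sq_abs, Real.sq_sqrt hN.le]
  linarith

lemma abs_dotProduct_le {ι : Type*} [Fintype ι] {v z : ι → ℝ} {a b : ι → ℝ} (hv : ∀ l, |v l| ≤ a l)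
    (hz : ∀ l, |z l| ≤ b l) : |v ⬝ᵥ z| ≤ ∑ l, a l * b l := by
  refine (Finset.abs_sum_le_sum_abs _ _).trans (Finset.sum_le_sum fun l _ => ?_)
  rw [abs_mul]
  exact mul_le_mul (hv l) (hz l) (abs_nonneg _) ((abs_nonneg _).trans (hv l))

variable (hx : CovariateCondition x) (hg : Tendsto g atTop atTop) (hh : Tendsto h atTop atTop)
  (hm : Tendsto m atTop atTop)
include hx hg hh hm

/-- Fixed effects that satisfy the bounds on their rates are small. -/
lemma CovariateCondition.eventually_small (D : ℝ) {η : ℝ} (hη : 0 < η) :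
    ∀ᶠ t in atTop, ∀ ζ : FixedIdx pa pb pab pw → ℝ,
      (∀ l, g t * slopeA ζ l ^ 2 ≤ D) → (∀ l, h t * slopeB ζ l ^ 2 ≤ D) →
      (∀ l, g t * h t * slopeAB ζ l ^ 2 ≤ D) → (∀ l, g t * h t * m t * slopeW ζ l ^ 2 ≤ D) →
      g t * h t * grandMean (g t) (h t) (m t) (fixedTable x ζ) ^ 2 ≤ D * (g t + h t) →
      ∀ a, |ζ a| ≤ η := by
  obtain ⟨K, hK, hgb⟩ := hx.grand_bound
  obtain ⟨s0, hs0⟩ := eventually_atTop.1 hgb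
  have hw := (tendsto_sizes hg hh hm).eventually hgb
  -- The mean of the interaction covariate does not depend on m, so the bound is taken at a frozen
  -- m. A factor √m could not be compensated here, since the interaction slopes have no m in their
  -- rate.
  have hab : ∀ᶠ t in atTop, ∀ l, |x.abAll (g t) (h t) l|
      ≤ K * (lg (g t) + lg (h t) + √(s0.2.2 : ℝ)) := by
    filter_upwards [hg.eventually_ge_atTop s0.1, hh.eventually_ge_atTop s0.2.1] with t h1 h2
    exact (hs0 (g t, h t, s0.2.2) ⟨h1, h2, le_rfl⟩).1
  have ig := tendsto_one_div_sqrt hg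
  have ih := tendsto_one_div_sqrt hh
  have im := tendsto_one_div_sqrt hm
  have lG := tendsto_lg_div_sqrt.comp hg
  have lH := tendsto_lg_div_sqrt.comp hh
  obtain ⟨a, ha⟩ := hx.mean_a
  obtain ⟨b, hb⟩ := hx.mean_b
  have t1 : Tendsto (fun t => √D * (1 / √(g t : ℝ))) atTop (𝓝 0) := by simpa using ig.const_mul √D
  have t2 : Tendsto (fun t => √D * (1 / √(h t : ℝ))) atTop (𝓝 0) := by simpa using ih.const_mul √D
  have t3 : Tendsto (fun t => √D * (1 / √(g t * h t : ℝ))) atTop (𝓝 0) := by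
    have := t1.mul ih
    rw [zero_mul] at this
    refine this.congr fun t => ?_
    rw [Real.sqrt_mul (by positivity)]
    ring
  have t4 : Tendsto (fun t => √D * (1 / √(g t * h t * m t : ℝ))) atTop (𝓝 0) := by
    have := t3.mul im
    rw [zero_mul] at this
    refine this.congr fun t => ?_
    rw [Real.sqrt_mul (by positivity) (m t : ℝ)]
    ring
  have u0 : Tendsto (fun t => √D * (1 / √(g t : ℝ)) + √D * (1 / √(h t : ℝ))) atTop (𝓝 0) := by
    simpa using t1.add t2
  have u1 : Tendsto (fun t => ∑ l, |avg (g t) x.a l| * (√D * (1 / √(g t : ℝ)))) atTop (𝓝 0) := by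
    rw [← Finset.sum_const_zero]
    refine tendsto_finsetSum _ fun l _ => ?_
    simpa using ((tendsto_pi_nhds.1 (ha.comp hg) l).abs).mul t1
  have u2 : Tendsto (fun t => ∑ l, |avg (h t) x.b l| * (√D * (1 / √(h t : ℝ)))) atTop (𝓝 0) := by
    rw [← Finset.sum_const_zero]
    refine tendsto_finsetSum _ fun l _ => ?_
    simpa using ((tendsto_pi_nhds.1 (hb.comp hh) l).abs).mul t2
  have u3 : Tendsto (fun t => ∑ _l : Fin pab, K * (lg (g t) + lg (h t) + √(s0.2.2 : ℝ))
      * (√D * (1 / √(g t * h t : ℝ)))) atTop (𝓝 0) := by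
    rw [← Finset.sum_const_zero]
    refine tendsto_finsetSum _ fun l _ => ?_
    have := ((((lG.mul ih).add (ig.mul lH)).add ((ig.mul ih).const_mul √(s0.2.2 : ℝ))).const_mul
      (K * √D))
    simp only [mul_zero, add_zero] at this
    refine this.congr fun t => ?_
    rw [Real.sqrt_mul (by positivity)]
    simp only [Function.comp_apply, div_eq_mul_inv, mul_inv]
    ring
  have u4 : Tendsto (fun t => ∑ _l : Fin pw, K * (lg (g t) + lg (h t) + √(m t : ℝ))
      * (√D * (1 / √(g t * h t * m t : ℝ)))) atTop (𝓝 0) := by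
    rw [← Finset.sum_const_zero]
    refine tendsto_finsetSum _ fun l _ => ?_
    have := (((((lG.mul ih).add (ig.mul lH)).mul im).add (ig.mul ih)).const_mul (K * √D))
    simp only [mul_zero, add_zero] at this
    refine this.congr' ?_
    filter_upwards [eventually_pos_of_tendsto hm] with t ht
    have hs : √(m t : ℝ) ≠ 0 := (Real.sqrt_pos.2 (by exact_mod_cast ht)).ne'
    rw [Real.sqrt_mul (by positivity), Real.sqrt_mul (by positivity)]
    simp only [Function.comp_apply, div_eq_mul_inv, mul_inv]
    field_simp
  have hsum := ((((u0.add u1).add u2).add u3).add u4)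
  simp only [add_zero] at hsum
  filter_upwards [hab, hw, eventually_pos_of_tendsto hg, eventually_pos_of_tendsto hh,
    eventually_pos_of_tendsto hm, t1.eventually_le_const hη, t2.eventually_le_const hη,
    t3.eventually_le_const hη, t4.eventually_le_const hη, hsum.eventually_le_const hη]
    with t hab hw hg hh hm e1 e2 e3 e4 e5 ζ r1 r2 r3 r4 r5
  have hg' : (0 : ℝ) < g t := by exact_mod_cast hg
  have hh' : (0 : ℝ) < h t := by exact_mod_cast hh
  have hm' : (0 : ℝ) < m t := by exact_mod_cast hm
  have s1 := fun l => abs_le_of_rate hg' (r1 l)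
  have s2 := fun l => abs_le_of_rate hh' (r2 l)
  have s3 := fun l => abs_le_of_rate (mul_pos hg' hh') (r3 l)
  have s4 := fun l => abs_le_of_rate (mul_pos (mul_pos hg' hh') hm') (r4 l)
  have s0 : |grandMean (g t) (h t) (m t) (fixedTable x ζ)|
      ≤ √D * (1 / √(g t : ℝ)) + √D * (1 / √(h t : ℝ)) := by
    rw [← mul_add]
    have hD : 0 ≤ D := by
      have : 0 ≤ D * (g t + h t : ℝ) := le_trans (by positivity) r5
      exact nonneg_of_mul_nonneg_left this (by positivity)
    refine abs_le_of_sq_le_sq ?_ (by positivity)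
    rw [mul_pow, Real.sq_sqrt hD]
    have h2 : (1 / √(g t : ℝ)) ^ 2 + (1 / √(h t : ℝ)) ^ 2 ≤ (1 / √(g t : ℝ) + 1 / √(h t : ℝ)) ^ 2 := by
      have : 0 ≤ 1 / √(g t : ℝ) * (1 / √(h t : ℝ)) := by positivity
      linarith [add_sq (1 / √(g t : ℝ)) (1 / √(h t : ℝ))]
    refine le_trans ?_ (mul_le_mul_of_nonneg_left h2 hD)
    rw [div_pow, div_pow, Real.sq_sqrt hg'.le, Real.sq_sqrt hh'.le, one_pow,
      div_add_div _ _ hg'.ne' hh'.ne', mul_div_assoc', le_div_iff₀ (by positivity)]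
    linarith
  -- The intercept is the grand mean of the fitted table minus the products of slopes with mean
  -- covariates, each of which is small.
  have hmean := grandMean_fixedTable x ζ hg hh hm
  have d1 := abs_dotProduct_le (fun l => le_refl |avg (g t) x.a l|) s1
  have d2 := abs_dotProduct_le (fun l => le_refl |avg (h t) x.b l|) s2
  have d3 := abs_dotProduct_le hab s3
  have d4 := abs_dotProduct_le hw.2 s4
  rintro (a | l | l | l | l)
  · rw [abs_le] at s0 d1 d2 d3 d4 ⊢
    constructor <;> linarith [s0.1, s0.2, d1.1, d1.2, d2.1, d2.2, d3.1, d3.2, d4.1, d4.2]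
  · exact (s1 l).trans e1
  · exact (s2 l).trans e2
  · exact (s3 l).trans e3
  · exact (s4 l).trans e4

variable {θ₀ : Fin 4 → ℝ} (hθ₀ : ∀ l, 0 < θ₀ l)
include hθ₀

/-- The design matrix eventually has full column rank, and score equations have small solutions. -/
lemma CovariateCondition.eventually_design (B : ℝ) {η : ℝ} (hη : 0 < η) :
    ∀ᶠ t in atTop, (∀ v, design x (g t) (h t) (m t) *ᵥ v = 0 → v = 0) ∧
      ∀ θ ∈ nearTheta θ₀, ∀ r ζ, fitNoise x (g t) (h t) (m t) θ₀ r ≤ B →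
        IsScoreZero x (g t) (h t) (m t) θ (r - design x (g t) (h t) (m t) *ᵥ ζ) →
        ∀ a, |ζ a| ≤ η := by
  obtain ⟨C, hC, hr⟩ := hx.exists_rates hθ₀
  filter_upwards [(tendsto_sizes hg hh hm).eventually hr, hx.eventually_small hg hh hm (C * B) hη,
    hx.eventually_small hg hh hm 0 one_pos] with t hr hs hs0
  have hθ₀' : θ₀ ∈ nearTheta θ₀ := fun l => by constructor <;> linarith [hθ₀ l]
  refine ⟨fun v hv => ?_, fun θ hθ r ζ hB hsc => ?_⟩
  · have hfit : fitNoise x (g t) (h t) (m t) θ₀ 0 = 0 := by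
      simp [fitNoise, projSq]
    -- If X v = 0, every multiple n v solves the score equation with zero noise. All these multiples
    -- then obey the same bound, which forces v = 0.
    have key : ∀ n : ℕ, ∀ a, |(n : ℝ) * v a| ≤ 1 := by
      intro n
      have := hr θ₀ hθ₀' 0 ((n : ℝ) • v) (fun w => by
        rw [mulVec_smul, hv]
        simp)
      simp only [hfit, mul_zero, zero_mul] at this
      obtain ⟨r1, r2, r3, r4, r5⟩ := this
      exact hs0 ((n : ℝ) • v) r1 r2 r3 r4 (r5.trans_eq (by ring))
    funext a
    by_contra hne
    obtain ⟨n, hn⟩ := exists_nat_gt (1 / |v a|)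
    have h1 := key n a
    have h2 : 0 < |v a| := abs_pos.2 hne
    rw [div_lt_iff₀ h2] at hn
    rw [abs_mul, Nat.abs_cast] at h1
    linarith
  · obtain ⟨r1, r2, r3, r4, r5⟩ := hr θ hθ r ζ hsc
    have hCB := mul_le_mul_of_nonneg_left hB hC
    exact hs ζ (fun l => (r1 l).trans hCB) (fun l => (r2 l).trans hCB) (fun l => (r3 l).trans hCB)
      (fun l => (r4 l).trans hCB) (r5.trans (mul_le_mul_of_nonneg_right hCB (by positivity)))

/-- On typical data the profile criteria have local minima close to the true parameter. -/
theorem CovariateCondition.eventually_exists_isLocalMin {B : ℝ} (hB : 0 ≤ B) {η : ℝ} (hη : 0 < η) :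
    ∀ᶠ t in atTop, (0 < g t ∧ 0 < h t ∧ 0 < m t) ∧
      (∀ v, design x (g t) (h t) (m t) *ᵥ v = 0 → v = 0) ∧
      ∀ y ξ₀, IsTypical x (g t) (h t) (m t) θ₀ (resid x (g t) (h t) (m t) y ξ₀) B →
        ∀ c : ℝ, 0 ≤ c → c ≤ 1 → ∃ θ, (∀ l, 0 < θ l) ∧
          IsLocalMin (profileCrit x (g t) (h t) (m t) y c) θ ∧
          dist (gls x (g t) (h t) (m t) y θ, θ) (ξ₀, θ₀) ≤ η := by
  have hS : 0 < ∑ l, θ₀ l := Finset.sum_pos (fun l _ => hθ₀ l) Finset.univ_nonempty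
  obtain ⟨ε, hε, hε1, hε2⟩ : ∃ ε : ℝ, 0 < ε ∧ (∀ l, 2 * ε * ∑ l, θ₀ l ≤ θ₀ l / 2) ∧
      2 * ε * ∑ l, θ₀ l ≤ η := by
    obtain ⟨l0, hl0⟩ := Finite.exists_min θ₀
    refine ⟨min (θ₀ l0 / 2) η / (2 * ∑ l, θ₀ l), ?_, fun l => ?_, ?_⟩
    · have := hθ₀ l0
      positivity
    · rw [mul_right_comm, mul_div_cancel₀ _ (by positivity)]
      exact (min_le_left _ _).trans (by linarith [hl0 l])
    · rw [mul_right_comm, mul_div_cancel₀ _ (by positivity)]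
      exact min_le_right _ _
  set M := (5 * (3 * B ^ 2 + 2 * B) + Fintype.card (FixedIdx pa pb pab pw) * Real.log 2)
    / (ε ^ 2 / 48) with hM
  obtain ⟨n0, hn0⟩ := exists_nat_gt M
  filter_upwards [hx.eventually_design hg hh hm hθ₀ B hη, hg.eventually_ge_atTop (n0 + 2),
    hh.eventually_ge_atTop (n0 + 2), hm.eventually_ge_atTop (n0 + 2)] with t hd hgt hht hmt
  have hg0 : 0 < g t := by omega
  have hh0 : 0 < h t := by omega
  have hm0 : 0 < m t := by omega
  refine ⟨⟨hg0, hh0, hm0⟩, hd.1, fun y ξ₀ hty c hc0 hc1 => ?_⟩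
  have hn : ∀ k : Fin 5, k ≠ 0 → M < (strat (g t) (h t) (m t) k).trace := by
    intro k hk
    have e := congrFun (trace_strat hg0 hh0 hm0) k
    rw [e]
    have a1 : (n0 : ℝ) + 2 ≤ g t := by exact_mod_cast hgt
    have a2 : (n0 : ℝ) + 2 ≤ h t := by exact_mod_cast hht
    have a3 : (n0 : ℝ) + 2 ≤ m t := by exact_mod_cast hmt
    have a0 : (0 : ℝ) ≤ n0 := by positivity
    refine hn0.trans_le ?_
    fin_cases k
    · exact absurd rfl hk
    · simp only [Fin.mk_one, cons_val]
      linarith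
    · simp only [Fin.reduceFinMk, cons_val]
      linarith
    · simp only [Fin.reduceFinMk, cons_val]
      nlinarith
    · simp only [Fin.reduceFinMk, cons_val]
      have : (1 : ℝ) ≤ g t * h t := by nlinarith
      nlinarith
  obtain ⟨θ, hθ, hmin⟩ := exists_isLocalMin_profileCrit hg0 hh0 hm0 hd.1 hθ₀ hε hε1 hB hty
    (fun k hk => by
      have := hn k hk
      rwa [hM, div_lt_iff₀ (by positivity)] at this) hc0 hc1
  have hnear := thetaBox_subset_nearTheta hg0 hh0 hm0 hθ₀ hε hε1 hθ
  have hpos := nearTheta_pos hθ₀ hnear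
  refine ⟨θ, hpos, hmin, ?_⟩
  have hsc := isScoreZero_gls hg0 hh0 hm0 hd.1 y hpos
  have e : resid x (g t) (h t) (m t) y (gls x (g t) (h t) (m t) y θ)
      = resid x (g t) (h t) (m t) y ξ₀
        - design x (g t) (h t) (m t) *ᵥ (gls x (g t) (h t) (m t) y θ - ξ₀) := by
    rw [resid, resid, mulVec_sub]
    abel
  rw [e] at hsc
  rw [Prod.dist_eq]
  refine max_le ((dist_pi_le_iff hη.le).2 fun a => ?_) ((dist_pi_le_iff hη.le).2 fun l => ?_)
  · exact hd.2 θ hnear _ _ hty.fit hsc a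
  · exact (abs_sub_le_of_mem_thetaBox hg0 hh0 hm0 hθ₀ hε hθ l).trans hε2

end SmallEffects
end CrossedModel
end

open Filter Topology MeasureTheory ProbabilityTheory
noncomputable section
namespace CrossedModel
open Matrix

lemma trace_strat_pos {g h m : ℕ} (hg : 2 ≤ g) (hh : 2 ≤ h) (hm : 2 ≤ m) (k : Fin 5) :
    0 < (strat g h m k).trace := by
  have e := congrFun (trace_strat (g := g) (h := h) (m := m) (by omega) (by omega) (by omega)) k
  rw [e]
  have a1 : (2 : ℝ) ≤ g := by exact_mod_cast hg
  have a2 : (2 : ℝ) ≤ h := by exact_mod_cast hh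
  have a3 : (2 : ℝ) ≤ m := by exact_mod_cast hm
  have b1 : (0 : ℝ) < g - 1 := by linarith
  have b2 : (0 : ℝ) < h - 1 := by linarith
  have b3 : (0 : ℝ) < m - 1 := by linarith
  fin_cases k <;> simp only [Fin.zero_eta, Fin.mk_one, Fin.reduceFinMk, cons_val] <;> positivity

/-! ### Existence of consistent solutions -/

section Existence
variable {Ω : Type*} [MeasurableSpace Ω] {P : Measure Ω} [IsProbabilityMeasure P]
  {pa pb pab pw : ℕ} {x : Covariates pa pb pab pw} {u : RandomTerms Ω} {ω₀ : Param pa pb pab pw}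
  {g h m : ℕ → ℕ}

/-- At an interior point all four components can be lowered by a common r > 0 without leaving the
parameter space. -/
lemma pos_of_mem_interior_parameterSpace (hω₀ : ω₀ ∈ interior (parameterSpace pa pb pab pw))
    (l : Fin 4) : 0 < ω₀.2 l := by
  have hc : Continuous fun r : ℝ => ((ω₀.1, fun l => ω₀.2 l - r) : Param pa pb pab pw) := by
    fun_prop
  have h1 : ∀ᶠ r : ℝ in 𝓝 0, ((ω₀.1, fun l => ω₀.2 l - r) : Param pa pb pab pw)
      ∈ parameterSpace pa pb pab pw := by
    refine hc.continuousAt.eventually (mem_interior_iff_mem_nhds.1 ?_)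
    simpa using hω₀
  obtain ⟨r, hr, hr0⟩ := ((h1.filter_mono nhdsWithin_le_nhds).and
    (self_mem_nhdsWithin : Set.Ioi (0 : ℝ) ∈ 𝓝[>] 0)).exists
  have hr0' : 0 < r := hr0
  obtain ⟨a0, a1, a2, a3⟩ := hr
  simp only at a0 a1 a2 a3
  fin_cases l <;> simp only [Fin.zero_eta, Fin.mk_one, Fin.reduceFinMk] <;> linarith

omit [IsProbabilityMeasure P] in
/-- Estimates within any prescribed distance of the true parameter yield a consistent sequence. -/
lemma exists_consistentSolution
    {Solves : ∀ g h m : ℕ, (Cell g h m → ℝ) → Param pa pb pab pw → Prop}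
    (H : ∀ η : ℝ, 0 < η → ∀ᶠ q in whp P, ∃ ω, Solves (g q.1) (h q.1) (m q.1)
      (response x (g q.1) (h q.1) (m q.1) ω₀.1 u q.2) ω ∧ dist ω ω₀ ≤ η) :
    ∃ est, ConsistentSolution P x u ω₀ g h m Solves est := by
  -- For each data set a solution is chosen whose distance to ω₀ is minimal up to 1/(t + 1), as the
  -- infimum need not be attained. One such sequence serves every η, so no diagonal argument is
  -- required.
  have hnear : ∀ (t : ℕ) (y : Cell (g t) (h t) (m t) → ℝ), ∃ ω : Param pa pb pab pw,
      ∀ ω', Solves (g t) (h t) (m t) y ω' →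
        Solves (g t) (h t) (m t) y ω ∧ dist ω ω₀ ≤ dist ω' ω₀ + 1 / (t + 1) := by
    intro t y
    by_cases hs : ∃ ω', Solves (g t) (h t) (m t) y ω'
    · obtain ⟨ω, hω, hd⟩ := (Metric.infDist_lt_iff (s := {ω | Solves (g t) (h t) (m t) y ω}) hs).1
        (lt_add_of_pos_right (Metric.infDist ω₀ {ω | Solves (g t) (h t) (m t) y ω})
          (by positivity : (0 : ℝ) < 1 / (t + 1)))
      refine ⟨ω, fun ω' hω' => ⟨hω, ?_⟩⟩
      rw [dist_comm ω, dist_comm ω']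
      have : Metric.infDist ω₀ {ω | Solves (g t) (h t) (m t) y ω} ≤ dist ω₀ ω' :=
        Metric.infDist_le_dist_of_mem hω'
      linarith
    · exact ⟨ω₀, fun ω' hω' => absurd ⟨ω', hω'⟩ hs⟩
  choose est hest using hnear
  have hS : ∀ᶠ q in whp P, Solves (g q.1) (h q.1) (m q.1)
      (response x (g q.1) (h q.1) (m q.1) ω₀.1 u q.2)
      (est q.1 (response x (g q.1) (h q.1) (m q.1) ω₀.1 u q.2)) := by
    filter_upwards [H 1 one_pos] with q hq
    obtain ⟨ω, hω, -⟩ := hq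
    exact (hest _ _ ω hω).1
  refine ⟨est, eventually_whp.1 hS, ?_⟩
  rw [tendstoInMeasure_iff_dist]
  intro ε hε
  have h1 : ∀ᶠ q : ℕ × Ω in whp P,
      ¬ ε ≤ dist (est q.1 (response x (g q.1) (h q.1) (m q.1) ω₀.1 u q.2)) ω₀ := by
    have h2 : ∀ᶠ t : ℕ in atTop, (1 : ℝ) / (t + 1) < ε / 2 :=
      tendsto_one_div_add_atTop_nhds_zero_nat.eventually_lt_const (half_pos hε)
    filter_upwards [H (ε / 2) (half_pos hε), tendsto_fst_whp.eventually h2] with q hq hq2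
    obtain ⟨ω, hω, hd⟩ := hq
    have := (hest _ _ ω hω).2
    linarith
  simpa using eventually_whp.1 h1

variable (hx : CovariateCondition x) (hu : RandomTermsCondition P u ω₀.2) (hθ₀ : ∀ l, 0 < ω₀.2 l)
  (hg : Tendsto g atTop atTop) (hh : Tendsto h atTop atTop) (hm : Tendsto m atTop atTop)

include hu hθ₀ hg hh hm in
/-- The relative errors of the sums of squares are stochastically bounded. -/
lemma RandomTermsCondition.tight_strata :
    Tight P fun q => ∑ k, (toCell (g q.1) (h q.1) (m q.1) (noise u q.2)
      ⬝ᵥ (strat (g q.1) (h q.1) (m q.1) k *ᵥ toCell (g q.1) (h q.1) (m q.1) (noise u q.2))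
      - lam (g q.1) (h q.1) (m q.1) ω₀.2 k * (strat (g q.1) (h q.1) (m q.1) k).trace) ^ 2
      / (lam (g q.1) (h q.1) (m q.1) ω₀.2 k ^ 2 * (strat (g q.1) (h q.1) (m q.1) k).trace) := by
  obtain ⟨κ, hκ, hw⟩ := hu.exists_indepTerms hθ₀
  refine tight_of_integral_le (∑ _k : Fin 5, (κ + 2)) ?_
  -- With all sizes at least 2 every stratum has positive dimension, so dividing by its trace is
  -- legitimate.
  filter_upwards [hg.eventually_ge_atTop 2, hh.eventually_ge_atTop 2,
    hm.eventually_ge_atTop 2] with t hg2 hh2 hm2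
  have hg : 0 < g t := by omega
  have hh : 0 < h t := by omega
  have hm : 0 < m t := by omega
  have hl := fun k => lam_pos (g := g t) (h := h t) (m := m t) hθ₀ k
  have htr := trace_strat_pos hg2 hh2 hm2
  have hk := fun k => (hw.precomp (termIndex_injective (g t) (h t) (m t))).integral_stratum_sq_le
    (isResolution_strat hg hh hm)
    ((randomDesign_covariance (g t) (h t) (m t) ω₀.2).trans (V_eq_sum hg hh hm ω₀.2)) hκ k
  simp only [randomDesign_mulVec] at hk
  have hpos := fun k => mul_pos (pow_pos (hl k) 2) (htr k)
  refine ⟨Eventually.of_forall fun s => Finset.sum_nonneg fun k _ =>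
    div_nonneg (sq_nonneg _) (hpos k).le,
    integrable_finsetSum _ fun k _ => (hk k).1.div_const
      (lam (g t) (h t) (m t) ω₀.2 k ^ 2 * (strat (g t) (h t) (m t) k).trace), ?_⟩
  rw [integral_finsetSum _ fun k _ => (hk k).1.div_const
    (lam (g t) (h t) (m t) ω₀.2 k ^ 2 * (strat (g t) (h t) (m t) k).trace)]
  refine Finset.sum_le_sum fun k _ => ?_
  rw [integral_div, div_le_iff₀ (hpos k)]
  exact (hk k).2

include hx hu hθ₀ hg hh hm in
/-- With probability tending to one the profile criteria have local minima close to the true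
parameter. -/
theorem eventually_exists_isLocalMin_profileCrit {η : ℝ} (hη : 0 < η) :
    ∀ᶠ q in whp P, (0 < g q.1 ∧ 0 < h q.1 ∧ 0 < m q.1) ∧
      (∀ v, design x (g q.1) (h q.1) (m q.1) *ᵥ v = 0 → v = 0) ∧
      ∀ y, y = response x (g q.1) (h q.1) (m q.1) ω₀.1 u q.2 →
        ∀ c : ℝ, 0 ≤ c → c ≤ 1 → ∃ θ, (∀ l, 0 < θ l) ∧
          IsLocalMin (profileCrit x (g q.1) (h q.1) (m q.1) y c) θ ∧
          dist (gls x (g q.1) (h q.1) (m q.1) y θ, θ) ω₀ ≤ η := by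
  refine ((hu.tight_fitNoise hθ₀ hg hh hm x).add
    (hu.tight_strata hθ₀ hg hh hm)).eventually_whp fun B => ?_
  -- The constant |B| + 1 meets both requirements of `IsTypical`: it exceeds |B|, and so does its
  -- square.
  filter_upwards [hx.eventually_exists_isLocalMin hg hh hm hθ₀ (B := |B| + 1) (by positivity) hη,
    hg.eventually_ge_atTop 2, hh.eventually_ge_atTop 2,
    hm.eventually_ge_atTop 2] with t ht hg2 hh2 hm2 s hs
  obtain ⟨⟨hg, hh, hm⟩, hinj, hmin⟩ := ht
  refine ⟨⟨hg, hh, hm⟩, hinj, ?_⟩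
  rintro y rfl
  refine hmin _ ω₀.1 ?_
  have e : resid x (g t) (h t) (m t) (response x (g t) (h t) (m t) ω₀.1 u s) ω₀.1
      = toCell (g t) (h t) (m t) (noise u s) := by
    rw [response_sub, sub_self, mulVec_zero, sub_zero]
  rw [e]
  have hl := fun k => lam_pos (g := g t) (h := h t) (m := m t) hθ₀ k
  have htr := trace_strat_pos hg2 hh2 hm2
  have hpos := fun k => mul_pos (pow_pos (hl k) 2) (htr k)
  have n1 : 0 ≤ fitNoise x (g t) (h t) (m t) ω₀.2 (toCell (g t) (h t) (m t) (noise u s)) :=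
    Finset.sum_nonneg fun k _ => mul_nonneg (inv_pos.2 (hl k)).le (projSq_nonneg _ _)
  have hs' := (le_abs_self _).trans (hs.trans (le_abs_self B))
  have n2 : ∀ k, 0 ≤ (toCell (g t) (h t) (m t) (noise u s)
      ⬝ᵥ (strat (g t) (h t) (m t) k *ᵥ toCell (g t) (h t) (m t) (noise u s))
      - lam (g t) (h t) (m t) ω₀.2 k * (strat (g t) (h t) (m t) k).trace) ^ 2
      / (lam (g t) (h t) (m t) ω₀.2 k ^ 2 * (strat (g t) (h t) (m t) k).trace) := fun k =>
    div_nonneg (sq_nonneg _) (hpos k).le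
  refine ⟨?_, fun k => ?_⟩
  · linarith [Finset.sum_nonneg fun k (_ : k ∈ Finset.univ) => n2 k]
  · have h1 := (Finset.single_le_sum (fun k _ => n2 k) (Finset.mem_univ k)).trans
      ((le_add_of_nonneg_left n1).trans hs')
    rw [div_le_iff₀ (hpos k)] at h1
    refine h1.trans (mul_le_mul_of_nonneg_right ?_ (hpos k).le)
    nlinarith [abs_nonneg B]

end Existence
end CrossedModel
end

namespace CrossedModel

/-! ### Consistent solutions and the main theorem -/

section Consistency
variable {Ω : Type*} [MeasurableSpace Ω] {P : Measure Ω} {pa pb pab pw : ℕ}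
  {x : Covariates pa pb pab pw} {u : RandomTerms Ω} {ω₀ : Param pa pb pab pw} {g h m : ℕ → ℕ}

/-- Consistency enters only here: half the smallest true component is a radius that puts the
estimated variance components within a factor two of the true ones. -/
lemma ConsistentSolution.isAdmissible (hθ₀ : ∀ l, 0 < ω₀.2 l)
    {Solves : ∀ g h m : ℕ, (Cell g h m → ℝ) → Param pa pb pab pw → Prop}
    (hS : ∀ g h m y ω, Solves g h m y ω → IsScoreZero x g h m ω.2 (resid x g h m y ω.1))
    {est : ∀ t : ℕ, (Cell (g t) (h t) (m t) → ℝ) → Param pa pb pab pw}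
    (hest : ConsistentSolution P x u ω₀ g h m Solves est) :
    IsAdmissible P x u ω₀ g h m
      (fun q => est q.1 (response x (g q.1) (h q.1) (m q.1) ω₀.1 u q.2)) := by
  obtain ⟨l0, hl0⟩ := Finite.exists_min ω₀.2
  have h1 : ∀ᶠ q in whp P, Solves (g q.1) (h q.1) (m q.1)
      (response x (g q.1) (h q.1) (m q.1) ω₀.1 u q.2)
      (est q.1 (response x (g q.1) (h q.1) (m q.1) ω₀.1 u q.2)) := hest.1
  have h2 : ∀ᶠ q : ℕ × Ω in whp P,
      dist (est q.1 (response x (g q.1) (h q.1) (m q.1) ω₀.1 u q.2)) ω₀ < ω₀.2 l0 / 2 := by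
    refine eventually_whp.2 ?_
    simpa only [not_lt] using tendstoInMeasure_iff_dist.1 hest.2 _ (half_pos (hθ₀ l0))
  filter_upwards [h1, h2] with q hq hd
  refine ⟨hS _ _ _ _ _ hq, fun l => ?_⟩
  have h3 := (dist_le_pi_dist _ _ l).trans ((le_max_right _ _).trans_lt hd).le
  rw [Real.dist_eq] at h3
  have h4 := abs_le.1 (h3.trans (div_le_div_of_nonneg_right (hl0 l) zero_le_two))
  constructor <;> linarith [h4.1, h4.2, hθ₀ l]

end Consistency
end CrossedModel

theorem mainTheorem1 {Ω : Type*} [MeasurableSpace Ω] (P : Measure Ω) [IsProbabilityMeasure P]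
    {pa pb pab pw : ℕ} (x : Covariates pa pb pab pw) (u : RandomTerms Ω)
    (ω₀ : Param pa pb pab pw)
    (hω₀ : ω₀ ∈ interior (parameterSpace pa pb pab pw))
    (hu : RandomTermsCondition P u ω₀.2)
    (hx : CovariateCondition x)
    (D1 : Matrix (Fin pa) (Fin pa) ℝ) (hD1 : Tendsto x.D1hat atTop (𝓝 D1))
    (D2 : Matrix (Fin pb) (Fin pb) ℝ) (hD2 : Tendsto x.D2hat atTop (𝓝 D2))
    (g h m : ℕ → ℕ) (hg : Tendsto g atTop atTop) (hh : Tendsto h atTop atTop)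
    (hm : Tendsto m atTop atTop) :
    (∃ est, ConsistentSolution P x u ω₀ g h m (IsMLSolution x) est) ∧
    (∃ est, ConsistentSolution P x u ω₀ g h m (IsREMLSolution x) est) ∧
    ∀ est : ∀ t : ℕ, (Cell (g t) (h t) (m t) → ℝ) → Param pa pb pab pw,
      (ConsistentSolution P x u ω₀ g h m (IsMLSolution x) est ∨
        ConsistentSolution P x u ω₀ g h m (IsREMLSolution x) est) →
      ∀ i j : ℕ,
        IsLittleOp P
          (fun t s =>
            (blupα x (g t) (h t) (m t) (response x (g t) (h t) (m t) ω₀.1 u s)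
                (est t (response x (g t) (h t) (m t) ω₀.1 u s)) i - u.α i s)
            - (avg (h t) (fun l => u.γ (i, l) s)
                - avg (g t) (fun r => Ha x D1 (g t) i r * u.α r s)))
          (fun t => 1 / √(g t : ℝ) + 1 / √(h t : ℝ)) ∧
        IsLittleOp P
          (fun t s =>
            (blupβ x (g t) (h t) (m t) (response x (g t) (h t) (m t) ω₀.1 u s)
                (est t (response x (g t) (h t) (m t) ω₀.1 u s)) j - u.β j s)
            - (avg (g t) (fun r => u.γ (r, j) s)
                - avg (h t) (fun l => Hb x D2 (h t) j l * u.β l s)))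
          (fun t => 1 / √(g t : ℝ) + 1 / √(h t : ℝ)) ∧
        ∃ R₁ R₂ : ℕ → Ω → ℝ,
          IsBigOp P R₁ (fun t => 1 / (m t : ℝ)) ∧
          IsLittleOp P R₂ (fun t => 1 / √(g t : ℝ) + 1 / √(h t : ℝ)) ∧
          ∀ t s,
            blupγ x (g t) (h t) (m t) (response x (g t) (h t) (m t) ω₀.1 u s)
                (est t (response x (g t) (h t) (m t) ω₀.1 u s)) i j - u.γ (i, j) s
            = avg (m t) (fun k => u.e (i, j, k) s)
                - avg (h t) (fun l => u.γ (i, l) s) - avg (g t) (fun r => u.γ (r, j) s)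
                + R₁ t s + R₂ t s := by
  have hθ₀ := pos_of_mem_interior_parameterSpace hω₀
  refine ⟨exists_consistentSolution fun η hη => ?_, exists_consistentSolution fun η hη => ?_,
    fun est hest i j => ?_⟩
  · filter_upwards [eventually_exists_isLocalMin_profileCrit hx hu hθ₀ hg hh hm hη] with q hq
    obtain ⟨⟨hg, hh, hm⟩, hinj, hq⟩ := hq
    obtain ⟨θ, hθ, hmin, hd⟩ := hq _ rfl 0 le_rfl zero_le_one
    exact ⟨_, isMLSolution_of_isLocalMin hg hh hm hθ hinj hmin, hd⟩
  · filter_upwards [eventually_exists_isLocalMin_profileCrit hx hu hθ₀ hg hh hm hη] with q hq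
    obtain ⟨⟨hg, hh, hm⟩, hinj, hq⟩ := hq
    obtain ⟨θ, hθ, hmin, hd⟩ := hq _ rfl 1 zero_le_one le_rfl
    exact ⟨_, isREMLSolution_of_isLocalMin hg hh hm hθ hinj hmin, hd⟩
  · have hadm : IsAdmissible P x u ω₀ g h m
        (fun q => est q.1 (response x (g q.1) (h q.1) (m q.1) ω₀.1 u q.2)) :=
      hest.elim (fun h => h.isAdmissible hθ₀ fun _ _ _ _ _ h => h.isScoreZero)
        fun h => h.isAdmissible hθ₀ fun _ _ _ _ _ h => h.isScoreZero
    obtain ⟨h1, h2, R₁, hR₁, h3⟩ := hadm.expansions hx hu hθ₀ hg hh hm hD1 hD2 i j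
    have hpos : ∀ᶠ t in atTop, 0 < 1 / √(g t : ℝ) + 1 / √(h t : ℝ) := by
      filter_upwards [eventually_pos_of_tendsto hg] with t ht
      positivity
    -- R₂ is defined as the remainder, so the identity for the interaction predictor holds for every
    -- t and s, and only the order of R₂ is at stake.
    refine ⟨isLittleOp_of_isLittleO hpos h1, isLittleOp_of_isLittleO hpos h2, R₁,
      fun t s => (blupγ x (g t) (h t) (m t) (response x (g t) (h t) (m t) ω₀.1 u s)
          (est t (response x (g t) (h t) (m t) ω₀.1 u s)) i j - u.γ (i, j) s)
        - (avg (m t) (fun k => u.e (i, j, k) s) - avg (h t) (fun l => u.γ (i, l) s)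
          - avg (g t) (fun r => u.γ (r, j) s) + R₁ t s),
      hR₁, isLittleOp_of_isLittleO hpos h3, fun t s => by ring⟩
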